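/- **Setting.** Let $n\ge 1$, $Y=[0,1)^n$ with centre $y^{\rm c}$, and let $Y_1\subset Y$ be a non-empty open subset of $\mathbf R^n$ with Lipschitz boundary. Let $0<r_1<r_2<1$ and $Y_{1,r}:=r(Y_1-y^{\rm c})+y^{\rm c}$ for $r\in[r_1,r_2]$. Let $\mu$ be a probability measure on $\mathbf R$ concentrated on $\{0\}\cup[r_1,r_2]$, whose restriction to $[r_1,r_2]$ is absolutely continuous with respect to Lebesgue measure and gives positive mass to every non-empty open subinterval of $[r_1,r_2]$. Let $\widetilde\Omega$ be the space of real families $\widetilde\omega=(\widetilde\omega_z)_{z\in\mathbf Z^n}$ with the product measure $\widetilde P=\mu^{\otimes\mathbf Z^n}$ (independent components with law $\mu$), and let $\Omega=\widetilde\Omega\times Y$, $P=\widetilde P\times dy$, with the dynamical system $$T_x(\widetilde\omega,y)=\bigl((\widetilde\omega_{j+[x+y]})_{j\in\mathbf Z^n},\;x+y-[x+y]\bigr),\qquad x\in\mathbf R^n,$$ where $[\cdot]$ is the componentwise integer part. Let $D_if=\lim_{h\to0}h^{-1}(f\circ T_{he_i}-f)$ (limit in $L^2(\Omega)$), $\nabla_\omega=(D_1,\dots,D_n)$,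 and let $W^{1,2}(\Omega)$ be the set of $f\in L^2(\Omega)$ for which all $D_if$ exist. Put $$\mathcal O=\{(\widetilde\omega,y):\ \widetilde\omega_0\in[r_1,r_2],\ y\in Y_{1,\widetilde\omega_0}\},\qquad W^{1,2}_0(\mathcal O)=\{v\in W^{1,2}(\Omega):\ v=0\text{ a.e. on }\Omega\setminus\mathcal O\}.$$ All function spaces are complex-valued. Let $-\Delta_\omega$ be the operator in $L^2(\mathcal O)$ generated by the form $\int_{\mathcal O}\nabla_\omega u\cdot\overline{\nabla_\omega v}\,dP$, $u,v\in W^{1,2}_0(\mathcal O)$; that is, $u$ is in its domain with $-\Delta_\omega u=f$ iff $u\in W_0^{1,2}(\mathcal O)$, $f\in L^2(\mathcal O)$ and $\int_{\mathcal O}\nabla_\omega u\cdot\overline{\nabla_\omega v}\,dP=\int_{\mathcal O}f\,\overline v\,dP$ for all $v\in W^{1,2}_0(\mathcal O)$. For a bounded open set $D\subset\mathbf R^n$, consider the Dirichlet Laplacian in $L^2(D)$, generated by $\int_D\nabla u\cdot\overline{\nabla v}$ on $W^{1,2}_0(D)$, the closure of $C_c^\infty(D)$ in $W^{1,2}(D)$.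 Let $\{\nu_{j}\}$ be the set of its eigenvalues that have an eigenfunction with non-zero integral over $D$, and $\{\nu'_{j}\}$ the set of its eigenvalues that have a (non-zero) eigenfunction with zero integral over $D$. Write $\nu_{j},\nu'_{j}$ for the eigenvalues so obtained with $D=Y_1$, and $\nu_{j,r},\nu_{j,r}'$ for those with $D=Y_{1,r}$. **Lemma.** The operator $-\Delta_\omega$ is well defined (single-valued), and its spectrum is $$\sigma(-\Delta_\omega)=\bigcup_{r\in[r_1,r_2]}\Bigl(\{\nu_{j,r}\}_j\cup\{\nu'_{j,r}\}_j\Bigr),$$ where, for every $r\in[r_1,r_2]$, $\{\nu_{j,r}\}_j=\{r^{-2}\nu_j\}_j$ and $\{\nu'_{j,r}\}_j=\{r^{-2}\nu'_j\}_j$. The operator $-\Delta_\omega$ has no eigenvalues, and its spectrum is purely continuous: for every $\lambda\in\sigma(-\Delta_\omega)$ the operator $-\Delta_\omega-\lambda$ is injective with dense range. -/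

import Mathlib

open MeasureTheory Filter Topology

namespace RandomInclusion

noncomputable section

/-- `ℝⁿ` with its Euclidean norm. -/
abbrev E (n : ℕ) : Type := EuclideanSpace ℝ (Fin n)

/-- The `i`-th coordinate vector of `ℝⁿ`. -/
def basisVec {n : ℕ} (i : Fin n) : E n := EuclideanSpace.single i 1

/-! ### Operators generated by forms, and their spectra

An unbounded operator `A` on a Hilbert space `H` is represented by its graph, the set of all pairs
`(u, A u)` with `u` in the domain of `A`. -/

section Operators

variable {H K : Type*} [NormedAddCommGroup H] [InnerProductSpace ℂ H]
  [NormedAddCommGroup K] [InnerProductSpace ℂ K]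

/-- Let `G` be the graph of a gradient, i.e. the set of pairs `(u, ∇u)` where `u` runs through the
form domain. This is the graph of the operator generated by the form `∫ ∇u · ∇v`: the pair `(u, f)`
belongs to it iff `u` is in the form domain and `∑ i, ⟪∂ᵢ v, ∂ᵢ u⟫ = ⟪v, f⟫` for all `v` in
the form domain. -/
def formOperator {n : ℕ} (G : Set (H × (Fin n → K))) : Set (H × H) :=
  {p | ∃ g : Fin n → K, (p.1, g) ∈ G ∧
    ∀ (v : H) (h : Fin n → K), (v, h) ∈ G → ∑ i, inner ℂ (h i) (g i) = inner ℂ v p.2}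

/-- The resolvent set of the operator with graph `A`: those `z` for which `A - z` is a bijection
from the domain of `A` onto `H` with a bounded inverse `R`. -/
def opResolventSet (A : Set (H × H)) : Set ℂ :=
  {z | ∃ R : H →L[ℂ] H, ∀ u f : H, (u, f + z • u) ∈ A ↔ u = R f}

/-- The spectrum of the operator with graph `A`. -/
def opSpectrum (A : Set (H × H)) : Set ℂ := (opResolventSet A)ᶜ

/-- The set of eigenvalues (the point spectrum) of the operator with graph `A`. -/
def opEigenvalues (A : Set (H × H)) : Set ℂ := {z | ∃ u : H, u ≠ 0 ∧ (u, z • u) ∈ A}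

/-- The continuous spectrum of the operator with graph `A`: those points `z` of the spectrum for
which `A - z` is injective with dense range. -/
def opContinuousSpectrum (A : Set (H × H)) : Set ℂ :=
  {z | z ∈ opSpectrum A ∧ (∀ u : H, (u, z • u) ∈ A → u = 0) ∧
    Dense {f : H | ∃ u : H, (u, f + z • u) ∈ A}}

end Operators

/-! ### The Dirichlet Laplacian of an open set of `ℝⁿ` -/

/-- Complex-valued `L²(D)`. -/
abbrev L2 {n : ℕ} (D : Set (E n)) : Type := Lp ℂ 2 ((volume : Measure (E n)).restrict D)

/-- The pairs `(u, ∇u)` with `u ∈ W₀^{1,2}(D)`, where `W₀^{1,2}(D)` is the closure of `C_c^∞(D)` in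
`W^{1,2}(D)`: there are test functions `φ k` on `D` with `φ k → u` and `∂ᵢ (φ k) → g i` in
`L²(D)`. -/
def dirichletGradient {n : ℕ} (D : Set (E n)) : Set (L2 D × (Fin n → L2 D)) :=
  {p | ∃ φ : ℕ → E n → ℂ,
    (∀ k, ContDiff ℝ ((⊤ : ℕ∞) : WithTop ℕ∞) (φ k) ∧ HasCompactSupport (φ k) ∧ tsupport (φ k) ⊆ D) ∧
    Tendsto (fun k => eLpNorm (fun x => φ k x - p.1 x) 2 (volume.restrict D)) atTop (𝓝 0) ∧
    ∀ i, Tendsto (fun k => eLpNorm (fun x => fderiv ℝ (φ k) x (basisVec i) - p.2 i x) 2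
      (volume.restrict D)) atTop (𝓝 0)}

/-- The (graph of the) Laplacian `-Δ` on `D` with Dirichlet boundary condition. -/
def dirichletLaplacian {n : ℕ} (D : Set (E n)) : Set (L2 D × L2 D) :=
  formOperator (dirichletGradient D)

/-- The set `{ν_j}` of those eigenvalues of the Dirichlet Laplacian on `D` that have an
eigenfunction with non-zero integral over `D`. -/
def nuSet {n : ℕ} (D : Set (E n)) : Set ℝ :=
  {ν | ∃ u : L2 D, u ≠ 0 ∧ (u, (ν : ℂ) • u) ∈ dirichletLaplacian D ∧ ∫ x in D, u x ≠ 0}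

/-- The set `{ν'_j}` of those eigenvalues of the Dirichlet Laplacian on `D` that have an
eigenfunction with zero integral over `D`. -/
def nuPrimeSet {n : ℕ} (D : Set (E n)) : Set ℝ :=
  {ν | ∃ u : L2 D, u ≠ 0 ∧ (u, (ν : ℂ) • u) ∈ dirichletLaplacian D ∧ ∫ x in D, u x = 0}

/-- `D` has Lipschitz boundary: near each boundary point, for a suitable direction `e`, the set `D`
is the region above the graph, over the hyperplane orthogonal to `e`, of a Lipschitz function. -/
def HasLipschitzBoundary {n : ℕ} (D : Set (E n)) : Prop :=
  ∀ p ∈ frontier D, ∃ e : E n, ‖e‖ = 1 ∧ ∃ (L : NNReal) (γ : (Submodule.span ℝ {e})ᗮ → ℝ) (ρ : ℝ),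
    LipschitzWith L γ ∧ 0 < ρ ∧ ∀ x ∈ Metric.ball p ρ,
      (x ∈ D ↔ γ ((Submodule.span ℝ {e})ᗮ.orthogonalProjectionOnto x) < inner ℝ e x)

/-! ### The probability space and the dynamical system -/

/-- The cell `Y = [0,1)ⁿ`. -/
def cell (n : ℕ) : Set (E n) := {y | ∀ i, y i ∈ Set.Ico (0 : ℝ) 1}

/-- The centre of the cell. -/
def cellCentre (n : ℕ) : E n := WithLp.toLp 2 fun _ => 1 / 2

/-- The scaled inclusion `Y_{1,r} = r (Y₁ - y^c) + y^c`. -/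
def scaled {n : ℕ} (Y₁ : Set (E n)) (r : ℝ) : Set (E n) :=
  (fun y => r • (y - cellCentre n) + cellCentre n) '' Y₁

/-- `Ω = Ω̃ × Y`, where `Ω̃` consists of the families `(ω̃_z)` of real numbers indexed by `ℤⁿ`. -/
abbrev Om (n : ℕ) : Type := ((Fin n → ℤ) → ℝ) × cell n

/-- `P = P̃ × dy`, where `P̃` makes the `ω̃_z` independent with common law `μ`. -/
def prob (n : ℕ) (μ : Measure ℝ) [IsProbabilityMeasure μ] : Measure (Om n) :=
  (Measure.infinitePi fun _ : Fin n → ℤ => μ).prod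
    (Measure.comap (Subtype.val : cell n → E n) volume)

/-- The dynamical system `T_x (ω̃, y) = (T̃_{[x+y]} ω̃, x + y - [x+y])`, where `T̃_z` is the shift
`(T̃_z ω̃)_j = ω̃_{j+z}`. -/
def T {n : ℕ} (x : E n) (ω : Om n) : Om n :=
  (fun j => ω.1 (j + fun i => ⌊x i + ω.2.1 i⌋),
    ⟨WithLp.toLp 2 fun i => Int.fract (x i + ω.2.1 i),
      fun i => ⟨Int.fract_nonneg (x i + ω.2.1 i), Int.fract_lt_one (x i + ω.2.1 i)⟩⟩)

/-- `d = D_i f` for the infinitesimal generator `D_i` in `L²(Ω)`: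
`(f ∘ T_{h e_i} - f) / h → d` in `L²(Ω)` as `h → 0`. -/
def IsStochDeriv {n : ℕ} (μ : Measure ℝ) [IsProbabilityMeasure μ] (i : Fin n)
    (f d : Om n → ℂ) : Prop :=
  MemLp f 2 (prob n μ) ∧ MemLp d 2 (prob n μ) ∧
  Tendsto (fun h : ℝ => eLpNorm (fun ω => (f (T (h • basisVec i) ω) - f ω) / (h : ℂ) - d ω) 2
    (prob n μ)) (𝓝[≠] 0) (𝓝 0)

/-- The set `𝒪` of those `(ω̃, y)` with `ω̃_0 ∈ [r₁, r₂]` and `y ∈ Y_{1, ω̃_0}`. -/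
def inclusionSet {n : ℕ} (Y₁ : Set (E n)) (r₁ r₂ : ℝ) : Set (Om n) :=
  {ω | ω.1 0 ∈ Set.Icc r₁ r₂ ∧ (ω.2 : E n) ∈ scaled Y₁ (ω.1 0)}

/-- Complex-valued `L²(𝒪)`. -/
abbrev L2O {n : ℕ} (μ : Measure ℝ) [IsProbabilityMeasure μ] (O : Set (Om n)) : Type :=
  Lp ℂ 2 ((prob n μ).restrict O)

/-- The pairs `(v, ∇_ω v)`, both as functions on `𝒪`, where `v` runs through `W₀^{1,2}(𝒪)`, the
space of those functions in `W^{1,2}(Ω) = ⋂ᵢ dom D_i` that vanish outside `𝒪`. -/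
def stochGradient {n : ℕ} (μ : Measure ℝ) [IsProbabilityMeasure μ] (O : Set (Om n)) :
    Set (L2O μ O × (Fin n → L2O μ O)) :=
  {p | ∃ d : Fin n → Om n → ℂ, ∀ i, IsStochDeriv μ i (O.indicator p.1) (d i) ∧
    p.2 i =ᵐ[(prob n μ).restrict O] d i}

/-- The (graph of the) operator `-Δ_ω` on `L²(𝒪)` generated by the form `∫_𝒪 ∇_ω u · ∇_ω v` on
`W₀^{1,2}(𝒪)`. -/
def stochLaplacian {n : ℕ} (μ : Measure ℝ) [IsProbabilityMeasure μ] (O : Set (Om n)) :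
    Set (L2O μ O × L2O μ O) :=
  formOperator (stochGradient μ O)

/-- The operator `-Δ_ω` in the example of inclusions of random size. -/
def randomSizeLaplacian {n : ℕ} (Y₁ : Set (E n)) (r₁ r₂ : ℝ) (μ : Measure ℝ)
    [IsProbabilityMeasure μ] :
    Set (L2O μ (inclusionSet Y₁ r₁ r₂) × L2O μ (inclusionSet Y₁ r₁ r₂)) :=
  stochLaplacian μ (inclusionSet Y₁ r₁ r₂)

end

end RandomInclusion

open RandomInclusion

/-!
The random inclusion `𝒪` is a product in disguise. Rescaling the fibre over `ω̃` by the size `ω̃₀`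
maps it onto the reference inclusion `Y₁`, and `P` to `m ⊗ dx` with `m = ω̃₀ⁿ P̃` on the sizes in
`[r₁, r₂]`; hence `L²(𝒪) ≅ L²(m) ⊗ L²(Y₁)`. Inside one cell the flow `T_x` is a translation of the
second variable, so the stochastic gradient becomes `ω̃₀⁻¹` times the gradient in `x`, and `-Δ_ω`
becomes `ω̃₀⁻² ⊗ (-Δ)` with the Dirichlet Laplacian of `Y₁` as second factor. Expanding in Dirichlet
eigenfunctions `e_k` with eigenvalues `λ_k` turns `-Δ_ω` into the direct sum over `k` of the
multiplications by `λ_k / ω̃₀²` on `L²(m)` (`exists_isDiagonal`). The rest concerns multiplication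
operators. The support condition on `μ` makes every `λ_k / r²` belong to the spectrum. The
eigenvalues accumulate only at infinity and `[r₁, r₂]` is compact, so that off these values the
multipliers are bounded away from `z` and the resolvent exists. Absolute continuity of `μ` makes
`λ_k / ω̃₀² ≠ z` almost surely, because `λ_k > 0`; this leaves no eigenvalues and makes all ranges
dense. Scaling `Y₁` by `r` divides the eigenvalues by `r²`.

The steps of substance are these.

* The flow preserves `P`, hence acts by isometries on `L²(Ω)`, and the `Dᵢ` are closed and
  skew-symmetric. Rescaled test functions, and by closure rescaled elements of `W₀^{1,2}(Y₁)`, are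
  differentiable along the flow (`hasDerivAt_blow`). A function that vanishes off `𝒪` has
  derivatives that vanish off `𝒪` (`ae_zero_of_hasDerivAt`), so the form lives on `L²(𝒪)`.
* Elements of the stochastic form domain are only known to vanish off `𝒪`, whereas the Dirichlet
  form domain is a closure of test functions. Let `v` be in the former. Averaging the rescaled `v`
  against a weight in `ω̃` gives a function on `ℝⁿ` that vanishes off `Y₁` and, by testing against
  rescaled test functions, has a weak gradient in `L²`. Here the Lipschitz boundary enters: such a
  function can be pushed inwards locally along the graph direction and mollified, so it lies in
  `W₀^{1,2}(Y₁)` (`mem_dirichletGradient_of_isWeakGrad`, `average_mem_dirichletGradient`). It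
  follows that `h ⊗ e_k` belongs to the operator domain (`blowO_mem_stochLaplacian`).
* The eigenbasis (`exists_dirichlet_eigenbasis`) comes from the resolvent at `-1`, which is
  symmetric, and compact because step functions approximate bounded sets of `W₀^{1,2}(Y₁)` uniformly
  in `L²` (`isCompactOperator_dirichlet`). All `λ_k > 0` by the Poincaré inequality (`poincare`).
-/

namespace RandomInclusion

noncomputable section

/-! ### The resolvent of the operator generated by a closed form -/

section FormResolvent

variable {H K : Type*} [NormedAddCommGroup H] [InnerProductSpace ℂ H]
  [NormedAddCommGroup K] [InnerProductSpace ℂ K] {n : ℕ}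

/-- The graph of a gradient as a subspace of the Hilbert space `H ⊕ Kⁿ`, so that its inner product
is the form plus the inner product of `H`. -/
def graphSpace (G : Submodule ℂ (H × (Fin n → K))) :
    Submodule ℂ (WithLp 2 (H × PiLp 2 fun _ : Fin n => K)) :=
  G.comap ((LinearMap.prodMap LinearMap.id (WithLp.linearEquiv 2 ℂ (Fin n → K)).toLinearMap) ∘ₗ
    (WithLp.linearEquiv 2 ℂ (H × PiLp 2 fun _ : Fin n => K)).toLinearMap)

theorem isClosed_graphSpace {G : Submodule ℂ (H × (Fin n → K))}
    (hG : IsClosed (G : Set (H × (Fin n → K)))) :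
    IsClosed (graphSpace G : Set (WithLp 2 (H × PiLp 2 fun _ : Fin n => K))) := by
  have : (graphSpace G : Set (WithLp 2 (H × PiLp 2 fun _ : Fin n => K)))
      = (fun x => (x.fst, fun i => x.snd i)) ⁻¹' (G : Set (H × (Fin n → K))) := rfl
  rw [this]
  apply hG.preimage
  have h1 := WithLp.prod_continuous_ofLp 2 H (PiLp 2 fun _ : Fin n => K)
  refine (continuous_fst.comp h1).prodMk ?_
  exact (PiLp.continuous_ofLp 2 fun _ : Fin n => K).comp (continuous_snd.comp h1)

/-- A presentation of the form domain with its graph norm: a Hilbert space `X` with an embedding `J`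
into `H` and a gradient `D` whose joint graph is `G`. -/
structure FormSpace (G : Set (H × (Fin n → K))) (X : Type*) [NormedAddCommGroup X]
    [InnerProductSpace ℂ X] where
  /-- The embedding of the form domain. -/
  J : X →L[ℂ] H
  /-- The gradient. -/
  D : X → Fin n → K
  mem_iff : ∀ u g, (u, g) ∈ G ↔ ∃ x, J x = u ∧ D x = g
  inner_eq : ∀ x y, inner ℂ x y = inner ℂ (J x) (J y) + ∑ i, inner ℂ (D x i) (D y i)

/-- The form domain of a closed form is a Hilbert space. -/
theorem exists_formSpace.{u, v} {H : Type u} {K : Type v} [NormedAddCommGroup H]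
    [InnerProductSpace ℂ H] [NormedAddCommGroup K] [InnerProductSpace ℂ K] [CompleteSpace H]
    [CompleteSpace K] (G : Submodule ℂ (H × (Fin n → K)))
    (hG : IsClosed (G : Set (H × (Fin n → K)))) :
    ∃ (X : Type (max u v)) (_ : NormedAddCommGroup X) (_ : InnerProductSpace ℂ X)
      (_ : CompleteSpace X),
      Nonempty (FormSpace (G : Set (H × (Fin n → K))) X) := by
  refine ⟨graphSpace G, inferInstance, inferInstance,
    (isClosed_graphSpace hG).completeSpace_coe, ⟨?_⟩⟩
  exact
    { J := WithLp.fstL 2 ℂ H (PiLp 2 fun _ : Fin n => K) ∘L (graphSpace G).subtypeL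
      D := fun x i => x.1.snd i
      mem_iff := fun u g => by
        constructor
        · intro h
          exact ⟨⟨WithLp.toLp 2 (u, WithLp.toLp 2 g), h⟩, rfl, rfl⟩
        · rintro ⟨x, rfl, rfl⟩
          exact x.2
      inner_eq := fun x y => by
        rw [Submodule.coe_inner, WithLp.prod_inner_apply, PiLp.inner_apply]
        rfl }

namespace FormSpace

variable {G : Set (H × (Fin n → K))} {X : Type*} [NormedAddCommGroup X] [InnerProductSpace ℂ X]
  [CompleteSpace H] [CompleteSpace X]

/-- The resolvent `(A + 1)⁻¹` of the operator `A` generated by a closed form. -/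
def res (F : FormSpace G X) : H →L[ℂ] H := F.J ∘L F.J.adjoint

theorem res_isSymmetric (F : FormSpace G X) : F.res.IsSymmetric := by
  intro x y
  change inner ℂ (F.J (F.J.adjoint x)) y = inner ℂ x (F.J (F.J.adjoint y))
  rw [← ContinuousLinearMap.adjoint_inner_right, ContinuousLinearMap.adjoint_inner_left]

/-- `(A + 1) u = f + u` iff `u = (A + 1)⁻¹ (f + u)`. -/
theorem mem_formOperator_iff (F : FormSpace G X) {u f : H} :
    (u, f) ∈ formOperator G ↔ u = F.res (f + u) := by
  constructor
  · rintro ⟨g, hg, h⟩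
    obtain ⟨w, hw, hwg⟩ := (F.mem_iff u g).1 hg
    have : F.J.adjoint (f + u) = w := by
      refine ext_inner_left ℂ fun v => ?_
      rw [ContinuousLinearMap.adjoint_inner_right, inner_add_right, F.inner_eq, hw, hwg,
        h (F.J v) (F.D v) ((F.mem_iff _ _).2 ⟨v, rfl, rfl⟩), add_comm]
    rw [res, ContinuousLinearMap.comp_apply, this, hw]
  · intro h
    refine ⟨F.D (F.J.adjoint (f + u)), (F.mem_iff _ _).2 ⟨_, h.symm, rfl⟩, fun v k hv => ?_⟩
    obtain ⟨x, rfl, rfl⟩ := (F.mem_iff v k).1 hv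
    have := ContinuousLinearMap.adjoint_inner_right F.J x (f + u)
    rw [F.inner_eq, inner_add_right] at this
    have h2 : F.J (F.J.adjoint (f + u)) = u := h.symm
    rw [h2] at this
    dsimp only
    linear_combination this

/-- The resolvent of a densely defined closed form is injective. -/
theorem eq_zero_of_res_eq_zero (F : FormSpace G X)
    {f : H} (hd : (∀ u g, (u, g) ∈ G → inner ℂ u f = 0) → f = 0) (hf : F.res f = 0) : f = 0 := by
  have h0 : F.J.adjoint f = 0 := by
    rw [← inner_self_eq_zero (𝕜 := ℂ), ContinuousLinearMap.adjoint_inner_left]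
    have : F.J (F.J.adjoint f) = 0 := hf
    rw [this, inner_zero_right]
  refine hd fun u g hg => ?_
  obtain ⟨x, rfl, rfl⟩ := (F.mem_iff u g).1 hg
  rw [← ContinuousLinearMap.adjoint_inner_right, h0, inner_zero_right]

end FormSpace

end FormResolvent

/-! ### Generators of one-parameter groups of isometries -/

section Generator

variable {H : Type*} [NormedAddCommGroup H] [InnerProductSpace ℂ H]
  {U : ℝ → H →ₗᵢ[ℂ] H}

theorem hasDerivAt_group (hU : ∀ s t x, U (s + t) x = U s (U t x)) {f d : H}
    (h : HasDerivAt (fun t => U t f) d 0) (s : ℝ) : HasDerivAt (fun t => U t f) (U s d) s := by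
  have h1 : (fun t => U t f) = fun t => U s (U (t - s) f) := by
    funext t
    rw [← hU]
    congr 2
    ring
  rw [h1]
  have h2 : HasDerivAt (fun t => U (t - s) f) d s := by
    have := HasDerivAt.comp_sub_const (x := s) (a := s) (f := fun t => U t f) (f' := d)
      (by simpa using h)
    exact this
  exact ((U s).toContinuousLinearMap.restrictScalars ℝ).hasFDerivAt.comp_hasDerivAt s h2

/-- The generator of a group of isometries is closed. -/
theorem hasDerivAt_group_of_tendsto (hU : ∀ s t x, U (s + t) x = U s (U t x))
    {ι : Type*} {l : Filter ι} [NeBot l] {f d : ι → H} {f₀ d₀ : H}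
    (h : ∀ k, HasDerivAt (fun t => U t (f k)) (d k) 0)
    (hf : Tendsto f l (𝓝 f₀)) (hd : Tendsto d l (𝓝 d₀)) (hU0 : ∀ x, U 0 x = x) :
    HasDerivAt (fun t => U t f₀) d₀ 0 := by
  have := hasDerivAt_of_tendstoUniformly (l := l) (f := fun k t => U t (f k))
    (f' := fun k t => U t (d k)) (g := fun t => U t f₀) (g' := fun t => U t d₀) ?_
    (Eventually.of_forall fun k t => hasDerivAt_group hU (h k) t)
    (fun t => ((U t).continuous.tendsto f₀).comp hf) 0
  · simpa [hU0] using this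
  · rw [Metric.tendstoUniformly_iff]
    intro ε hε
    filter_upwards [Metric.tendsto_nhds.1 hd ε hε] with k hk t
    rw [(U t).isometry.dist_eq, dist_comm]
    exact hk

/-- The generator of a group of isometries is skew-symmetric. -/
theorem inner_group_deriv (hU0 : ∀ x, U 0 x = x) {f d w e : H}
    (h : HasDerivAt (fun t => U t f) d 0) (h' : HasDerivAt (fun t => U t w) e 0) :
    inner ℂ d w = - inner ℂ f e := by
  have h1 := h.inner ℂ h'
  have h2 : (fun t => inner ℂ (U t f) (U t w)) = fun _ => inner ℂ f w := by
    funext t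
    rw [(U t).inner_map_map]
  rw [h2, hU0, hU0] at h1
  have := h1.unique (hasDerivAt_const (0 : ℝ) _)
  linear_combination this

end Generator

/-! ### Operations on `L²` spaces -/

section Lebesgue

variable {α β : Type*} [MeasurableSpace α] [MeasurableSpace β]

/-- Extension by zero `L²(s) → L²`. -/
def extL2 (μ : Measure α) {s : Set α} (hs : MeasurableSet s) :
    Lp ℂ 2 (μ.restrict s) →ₗᵢ[ℂ] Lp ℂ 2 μ where
  toFun f := ((memLp_indicator_iff_restrict hs).2 (Lp.memLp f)).toLp (s.indicator f)
  map_add' f g := by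
    rw [← MemLp.toLp_add]
    apply MemLp.toLp_congr
    have := (ae_restrict_iff' hs).1 (Lp.coeFn_add f g)
    filter_upwards [this] with x hx
    by_cases h : x ∈ s
    · simp only [Pi.add_apply, Set.indicator_of_mem h, hx h]
    · simp only [Pi.add_apply, Set.indicator_of_notMem h, add_zero]
  map_smul' c f := by
    simp only [RingHom.id_apply]
    rw [← MemLp.toLp_const_smul]
    apply MemLp.toLp_congr
    have := (ae_restrict_iff' hs).1 (Lp.coeFn_smul c f)
    filter_upwards [this] with x hx
    by_cases h : x ∈ s
    · simp only [Pi.smul_apply, Set.indicator_of_mem h, hx h]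
    · simp only [Pi.smul_apply, Set.indicator_of_notMem h, smul_zero]
  norm_map' f := by
    change ‖((memLp_indicator_iff_restrict hs).2 (Lp.memLp f)).toLp (s.indicator f)‖ = _
    rw [Lp.norm_toLp, eLpNorm_indicator_eq_eLpNorm_restrict hs, Lp.norm_def]

variable {μ : Measure α} {s : Set α} (hs : MeasurableSet s)

theorem coeFn_extL2 (f : Lp ℂ 2 (μ.restrict s)) : extL2 μ hs f =ᵐ[μ] s.indicator f :=
  ((memLp_indicator_iff_restrict hs).2 (Lp.memLp f)).coeFn_toLp

/-- Restriction `L² → L²(s)`. -/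
abbrev resL2 (μ : Measure α) (s : Set α) : Lp ℂ 2 μ →L[ℂ] Lp ℂ 2 (μ.restrict s) :=
  LpToLpRestrictCLM α ℂ ℂ μ 2 s

theorem coeFn_resL2 (f : Lp ℂ 2 μ) : resL2 μ s f =ᵐ[μ.restrict s] f :=
  LpToLpRestrictCLM_coeFn ℂ s f

theorem resL2_extL2 (f : Lp ℂ 2 (μ.restrict s)) : resL2 μ s (extL2 μ hs f) = f := by
  apply Lp.ext
  filter_upwards [coeFn_resL2 (s := s) (extL2 μ hs f), ae_restrict_of_ae (coeFn_extL2 hs f),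
    ae_restrict_mem hs] with x h1 h2 h3
  rw [h1, h2, Set.indicator_of_mem h3]

theorem coeFn_extL2_resL2 (f : Lp ℂ 2 μ) : extL2 μ hs (resL2 μ s f) =ᵐ[μ] s.indicator f := by
  filter_upwards [coeFn_extL2 hs (resL2 μ s f),
    (ae_restrict_iff' hs).1 (coeFn_resL2 (s := s) f)] with x h1 h2
  rw [h1]
  by_cases h : x ∈ s
  · simp [h, h2 h]
  · simp [h]

theorem inner_extL2 (f : Lp ℂ 2 (μ.restrict s)) (g : Lp ℂ 2 μ) :
    inner ℂ (extL2 μ hs f) g = inner ℂ f (resL2 μ s g) := by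
  rw [L2.inner_def, L2.inner_def, ← integral_indicator hs]
  apply integral_congr_ae
  filter_upwards [coeFn_extL2 hs f, (ae_restrict_iff' hs).1 (coeFn_resL2 (s := s) g)] with x h1 h2
  by_cases h : x ∈ s
  · simp [h, h1, h2 h]
  · simp [h, h1]

theorem memLp_mul_of_bound {μ : Measure α} {a : α → ℂ} {C : ℝ} (ha : AEStronglyMeasurable a μ)
    (hC : ∀ᵐ x ∂μ, ‖a x‖ ≤ C) (f : Lp ℂ 2 μ) : MemLp (fun x => a x * f x) 2 μ := by
  refine (Lp.memLp f).of_le_mul (c := C) (ha.mul (Lp.aestronglyMeasurable f)) ?_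
  filter_upwards [hC] with x hx
  rw [norm_mul]
  gcongr

/-- Multiplication by a bounded measurable function on `L²`. -/
def mulL2 (μ : Measure α) (a : α → ℂ) (C : ℝ) (ha : AEStronglyMeasurable a μ)
    (hC : ∀ᵐ x ∂μ, ‖a x‖ ≤ C) : Lp ℂ 2 μ →L[ℂ] Lp ℂ 2 μ :=
  LinearMap.mkContinuous
    { toFun := fun f => (memLp_mul_of_bound ha hC f).toLp _
      map_add' := fun f g => by
        rw [← MemLp.toLp_add]
        apply MemLp.toLp_congr
        filter_upwards [Lp.coeFn_add f g] with x hx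
        simp only [hx, Pi.add_apply, mul_add]
      map_smul' := fun c f => by
        rw [RingHom.id_apply, ← MemLp.toLp_const_smul]
        apply MemLp.toLp_congr
        filter_upwards [Lp.coeFn_smul c f] with x hx
        simp only [hx, Pi.smul_apply, smul_eq_mul]
        ring }
    C fun f => by
      apply Lp.norm_le_mul_norm_of_ae_le_mul
      filter_upwards [(memLp_mul_of_bound ha hC f).coeFn_toLp, hC] with x h1 h2
      change ‖(memLp_mul_of_bound ha hC f).toLp _ x‖ ≤ _
      rw [h1, norm_mul]
      gcongr

theorem coeFn_mulL2 {a : α → ℂ} {C : ℝ} (ha : AEStronglyMeasurable a μ)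
    (hC : ∀ᵐ x ∂μ, ‖a x‖ ≤ C) (f : Lp ℂ 2 μ) :
    mulL2 μ a C ha hC f =ᵐ[μ] fun x => a x * f x :=
  (memLp_mul_of_bound ha hC f).coeFn_toLp

theorem norm_mulL2_le {a : α → ℂ} {C : ℝ} (h0 : 0 ≤ C) (ha : AEStronglyMeasurable a μ)
    (hC : ∀ᵐ x ∂μ, ‖a x‖ ≤ C) : ‖mulL2 μ a C ha hC‖ ≤ C := by
  unfold mulL2
  exact LinearMap.mkContinuous_norm_le _ h0 _

variable {ν : Measure β}

theorem memLp_tensor [SFinite μ] [SFinite ν] {f : α → ℂ} {g : β → ℂ}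
    (hf : MemLp f 2 μ) (hg : MemLp g 2 ν) :
    MemLp (fun p : α × β => f p.1 * g p.2) 2 (μ.prod ν) := by
  have h1 := hf.1.comp_fst (ν := ν)
  have h2 := hg.1.comp_snd (μ := μ)
  refine (memLp_two_iff_integrable_sq_norm (h1.mul h2)).2 ?_
  have := (hf.integrable_norm_pow (by norm_num)).mul_prod (hg.integrable_norm_pow (by norm_num))
  refine this.congr (Eventually.of_forall fun p => ?_)
  simp [mul_pow]

theorem tensor_congr {f f' : α → ℂ} {g g' : β → ℂ} (hf : f =ᵐ[μ] f') (hg : g =ᵐ[ν] g') :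
    (fun p : α × β => f p.1 * g p.2) =ᵐ[μ.prod ν] fun p => f' p.1 * g' p.2 := by
  filter_upwards [Measure.quasiMeasurePreserving_fst.ae_eq_comp hf,
    Measure.quasiMeasurePreserving_snd.ae_eq_comp hg] with p h1 h2
  simp only [Function.comp_apply] at h1 h2
  rw [h1, h2]

variable [SFinite μ] [SFinite ν]

theorem inner_toLp_tensor (f f' : Lp ℂ 2 μ) (g g' : Lp ℂ 2 ν) :
    inner ℂ ((memLp_tensor (Lp.memLp f) (Lp.memLp g)).toLp _)
      ((memLp_tensor (Lp.memLp f') (Lp.memLp g')).toLp _) = inner ℂ f f' * inner ℂ g g' := by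
  rw [L2.inner_def, L2.inner_def, L2.inner_def, ← integral_prod_mul]
  apply integral_congr_ae
  filter_upwards [(memLp_tensor (Lp.memLp f) (Lp.memLp g)).coeFn_toLp,
    (memLp_tensor (Lp.memLp f') (Lp.memLp g')).coeFn_toLp] with p h1 h2
  rw [h1, h2]
  simp
  ring

/-- The function `(x, y) ↦ f x * g y` in `L²(μ × ν)`, as a bilinear map in `f` and `g`. -/
def tensorL2 (μ : Measure α) (ν : Measure β) [SFinite μ] [SFinite ν] :
    Lp ℂ 2 μ →L[ℂ] Lp ℂ 2 ν →L[ℂ] Lp ℂ 2 (μ.prod ν) :=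
  LinearMap.mkContinuous₂
    (LinearMap.mk₂ ℂ (fun f g => (memLp_tensor (Lp.memLp f) (Lp.memLp g)).toLp _)
      (fun f f' g => by
        rw [← MemLp.toLp_add]
        apply MemLp.toLp_congr
        refine (tensor_congr (Lp.coeFn_add f f') (EventuallyEq.refl _ _)).trans
          (Eventually.of_forall fun p => ?_)
        simp [add_mul])
      (fun c f g => by
        rw [← MemLp.toLp_const_smul]
        apply MemLp.toLp_congr
        refine (tensor_congr (Lp.coeFn_smul c f) (EventuallyEq.refl _ _)).trans
          (Eventually.of_forall fun p => ?_)
        simp [mul_assoc])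
      (fun f g g' => by
        rw [← MemLp.toLp_add]
        apply MemLp.toLp_congr
        refine (tensor_congr (EventuallyEq.refl _ _) (Lp.coeFn_add g g')).trans
          (Eventually.of_forall fun p => ?_)
        simp [mul_add])
      (fun c f g => by
        rw [← MemLp.toLp_const_smul]
        apply MemLp.toLp_congr
        refine (tensor_congr (EventuallyEq.refl _ _) (Lp.coeFn_smul c g)).trans
          (Eventually.of_forall fun p => ?_)
        simp
        ring))
    1 fun f g => by
      rw [LinearMap.mk₂_apply]
      apply le_of_eq
      have := inner_toLp_tensor f f g g
      simp only [inner_self_eq_norm_sq_to_K] at this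
      have h2 : ‖(memLp_tensor (Lp.memLp f) (Lp.memLp g)).toLp _‖ ^ 2 = (‖f‖ * ‖g‖) ^ 2 := by
        rw [mul_pow]
        exact_mod_cast this
      rw [one_mul]
      exact (sq_eq_sq₀ (norm_nonneg _) (by positivity)).1 h2

theorem coeFn_tensorL2 (f : Lp ℂ 2 μ) (g : Lp ℂ 2 ν) :
    tensorL2 μ ν f g =ᵐ[μ.prod ν] fun p => f p.1 * g p.2 :=
  (memLp_tensor (Lp.memLp f) (Lp.memLp g)).coeFn_toLp

theorem inner_tensorL2 (f f' : Lp ℂ 2 μ) (g g' : Lp ℂ 2 ν) :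
    inner ℂ (tensorL2 μ ν f g) (tensorL2 μ ν f' g') = inner ℂ f f' * inner ℂ g g' :=
  inner_toLp_tensor f f' g g'

end Lebesgue

/-! ### Test functions and the Dirichlet form domain -/

/-- `φ ∈ C_c^∞(D)`. -/
def IsTest {n : ℕ} (D : Set (E n)) (φ : E n → ℂ) : Prop :=
  ContDiff ℝ ((⊤ : ℕ∞) : WithTop ℕ∞) φ ∧ HasCompactSupport φ ∧ tsupport φ ⊆ D

/-- The `i`-th partial derivative. -/
def pderiv {n : ℕ} (i : Fin n) (φ : E n → ℂ) (x : E n) : ℂ := fderiv ℝ φ x (basisVec i)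

namespace IsTest

variable {n : ℕ} {D : Set (E n)} {φ ψ : E n → ℂ}

theorem continuous (h : IsTest D φ) : Continuous φ := h.1.continuous

theorem differentiable (h : IsTest D φ) : Differentiable ℝ φ := h.1.differentiable (by simp)

theorem mono (h : IsTest D φ) {D' : Set (E n)} (hD : D ⊆ D') : IsTest D' φ :=
  ⟨h.1, h.2.1, h.2.2.trans hD⟩

theorem zero : IsTest D (0 : E n → ℂ) :=
  ⟨contDiff_const, HasCompactSupport.zero, by simp⟩

theorem add (h : IsTest D φ) (h' : IsTest D ψ) : IsTest D (φ + ψ) :=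
  ⟨h.1.add h'.1, h.2.1.add h'.2.1,
    (tsupport_add φ ψ).trans (Set.union_subset h.2.2 h'.2.2)⟩

theorem smul (h : IsTest D φ) (c : ℂ) : IsTest D (c • φ) :=
  ⟨h.1.const_smul c, h.2.1.smul_left (f := fun _ => c),
    (closure_mono (Function.support_const_smul_subset c φ)).trans h.2.2⟩

theorem pderiv (h : IsTest D φ) (i : Fin n) : IsTest D (pderiv i φ) := by
  refine ⟨?_, h.2.1.fderiv_apply ℝ _, ?_⟩
  · exact (h.1.fderiv_right (m := ((⊤ : ℕ∞) : WithTop ℕ∞)) (by simp)).clm_apply contDiff_const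
  · exact (tsupport_fderiv_apply_subset ℝ _).trans h.2.2

theorem pderiv_add (h : IsTest D φ) (h' : IsTest D ψ) (i : Fin n) :
    RandomInclusion.pderiv i (φ + ψ)
      = RandomInclusion.pderiv i φ + RandomInclusion.pderiv i ψ := by
  funext x
  simp [RandomInclusion.pderiv, fderiv_add (h.differentiable x) (h'.differentiable x)]

theorem pderiv_smul (h : IsTest D φ) (c : ℂ) (i : Fin n) :
    RandomInclusion.pderiv i (c • φ) = c • RandomInclusion.pderiv i φ := by
  funext x
  simp [RandomInclusion.pderiv, fderiv_const_smul (h.differentiable x)]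

theorem memLp (h : IsTest D φ) (μ : Measure (E n)) [IsFiniteMeasureOnCompacts μ] : MemLp φ 2 μ :=
  h.continuous.memLp_of_hasCompactSupport h.2.1

theorem eq_zero_of_notMem (h : IsTest D φ) {x : E n} (hx : x ∉ D) : φ x = 0 :=
  image_eq_zero_of_notMem_tsupport fun hx' => hx (h.2.2 hx')

end IsTest

variable {n : ℕ}

/-- The pairs `(φ, ∇φ)` with `φ ∈ C_c^∞(D)`. -/
def testPairs (D : Set (E n)) : Submodule ℂ (L2 D × (Fin n → L2 D)) where
  carrier := {p | ∃ φ, IsTest D φ ∧ p.1 =ᵐ[volume.restrict D] φ ∧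
    ∀ i, p.2 i =ᵐ[volume.restrict D] pderiv i φ}
  zero_mem' := ⟨0, IsTest.zero, Lp.coeFn_zero _ _ _, fun i => by
    have : pderiv i (0 : E n → ℂ) = 0 := by
      funext x
      simp [pderiv]
    rw [this]
    exact Lp.coeFn_zero _ _ _⟩
  add_mem' := by
    rintro p q ⟨φ, hφ, h1, h2⟩ ⟨ψ, hψ, h3, h4⟩
    refine ⟨φ + ψ, hφ.add hψ, (Lp.coeFn_add _ _).trans (h1.add h3), fun i => ?_⟩
    rw [hφ.pderiv_add hψ]
    exact (Lp.coeFn_add _ _).trans ((h2 i).add (h4 i))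
  smul_mem' := by
    rintro c p ⟨φ, hφ, h1, h2⟩
    refine ⟨c • φ, hφ.smul c, (Lp.coeFn_smul _ _).trans (h1.const_smul c), fun i => ?_⟩
    rw [hφ.pderiv_smul]
    exact (Lp.coeFn_smul _ _).trans ((h2 i).const_smul c)

/-- The pair `(φ, ∇φ)` as an element of `L²(D) × L²(D)ⁿ`. -/
def testPair {D : Set (E n)} {φ : E n → ℂ} (h : IsTest D φ) : L2 D × (Fin n → L2 D) :=
  ((h.memLp _).toLp φ, fun i => ((h.pderiv i).memLp _).toLp (pderiv i φ))

theorem testPair_mem {D : Set (E n)} {φ : E n → ℂ} (h : IsTest D φ) :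
    testPair h ∈ testPairs D :=
  ⟨φ, h, (h.memLp _).coeFn_toLp, fun i => ((h.pderiv i).memLp _).coeFn_toLp⟩

theorem eq_testPair {D : Set (E n)} {p : L2 D × (Fin n → L2 D)} (hp : p ∈ testPairs D) :
    ∃ (φ : E n → ℂ) (h : IsTest D φ), p = testPair h := by
  obtain ⟨φ, h, h1, h2⟩ := hp
  refine ⟨φ, h, Prod.ext (Lp.ext (h1.trans (h.memLp _).coeFn_toLp.symm))
    (funext fun i => ?_)⟩
  exact Lp.ext ((h2 i).trans ((h.pderiv i).memLp _).coeFn_toLp.symm)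

/-- Functions with their gradients converging in `L²`, through representatives. -/
theorem tendsto_testPair_iff {D : Set (E n)} {φ : ℕ → E n → ℂ} (h : ∀ k, IsTest D (φ k))
    (p : L2 D × (Fin n → L2 D)) :
    Tendsto (fun k => testPair (h k)) atTop (𝓝 p) ↔
    Tendsto (fun k => eLpNorm (fun x => φ k x - p.1 x) 2 (volume.restrict D)) atTop (𝓝 0) ∧
    ∀ i, Tendsto (fun k => eLpNorm (fun x => fderiv ℝ (φ k) x (basisVec i) - p.2 i x) 2
      (volume.restrict D)) atTop (𝓝 0) := by
  have key : ∀ (f : ℕ → E n → ℂ) (hf : ∀ k, MemLp (f k) 2 (volume.restrict D)) (g : L2 D),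
      Tendsto (fun k => (hf k).toLp) atTop (𝓝 g) ↔
      Tendsto (fun k => eLpNorm (fun x => f k x - g x) 2 (volume.restrict D)) atTop (𝓝 0) := by
    intro f hf g
    rw [Lp.tendsto_Lp_iff_tendsto_eLpNorm']
    refine tendsto_congr fun k => eLpNorm_congr_ae ?_
    filter_upwards [(hf k).coeFn_toLp] with x hx
    simp [hx]
  rw [Prod.tendsto_iff, tendsto_pi_nhds]
  refine and_congr (key φ (fun k => (h k).memLp _) p.1) (forall_congr' fun i => ?_)
  exact key (fun k => pderiv i (φ k)) (fun k => ((h k).pderiv i).memLp _) (p.2 i)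

/-- `W₀^{1,2}(D)` is the closure of the test functions. -/
theorem dirichletGradient_eq (D : Set (E n)) :
    dirichletGradient D = ((testPairs D).topologicalClosure : Set (L2 D × (Fin n → L2 D))) := by
  ext p
  rw [Submodule.topologicalClosure_coe, mem_closure_iff_seq_limit]
  constructor
  · rintro ⟨φ, h1, h2⟩
    exact ⟨fun k => testPair (h1 k), fun k => testPair_mem _, (tendsto_testPair_iff h1 p).2 h2⟩
  · rintro ⟨q, hq, hlim⟩
    choose φ h hφ using fun k => eq_testPair (hq k)
    refine ⟨φ, h, (tendsto_testPair_iff h p).1 ?_⟩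
    convert hlim using 2 with k
    exact (hφ k).symm

/-- An operator generated by a form is symmetric. -/
theorem formOperator_symm {H K : Type*} [NormedAddCommGroup H] [InnerProductSpace ℂ H]
    [NormedAddCommGroup K] [InnerProductSpace ℂ K] {G : Set (H × (Fin n → K))} {u f v g : H}
    (h : (u, f) ∈ formOperator G) (h' : (v, g) ∈ formOperator G) :
    inner ℂ v f = inner ℂ g u := by
  obtain ⟨a, ha, ha'⟩ := h
  obtain ⟨b, hb, hb'⟩ := h'
  have h1 := ha' v b hb
  have h2 := hb' u a ha
  dsimp only at h1 h2
  rw [← h1, ← inner_conj_symm g u, ← h2, map_sum]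
  simp

/-- Test functions separate the points of `L²(D)`. -/
theorem eq_zero_of_inner_test {D : Set (E n)} (hD : IsOpen D) (f : L2 D)
    (h : ∀ φ (hφ : IsTest D φ), inner ℂ ((hφ.memLp (volume.restrict D)).toLp φ) f = 0) : f = 0 := by
  apply Lp.ext
  refine EventuallyEq.trans ?_ (Lp.coeFn_zero _ _ _).symm
  have := hD.ae_eq_zero_of_integral_contDiff_smul_eq_zero (μ := volume.restrict D) (f := f)
    (((Lp.memLp f).locallyIntegrable (by norm_num)).locallyIntegrableOn D) ?_
  · filter_upwards [this, ae_restrict_mem hD.measurableSet] with x h1 h2 using h1 h2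
  · intro g hg hgc hgD
    have hφ : IsTest D (fun x => (g x : ℂ)) := by
      refine ⟨Complex.ofRealCLM.contDiff.comp hg, hgc.comp_left (g := Complex.ofReal) (by simp), ?_⟩
      exact (closure_mono
        (Function.support_comp_subset (g := Complex.ofReal) (by simp) g)).trans hgD
    rw [← h _ hφ, L2.inner_def]
    apply integral_congr_ae
    filter_upwards [(hφ.memLp (volume.restrict D)).coeFn_toLp] with x hx
    rw [hx]
    simp [mul_comm]

/-! ### Translation estimates -/

/-- `‖φ(· + k) - φ‖ ≤ ‖∂ₖ φ‖` in `L²`. -/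
theorem lintegral_translate_sub_le {φ : E n → ℂ} (h : IsTest Set.univ φ) (k : E n) :
    ∫⁻ x, ‖φ (x + k) - φ x‖ₑ ^ 2 ≤ ∫⁻ x, ‖fderiv ℝ φ x k‖ₑ ^ 2 := by
  have hc : Continuous fun x => fderiv ℝ φ x k :=
    (h.1.continuous_fderiv (by simp)).clm_apply continuous_const
  have h1 : ∀ x, ‖φ (x + k) - φ x‖ₑ ^ 2
      ≤ ∫⁻ t in Set.Ioc (0 : ℝ) 1, ‖fderiv ℝ φ (x + t • k) k‖ₑ ^ 2 := by
    intro x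
    have hd : ∀ t : ℝ, HasDerivAt (fun t : ℝ => φ (x + t • k)) (fderiv ℝ φ (x + t • k) k) t := by
      intro t
      have h2 : HasDerivAt (fun t : ℝ => x + t • k) k t := by
        simpa using ((hasDerivAt_id t).smul_const k).const_add x
      exact (h.differentiable (x + t • k)).hasFDerivAt.comp_hasDerivAt t h2
    have hct : Continuous fun t : ℝ => fderiv ℝ φ (x + t • k) k := hc.comp (by fun_prop)
    have h3 := intervalIntegral.integral_eq_sub_of_hasDerivAt (a := 0) (b := 1)
      (fun t _ => hd t) (hct.intervalIntegrable _ _)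
    simp only [one_smul, zero_smul, add_zero] at h3
    rw [← h3, intervalIntegral.integral_of_le zero_le_one]
    calc ‖∫ t in Set.Ioc (0 : ℝ) 1, fderiv ℝ φ (x + t • k) k‖ₑ ^ 2
        ≤ (∫⁻ t in Set.Ioc (0 : ℝ) 1, ‖fderiv ℝ φ (x + t • k) k‖ₑ) ^ 2 := by
          gcongr
          exact enorm_integral_le_lintegral_enorm _
      _ ≤ _ := by
          have := ENNReal.lintegral_mul_le_Lp_mul_Lq (volume.restrict (Set.Ioc (0 : ℝ) 1))
            Real.HolderConjugate.two_two (f := fun t => ‖fderiv ℝ φ (x + t • k) k‖ₑ)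
            (g := fun _ => 1) hct.enorm.aemeasurable aemeasurable_const
          simp only [Pi.mul_apply, mul_one, ENNReal.one_rpow, lintegral_one, Measure.restrict_apply,
            MeasurableSet.univ, Set.univ_inter, Real.volume_Ioc, sub_zero, ENNReal.ofReal_one]
            at this
          calc _ ≤ _ := pow_le_pow_left' this 2
            _ = _ := by
              rw [← ENNReal.rpow_natCast, ← ENNReal.rpow_mul]
              norm_num
  calc ∫⁻ x, ‖φ (x + k) - φ x‖ₑ ^ 2
      ≤ ∫⁻ x, ∫⁻ t in Set.Ioc (0 : ℝ) 1, ‖fderiv ℝ φ (x + t • k) k‖ₑ ^ 2 := lintegral_mono h1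
    _ = ∫⁻ t in Set.Ioc (0 : ℝ) 1, ∫⁻ x, ‖fderiv ℝ φ (x + t • k) k‖ₑ ^ 2 := by
        apply lintegral_lintegral_swap
        apply Measurable.aemeasurable
        have : Continuous fun p : E n × ℝ => ‖fderiv ℝ φ (p.1 + p.2 • k) k‖ₑ ^ 2 :=
          (ENNReal.continuous_pow 2).comp (hc.comp (by fun_prop)).enorm
        exact this.measurable
    _ = ∫⁻ t in Set.Ioc (0 : ℝ) 1, ∫⁻ x, ‖fderiv ℝ φ x k‖ₑ ^ 2 := by
        refine lintegral_congr fun t => ?_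
        exact lintegral_add_right_eq_self (fun x => ‖fderiv ℝ φ x k‖ₑ ^ 2) (t • k)
    _ = _ := by simp

theorem norm_fderiv_sq_le {φ : E n → ℂ} (x k : E n) :
    ‖fderiv ℝ φ x k‖ ^ 2 ≤ ‖k‖ ^ 2 * ∑ i, ‖pderiv i φ x‖ ^ 2 := by
  have hk : k = ∑ i, k i • basisVec i := by
    ext j
    simp [basisVec, Finset.sum_apply, Pi.single_apply]
  have h1 : fderiv ℝ φ x k = ∑ i, k i • pderiv i φ x := by
    conv_lhs => rw [hk]
    simp [pderiv]
  calc ‖fderiv ℝ φ x k‖ ^ 2 ≤ (∑ i, |k i| * ‖pderiv i φ x‖) ^ 2 := by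
        gcongr
        rw [h1]
        refine (norm_sum_le _ _).trans (Finset.sum_le_sum fun i _ => ?_)
        rw [norm_smul, Real.norm_eq_abs]
    _ ≤ (∑ i, |k i| ^ 2) * ∑ i, ‖pderiv i φ x‖ ^ 2 := Finset.sum_mul_sq_le_sq_mul_sq _ _ _
    _ = _ := by
        rw [EuclideanSpace.norm_sq_eq]
        simp

theorem lintegral_translate_sub_le' {φ : E n → ℂ} (h : IsTest Set.univ φ) (k : E n) :
    ∫⁻ x, ‖φ (x + k) - φ x‖ₑ ^ 2 ≤ ‖k‖ₑ ^ 2 * ∑ i, ∫⁻ x, ‖pderiv i φ x‖ₑ ^ 2 := by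
  refine (lintegral_translate_sub_le h k).trans ?_
  have hm : ∀ i, Measurable fun x => ‖pderiv i φ x‖ₑ ^ 2 := fun i =>
    ((h.pderiv i).continuous.enorm.measurable).pow_const 2
  rw [← lintegral_finsetSum _ fun i _ => hm i,
    ← lintegral_const_mul _ (Finset.measurable_sum _ fun i _ => hm i)]
  refine lintegral_mono fun x => ?_
  have := ENNReal.ofReal_le_ofReal (norm_fderiv_sq_le (φ := φ) x k)
  rw [ENNReal.ofReal_mul (by positivity), ENNReal.ofReal_sum_of_nonneg (fun _ _ => by positivity)]
    at this
  simpa only [ENNReal.ofReal_pow (norm_nonneg _), ofReal_norm] using this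

theorem enorm_sq_Lp {α : Type*} [MeasurableSpace α] {μ : Measure α} (f : Lp ℂ 2 μ) :
    ‖f‖ₑ ^ 2 = ∫⁻ x, ‖f x‖ₑ ^ 2 ∂μ := by
  rw [Lp.enorm_def]
  have := eLpNorm_nnreal_pow_eq_lintegral (f := f) (μ := μ) (p := 2) (by norm_num)
  simpa using this

theorem enorm_sq_toLp {α : Type*} [MeasurableSpace α] {μ : Measure α} {f : α → ℂ}
    (hf : MemLp f 2 μ) : ‖hf.toLp f‖ₑ ^ 2 = ∫⁻ x, ‖f x‖ₑ ^ 2 ∂μ := by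
  rw [enorm_sq_Lp]
  apply lintegral_congr_ae
  filter_upwards [hf.coeFn_toLp] with x hx
  rw [hx]

theorem IsTest.lintegral_restrict {D : Set (E n)} {φ : E n → ℂ} (h : IsTest D φ) :
    ∫⁻ x in D, ‖φ x‖ₑ ^ 2 = ∫⁻ x, ‖φ x‖ₑ ^ 2 := by
  apply setLIntegral_eq_of_support_subset
  intro x hx
  by_contra hxD
  simp [h.eq_zero_of_notMem hxD] at hx

theorem measurableSet_cube (a b : ℝ) : MeasurableSet {y : E n | ∀ i, y i ∈ Set.Ico a b} := by
  have : {y : E n | ∀ i, y i ∈ Set.Ico a b} = ⋂ i, {y : E n | y i ∈ Set.Ico a b} := by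
    ext; simp
  rw [this]
  refine MeasurableSet.iInter fun i => ?_
  exact (by fun_prop : Measurable fun y : E n => y i) measurableSet_Ico

theorem volume_cube (a b : ℝ) :
    volume {y : E n | ∀ i, y i ∈ Set.Ico a b} = ENNReal.ofReal (b - a) ^ n := by
  have h := (PiLp.volume_preserving_ofLp (Fin n)).measure_preimage
    (s := Set.univ.pi fun _ => Set.Ico a b)
    (MeasurableSet.univ_pi fun _ => measurableSet_Ico).nullMeasurableSet
  have h2 : WithLp.ofLp ⁻¹' (Set.univ.pi fun _ => Set.Ico a b)
      = {y : E n | ∀ i, y i ∈ Set.Ico a b} := by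
    ext y; simp
  rw [h2] at h
  rw [h, Real.volume_pi_Ico]
  simp

theorem measurableSet_cell : MeasurableSet (cell n) := measurableSet_cube 0 1

theorem volume_cell : volume (cell n) = 1 := by
  have : volume (cell n) = _ := volume_cube (n := n) 0 1
  rw [this]
  simp

theorem volume_lt_top_of_subset_cell {D : Set (E n)} (hD : D ⊆ cell n) : volume D < ⊤ :=
  (measure_mono hD).trans_lt (by rw [volume_cell]; exact ENNReal.one_lt_top)

/-- Inequalities between norms extend from test functions to `W₀^{1,2}(D)`. -/
theorem dirichletGradient_induction {D : Set (E n)} {P : L2 D × (Fin n → L2 D) → Prop}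
    (hP : IsClosed {p | P p}) (h : ∀ φ (hφ : IsTest D φ), P (testPair hφ))
    {p : L2 D × (Fin n → L2 D)} (hp : p ∈ dirichletGradient D) : P p := by
  rw [dirichletGradient_eq] at hp
  refine closure_minimal ?_ hP hp
  intro q hq
  obtain ⟨φ, hφ, rfl⟩ := eq_testPair hq
  exact h φ hφ

theorem sq_le_sq_of_enorm {F G : Type*} [SeminormedAddCommGroup F] [SeminormedAddCommGroup G]
    {c : ℝ} (hc : 0 ≤ c) {x : F} {ι : Type*} {s : Finset ι} {y : ι → G}
    (h : ‖x‖ₑ ^ 2 ≤ ENNReal.ofReal c * ∑ i ∈ s, ‖y i‖ₑ ^ 2) :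
    ‖x‖ ^ 2 ≤ c * ∑ i ∈ s, ‖y i‖ ^ 2 := by
  rw [← ENNReal.ofReal_le_ofReal_iff (by positivity), ENNReal.ofReal_mul hc,
    ENNReal.ofReal_sum_of_nonneg fun _ _ => by positivity]
  simpa only [ENNReal.ofReal_pow (norm_nonneg _), ofReal_norm] using h

/-- The Poincaré inequality: translating `D` by a unit vector makes it disjoint from itself. -/
theorem poincare {D : Set (E n)} (hD : D ⊆ cell n) (i : Fin n) {p : L2 D × (Fin n → L2 D)}
    (hp : p ∈ dirichletGradient D) : ‖p.1‖ ^ 2 ≤ ‖p.2 i‖ ^ 2 := by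
  refine dirichletGradient_induction (P := fun p => ‖p.1‖ ^ 2 ≤ ‖p.2 i‖ ^ 2) ?_ ?_ hp
  · exact isClosed_le (by fun_prop) (by fun_prop)
  · intro φ hφ
    have key : ‖(testPair hφ).1‖ₑ ^ 2 ≤ ENNReal.ofReal 1 * ∑ j ∈ {i}, ‖(testPair hφ).2 j‖ₑ ^ 2 := by
      rw [ENNReal.ofReal_one, one_mul, Finset.sum_singleton]
      dsimp only [testPair]
      rw [enorm_sq_toLp, enorm_sq_toLp, hφ.lintegral_restrict, (hφ.pderiv i).lintegral_restrict]
      refine le_trans ?_ (lintegral_translate_sub_le (hφ.mono (Set.subset_univ _)) (basisVec i))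
      refine lintegral_mono fun x => ?_
      by_cases hx : x ∈ D
      · have : x + basisVec i ∉ D := fun h => by
          have h1 := (hD h i).2
          have h2 := (hD hx i).1
          simp [basisVec] at h1
          linarith
        simp [hφ.eq_zero_of_notMem this]
      · simp [hφ.eq_zero_of_notMem hx]
    simpa using sq_le_sq_of_enorm zero_le_one key

/-- The index of the cube of side `1/N` that contains `x`. -/
def cubeIndex (N : ℕ) (x : E n) : Fin n → ℤ := fun i => ⌊(N : ℝ) * x i⌋

theorem measurable_cubeIndex (N : ℕ) : Measurable (cubeIndex N : E n → Fin n → ℤ) := by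
  refine measurable_pi_lambda _ fun i => Int.measurable_floor.comp ?_
  fun_prop

theorem restrict_apply_ne_top {D : Set (E n)} (hD : volume D < ⊤) (A : Set (E n)) :
    volume.restrict D A ≠ ⊤ :=
  ((measure_mono (Set.subset_univ A)).trans_lt (by simpa using hD)).ne

/-- The indicator function of a cube of side `1/N`. -/
def cubeFun (D : Set (E n)) (hD : volume D < ⊤) (N : ℕ) (z : Fin n → ℤ) : L2 D :=
  indicatorConstLp 2 (s := cubeIndex N ⁻¹' {z}) (measurable_cubeIndex N (measurableSet_singleton z))
    (restrict_apply_ne_top hD _) 1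

/-- The step functions on the cubes of side `1/N`. -/
def stepSpace (D : Set (E n)) (hD : volume D < ⊤) (N : ℕ) : Submodule ℂ (L2 D) :=
  Submodule.span ℂ (Set.range fun z : Fin n → Fin N => cubeFun D hD N fun i => (z i : ℤ))

instance (D : Set (E n)) (hD : volume D < ⊤) (N : ℕ) :
    FiniteDimensional ℂ (stepSpace D hD N) :=
  FiniteDimensional.span_of_finite ℂ (Set.finite_range _)

/-- The corner of the cube of side `1/N` that contains `x`. -/
def cubeCorner (N : ℕ) (x : E n) : E n := WithLp.toLp 2 fun i => (⌊(N : ℝ) * x i⌋ : ℝ) / N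

/-- The function that takes on each cube the value of `φ` at the corner shifted by `h` is a step
function. -/
theorem toLp_corner_mem_stepSpace {D : Set (E n)} (hD : D ⊆ cell n) {N : ℕ} (hN : 0 < N)
    (φ : E n → ℂ) (h : E n) :
    ∃ s ∈ stepSpace D (volume_lt_top_of_subset_cell hD) N,
      s =ᵐ[volume.restrict D] fun x => φ (cubeCorner N x + h) := by
  have hN' : (0 : ℝ) < N := by exact_mod_cast hN
  let c : (Fin n → Fin N) → ℂ := fun z => φ (WithLp.toLp 2 (fun i => ((z i : ℤ) : ℝ) / N) + h)
  refine ⟨∑ z : Fin n → Fin N,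
    c z • cubeFun D (volume_lt_top_of_subset_cell hD) N fun i => (z i : ℤ), ?_, ?_⟩
  · exact Submodule.sum_mem _ fun z _ => Submodule.smul_mem _ _ (Submodule.subset_span ⟨z, rfl⟩)
  have h1 : ∀ᵐ x ∂volume.restrict D, ∀ z : Fin n → Fin N,
      (c z • cubeFun D (volume_lt_top_of_subset_cell hD) N fun i => (z i : ℤ) : L2 D) x
        = c z * (cubeIndex N ⁻¹' {fun i => (z i : ℤ)}).indicator (fun _ => (1 : ℂ)) x := by
    rw [ae_all_iff]
    intro z
    filter_upwards [Lp.coeFn_smul (c z)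
      (cubeFun D (volume_lt_top_of_subset_cell hD) N fun i => (z i : ℤ)),
      indicatorConstLp_coeFn (p := 2)
      (s := cubeIndex N ⁻¹' {fun i => (z i : ℤ)}) (hs := measurable_cubeIndex N
        (measurableSet_singleton _)) (hμs := restrict_apply_ne_top
          (volume_lt_top_of_subset_cell hD) _) (c := (1 : ℂ))] with x hx1 hx2
    rw [hx1, Pi.smul_apply, smul_eq_mul, ← hx2]
    rfl
  filter_upwards [h1, Lp.coeFn_finsetSum Finset.univ (fun z : Fin n → Fin N =>
    c z • cubeFun D (volume_lt_top_of_subset_cell hD) N fun i => (z i : ℤ)),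
    ae_restrict_of_ae_restrict_of_subset hD (ae_restrict_mem measurableSet_cell)] with x hx hsum hxD
  have hz : ∀ i, 0 ≤ ⌊(N : ℝ) * x i⌋ ∧ ⌊(N : ℝ) * x i⌋ < N := by
    intro i
    refine ⟨Int.floor_nonneg.2 (mul_nonneg hN'.le (hxD i).1), Int.floor_lt.2 ?_⟩
    have := (hxD i).2
    push_cast
    nlinarith
  let z₀ : Fin n → Fin N := fun i => ⟨(⌊(N : ℝ) * x i⌋).toNat, by have := hz i; omega⟩
  have hz₀ : ∀ i, ((z₀ i : ℕ) : ℤ) = ⌊(N : ℝ) * x i⌋ := fun i => Int.toNat_of_nonneg (hz i).1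
  rw [hsum, Finset.sum_apply, Finset.sum_congr rfl fun z _ => hx z, Finset.sum_eq_single z₀]
  · have : x ∈ cubeIndex N ⁻¹' {fun i => ((z₀ i : ℕ) : ℤ)} := by
      funext i
      exact (hz₀ i).symm
    rw [Set.indicator_of_mem this, mul_one]
    simp only [c, hz₀]
    rfl
  · intro z _ hzz
    rw [Set.indicator_of_notMem, mul_zero]
    intro hmem
    apply hzz
    funext i
    have h2 : ⌊(N : ℝ) * x i⌋ = ((z i : ℕ) : ℤ) := congrFun hmem i
    apply Fin.ext
    have := hz₀ i
    omega
  · simp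

theorem enorm_cubeCorner_le {N : ℕ} (hN : 0 < N) {x h : E n}
    (hh : ∀ i, h i ∈ Set.Ico (0 : ℝ) (1 / N)) : ‖cubeCorner N x + h - x‖ ≤ n / N := by
  have hN' : (0 : ℝ) < N := by exact_mod_cast hN
  have hk : ∀ i, |(cubeCorner N x + h - x) i| ≤ 1 / N := by
    intro i
    have h1 := Int.floor_le ((N : ℝ) * x i)
    have h2 := Int.lt_floor_add_one ((N : ℝ) * x i)
    have h3 : (cubeCorner N x + h - x) i = (⌊(N : ℝ) * x i⌋ : ℝ) / N + h i - x i := rfl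
    have h4 : (⌊(N : ℝ) * x i⌋ : ℝ) / N ≤ x i := by
      rw [div_le_iff₀ hN']; linarith
    have h5 : x i < (⌊(N : ℝ) * x i⌋ : ℝ) / N + 1 / N := by
      rw [← add_div, lt_div_iff₀ hN']; linarith
    rw [h3, abs_le]
    constructor <;> linarith [(hh i).1, (hh i).2]
  rw [EuclideanSpace.norm_eq]
  calc √(∑ i, ‖(cubeCorner N x + h - x) i‖ ^ 2) ≤ ∑ i, ‖(cubeCorner N x + h - x) i‖ := by
        apply Real.sqrt_le_iff.2 ⟨by positivity, ?_⟩
        exact Finset.sum_sq_le_sq_sum_of_nonneg fun _ _ => norm_nonneg _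
    _ ≤ ∑ i : Fin n, (1 / N : ℝ) := Finset.sum_le_sum fun i _ => hk i
    _ = n / N := by simp [div_eq_mul_inv]

theorem measurable_cubeCorner (N : ℕ) : Measurable (cubeCorner N : E n → E n) := by
  refine (PiLp.continuous_toLp 2 _).measurable.comp (measurable_pi_lambda _ fun i => ?_)
  have : Measurable fun x : E n => ⌊(N : ℝ) * x i⌋ := Int.measurable_floor.comp (by fun_prop)
  exact ((measurable_from_top (f := fun z : ℤ => (z : ℝ))).comp this).div_const _

/-- `W₀^{1,2}(D)` is approximated in `L²(D)` by step functions, uniformly on bounded sets. -/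
theorem exists_step_approx (n : ℕ) : ∃ C : ℝ, 0 ≤ C ∧ ∀ (D : Set (E n)) (hD : D ⊆ cell n) (N : ℕ),
    0 < N → ∀ p ∈ dirichletGradient D,
      ‖p.1 - (stepSpace D (volume_lt_top_of_subset_cell hD) N).starProjection p.1‖ ^ 2
        ≤ C / N ^ 2 * ∑ i, ‖p.2 i‖ ^ 2 := by
  obtain ⟨v, hv⟩ : ∃ v : NNReal, volume (Metric.ball (0 : E n) 1) = v :=
    ⟨_, (ENNReal.coe_toNNReal measure_ball_lt_top.ne).symm⟩
  refine ⟨(n : ℝ) ^ n * v * n ^ 2, by positivity, fun D hD N hN p hp => ?_⟩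
  have hN' : (0 : ℝ) < N := by exact_mod_cast hN
  set S := stepSpace D (volume_lt_top_of_subset_cell hD) N
  refine dirichletGradient_induction (P := fun p => ‖p.1 - S.starProjection p.1‖ ^ 2
        ≤ (n : ℝ) ^ n * v * n ^ 2 / N ^ 2 * ∑ i, ‖p.2 i‖ ^ 2) ?_ ?_ hp
  · exact isClosed_le (by fun_prop) (by fun_prop)
  intro φ hφ
  apply sq_le_sq_of_enorm (by positivity)
  have hφ' := hφ.mono (Set.subset_univ _)
  set f := (testPair hφ).1 with hf
  set Q : Set (E n) := {h | ∀ i, h i ∈ Set.Ico (0 : ℝ) (1 / N)}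
  set B : Set (E n) := Metric.closedBall 0 (n / N)
  have hQ : volume Q = ENNReal.ofReal (1 / N) ^ n := by
    have := volume_cube (n := n) 0 (1 / N)
    rwa [sub_zero] at this
  -- on the cube of `h`, the projection does at least as well as the step function at `h`
  have h1 : ∀ h : E n, ‖f - S.starProjection f‖ₑ ^ 2
      ≤ ∫⁻ x in D, ‖φ (cubeCorner N x + h) - φ x‖ₑ ^ 2 := by
    intro h
    obtain ⟨s, hs, hs'⟩ := toLp_corner_mem_stepSpace hD hN φ h
    have h2 : ‖f - S.starProjection f‖ ≤ ‖f - s‖ := by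
      rw [Submodule.starProjection_minimal]
      exact ciInf_le ⟨0, by rintro _ ⟨y, rfl⟩; positivity⟩ (⟨s, hs⟩ : S)
    have h3 : ‖f - S.starProjection f‖ₑ ≤ ‖f - s‖ₑ := by
      rw [← ofReal_norm, ← ofReal_norm]
      exact ENNReal.ofReal_le_ofReal h2
    refine (pow_le_pow_left' h3 2).trans (le_of_eq ?_)
    rw [enorm_sq_Lp]
    apply lintegral_congr_ae
    filter_upwards [hs', Lp.coeFn_sub f s, (hφ.memLp (volume.restrict D)).coeFn_toLp]
      with x hx1 hx2 hx3
    rw [hx2, Pi.sub_apply, hx1]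
    have : f x = φ x := hx3
    rw [this, ← enorm_neg, neg_sub]
  have hmeas : Measurable fun q : E n × E n => ‖φ (cubeCorner N q.1 + q.2) - φ q.1‖ₑ ^ 2 := by
    have hφm := hφ.continuous.measurable
    have h4 := measurable_cubeCorner (n := n) N
    exact (((hφm.comp ((h4.comp measurable_fst).add measurable_snd)).sub
      (hφm.comp measurable_fst)).enorm).pow_const 2
  have hmeas' : Measurable fun q : E n × E n => ‖φ (q.1 + q.2) - φ q.1‖ₑ ^ 2 := by
    have hφm := hφ.continuous.measurable
    exact (((hφm.comp (measurable_fst.add measurable_snd)).sub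
      (hφm.comp measurable_fst)).enorm).pow_const 2
  have h5 : ‖f - S.starProjection f‖ₑ ^ 2 * volume Q
      ≤ volume B * (ENNReal.ofReal (n / N) ^ 2 * ∑ i, ‖(testPair hφ).2 i‖ₑ ^ 2) := by
    calc ‖f - S.starProjection f‖ₑ ^ 2 * volume Q
        = ∫⁻ h in Q, ‖f - S.starProjection f‖ₑ ^ 2 := by simp
      _ ≤ ∫⁻ h in Q, ∫⁻ x in D, ‖φ (cubeCorner N x + h) - φ x‖ₑ ^ 2 := lintegral_mono h1
      _ = ∫⁻ x in D, ∫⁻ h in Q, ‖φ (cubeCorner N x + h) - φ x‖ₑ ^ 2 :=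
          lintegral_lintegral_swap (hmeas.comp measurable_swap).aemeasurable
      _ ≤ ∫⁻ x, ∫⁻ k in B, ‖φ (x + k) - φ x‖ₑ ^ 2 := by
          refine (lintegral_mono fun x => ?_).trans (setLIntegral_le_lintegral _ _)
          rw [← lintegral_indicator (measurableSet_cube _ _),
            ← lintegral_indicator Metric.isClosed_closedBall.measurableSet,
            ← lintegral_add_right_eq_self
              (B.indicator fun k => ‖φ (x + k) - φ x‖ₑ ^ 2) (cubeCorner N x - x)]
          refine lintegral_mono fun h => ?_
          by_cases hh : h ∈ Q
          · have hmem : h + (cubeCorner N x - x) ∈ B := by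
              rw [mem_closedBall_zero_iff]
              have h6 : h + (cubeCorner N x - x) = cubeCorner N x + h - x := by abel
              rw [h6]
              exact enorm_cubeCorner_le hN hh
            rw [Set.indicator_of_mem (s := Q) hh, Set.indicator_of_mem hmem]
            have h6 : x + (h + (cubeCorner N x - x)) = cubeCorner N x + h := by abel
            simp only [h6]
            exact le_rfl
          · rw [Set.indicator_of_notMem (s := Q) hh]
            exact zero_le
      _ = ∫⁻ k in B, ∫⁻ x, ‖φ (x + k) - φ x‖ₑ ^ 2 := lintegral_lintegral_swap hmeas'.aemeasurable
      _ ≤ ∫⁻ k in B, (ENNReal.ofReal (n / N) ^ 2 * ∑ i, ‖(testPair hφ).2 i‖ₑ ^ 2) := by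
          refine setLIntegral_mono measurable_const fun k hk => ?_
          refine (lintegral_translate_sub_le' hφ' k).trans ?_
          have h6 : ‖k‖ₑ ≤ ENNReal.ofReal (n / N) := by
            rw [← ofReal_norm]
            exact ENNReal.ofReal_le_ofReal (mem_closedBall_zero_iff.1 hk)
          have h7 : ∀ i, ∫⁻ x, ‖pderiv i φ x‖ₑ ^ 2 = ‖(testPair hφ).2 i‖ₑ ^ 2 := by
            intro i
            dsimp only [testPair]
            rw [enorm_sq_toLp, (hφ.pderiv i).lintegral_restrict]
          simp only [h7]
          gcongr
      _ = _ := by simp [mul_comm]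
  have hB : volume B = ENNReal.ofReal (n / N) ^ n * v := by
    rw [Measure.addHaar_closedBall _ _ (by positivity), finrank_euclideanSpace, Fintype.card_fin,
      ENNReal.ofReal_pow (by positivity), hv]
  rw [hQ, hB] at h5
  have h8 : ENNReal.ofReal (1 / N) ^ n ≠ 0 := by
    apply pow_ne_zero
    simpa using hN.ne'
  have h9 : ENNReal.ofReal (1 / N) ^ n ≠ ⊤ := ENNReal.pow_ne_top ENNReal.ofReal_ne_top
  refine (ENNReal.mul_le_mul_iff_left h8 h9).1 (h5.trans (le_of_eq ?_))
  have h10 : (v : ENNReal) = ENNReal.ofReal v := by simp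
  rw [h10, ← ENNReal.ofReal_pow (by positivity), ← ENNReal.ofReal_pow (by positivity),
    ← ENNReal.ofReal_pow (by positivity), ← ENNReal.ofReal_mul (by positivity), ← mul_assoc,
    ← ENNReal.ofReal_mul (by positivity), mul_right_comm (ENNReal.ofReal (_ / _)),
    ← ENNReal.ofReal_mul (by positivity)]
  congr 2
  simp only [div_pow, one_pow]
  field_simp

/-! ### The spectrum of the Dirichlet Laplacian -/

/-- The Rellich theorem: `W₀^{1,2}(D)` embeds compactly into `L²(D)`. -/
theorem isCompactOperator_dirichlet {D : Set (E n)} (hD : D ⊆ cell n) {X : Type*}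
    [NormedAddCommGroup X] [InnerProductSpace ℂ X] (F : FormSpace (dirichletGradient D) X) :
    IsCompactOperator F.J := by
  obtain ⟨C, hC0, hC⟩ := exists_step_approx n
  set S := fun N : ℕ => stepSpace D (volume_lt_top_of_subset_cell hD) (N + 1)
  have hbound : ∀ N, ‖(S N).starProjection ∘L F.J - F.J‖ ≤ √C / (N + 1) := by
    intro N
    refine ContinuousLinearMap.opNorm_le_bound _ (by positivity) fun x => ?_
    have h1 := hC D hD (N + 1) (by omega) (F.J x, F.D x) ((F.mem_iff _ _).2 ⟨x, rfl, rfl⟩)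
    have h2 : ∑ i, ‖F.D x i‖ ^ 2 ≤ ‖x‖ ^ 2 := by
      have := F.inner_eq x x
      simp only [inner_self_eq_norm_sq_to_K] at this
      have h3 : ‖x‖ ^ 2 = ‖F.J x‖ ^ 2 + ∑ i, ‖F.D x i‖ ^ 2 := by exact_mod_cast this
      rw [h3]
      nlinarith [sq_nonneg ‖F.J x‖]
    have h4 : ‖((S N).starProjection ∘L F.J - F.J) x‖ = ‖F.J x - (S N).starProjection (F.J x)‖ := by
      rw [sub_apply, ContinuousLinearMap.comp_apply, norm_sub_rev]
    rw [h4]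
    apply (sq_le_sq₀ (norm_nonneg _) (by positivity)).1
    rw [mul_pow, div_pow, Real.sq_sqrt hC0]
    refine h1.trans ?_
    push_cast
    gcongr
  refine isCompactOperator_of_tendsto (l := atTop)
    (F := fun N : ℕ => (S N).starProjection ∘L F.J) ?_ (Eventually.of_forall fun N => ?_)
  · rw [tendsto_iff_norm_sub_tendsto_zero]
    refine squeeze_zero (fun _ => norm_nonneg _) hbound ?_
    have := tendsto_one_div_add_atTop_nhds_zero_nat (𝕜 := ℝ)
    simpa [div_eq_mul_inv] using this.const_mul (√C)
  · have h5 : IsCompactOperator ((S N).orthogonalProjectionOnto ∘L F.J) := by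
      have := FiniteDimensional.proper ℂ (S N)
      exact isCompactOperator_of_locallyCompactSpace_dom _
    exact h5.clm_comp (S N).subtypeL

/-- A compact symmetric operator has an orthonormal basis of eigenvectors. -/
theorem exists_eigenbasis.{u} {H : Type u} [NormedAddCommGroup H] [InnerProductSpace ℂ H]
    [CompleteSpace H] {T : H →L[ℂ] H} (hT : IsCompactOperator T) (hT' : T.IsSymmetric) :
    ∃ (ι : Type u) (e : ι → H) (κ : ι → ℂ), Orthonormal ℂ e ∧
      (∀ f, (∀ k, inner ℂ (e k) f = 0) → f = 0) ∧ ∀ k, T (e k) = κ k • e k := by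
  let V : ℂ → Submodule ℂ H := fun κ => Module.End.eigenspace (T : Module.End ℂ H) κ
  have hV : ∀ κ, CompleteSpace (V κ) := fun κ => by
    have : IsClosed (V κ : Set H) := by
      have h1 : (V κ : Set H) = {x | T x = κ • x} := by
        ext x
        exact Module.End.mem_eigenspace_iff
      rw [h1]
      exact isClosed_eq (by fun_prop) (by fun_prop)
    exact this.completeSpace_coe
  choose w b hb using fun κ => exists_hilbertBasis ℂ (V κ)
  have horth := hT'.orthogonalFamily_eigenspaces
  let e : (Σ κ : ℂ, w κ) → H := fun k => ((k.2 : V k.1) : H)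
  have hbe : ∀ κ (x : w κ), b κ x = (x : V κ) := fun κ x => congrFun (hb κ) x
  refine ⟨_, e, fun k => k.1, ?_, ?_, ?_⟩
  · have h1 : Orthonormal ℂ fun k : Σ κ, w κ => (V k.1).subtypeₗᵢ (b k.1 k.2) :=
      horth.orthonormal_sigma_orthonormal fun κ => (b κ).orthonormal
    convert h1 using 2 with k
    simp [e, hbe]
  · intro f hf
    have h2 : f ∈ (⨆ κ, V κ)ᗮ := by
      rw [← Submodule.iInf_orthogonal, Submodule.mem_iInf]
      intro κ
      have h3 : (V κ).orthogonalProjectionOnto f = 0 := by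
        apply (b κ).repr.injective
        rw [map_zero]
        ext x
        rw [(b κ).repr_apply_apply, hbe, lp.coeFn_zero, Pi.zero_apply,
          Submodule.inner_orthogonalProjectionOnto_eq_of_mem_left]
        exact hf ⟨κ, x⟩
      exact Submodule.orthogonalProjectionOnto_eq_zero_iff.1 h3
    rw [ContinuousLinearMap.orthogonalComplement_iSup_eigenspaces_eq_bot hT hT'] at h2
    exact h2
  · intro k
    exact Module.End.mem_eigenspace_iff.1 (k.2 : V k.1).2

/-- The spectral decomposition of the Dirichlet Laplacian. The last property says that the
eigenvalues have no finite limit point other than an eigenvalue. -/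
theorem exists_dirichlet_eigenbasis (i₀ : Fin n) {D : Set (E n)} (hopen : IsOpen D)
    (hD : D ⊆ cell n) :
    ∃ (ι : Type) (e : ι → L2 D) (lam : ι → ℝ), Orthonormal ℂ e ∧
      (∀ f, (∀ k, inner ℂ (e k) f = 0) → f = 0) ∧ (∀ k, 0 < lam k) ∧
      (∀ k, (e k, (lam k : ℂ) • e k) ∈ dirichletLaplacian D) ∧
      IsCompact (insert 0 (Set.range fun k => (1 + lam k)⁻¹)) := by
  obtain ⟨X, _, _, _, ⟨F⟩⟩ := exists_formSpace _ (testPairs D).isClosed_topologicalClosure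
  rw [← dirichletGradient_eq] at F
  have hcomp : IsCompactOperator F.res := by
    have := (isCompactOperator_dirichlet hD F).comp_clm F.J.adjoint
    exact this
  obtain ⟨ι, e, κ, ho, htot, hκ⟩ := exists_eigenbasis hcomp F.res_isSymmetric
  have hdense : ∀ f : L2 D, F.res f = 0 → f = 0 := by
    intro f
    refine F.eq_zero_of_res_eq_zero fun h => eq_zero_of_inner_test hopen f fun φ hφ => ?_
    refine h (testPair hφ).1 (testPair hφ).2 ?_
    rw [dirichletGradient_eq]
    exact subset_closure (testPair_mem hφ)
  have hne : ∀ k, e k ≠ 0 := fun k => ho.ne_zero k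
  have hκ0 : ∀ k, κ k ≠ 0 := by
    intro k h0
    refine hne k (hdense _ ?_)
    rw [hκ, h0, zero_smul]
  -- the resolvent equation in the form of an eigenvalue equation
  have hlap : ∀ k, (e k, ((κ k)⁻¹ - 1) • e k) ∈ dirichletLaplacian D := by
    intro k
    refine F.mem_formOperator_iff.2 ?_
    have : ((κ k)⁻¹ - 1) • e k + e k = (κ k)⁻¹ • e k := by module
    rw [this, map_smul, hκ, smul_smul, inv_mul_cancel₀ (hκ0 k), one_smul]
  have hpos : ∀ k, ∃ l : ℝ, 0 < l ∧ (κ k)⁻¹ - 1 = l := by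
    intro k
    obtain ⟨g, hg, h⟩ := hlap k
    have h1 := h (e k) g hg
    simp only [inner_self_eq_norm_sq_to_K, inner_smul_right, ho.1 k] at h1
    refine ⟨∑ i, ‖g i‖ ^ 2, ?_, ?_⟩
    · have h2 := poincare hD i₀ hg
      dsimp only at h2
      rw [ho.1 k] at h2
      have h3 := Finset.single_le_sum (f := fun i => ‖g i‖ ^ 2) (fun i _ => by positivity)
        (Finset.mem_univ i₀)
      linarith
    · push_cast
      simpa using h1.symm
  choose lam hlam hlam' using hpos
  have hκlam : ∀ k, κ k = (((1 + lam k)⁻¹ : ℝ) : ℂ) := by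
    intro k
    push_cast
    rw [← hlam' k]
    simp
  refine ⟨ι, e, lam, ho, htot, hlam, fun k => hlam' k ▸ hlap k, ?_⟩
  -- apart from `0`, the spectrum of the resolvent consists of the numbers `(1 + lam k)⁻¹`
  have hset : insert (0 : ℝ) (Set.range fun k => (1 + lam k)⁻¹)
      = insert 0 (Complex.ofReal ⁻¹' (spectrum ℂ F.res)) := by
    ext t
    rcases eq_or_ne t 0 with rfl | ht
    · simp
    simp only [Set.mem_insert_iff, ht, false_or, Set.mem_preimage]
    rw [← hcomp.hasEigenvalue_iff_mem_spectrum (by exact_mod_cast ht)]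
    constructor
    · rintro ⟨k, rfl⟩
      refine Module.End.hasEigenvalue_of_hasEigenvector (x := e k) ⟨?_, hne k⟩
      rw [Module.End.mem_eigenspace_iff, ← hκlam]
      exact hκ k
    · intro h
      obtain ⟨x, hx, hx0⟩ := h.exists_hasEigenvector
      rw [Module.End.mem_eigenspace_iff] at hx
      by_contra hcon
      refine hx0 (htot x fun k => ?_)
      have h1 : inner ℂ (F.res (e k)) x = inner ℂ (e k) (F.res x) := F.res_isSymmetric (e k) x
      have h2 : F.res x = (t : ℂ) • x := hx
      rw [h2, hκ, hκlam, inner_smul_left, inner_smul_right, Complex.conj_ofReal] at h1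
      by_contra h3
      exact hcon ⟨k, by exact_mod_cast mul_right_cancel₀ h3 h1⟩
  rw [hset]
  refine IsCompact.insert ?_ 0
  exact Complex.isometry_ofReal.isClosedEmbedding.isCompact_preimage (spectrum.isCompact F.res)

/-- Eigenvalues of the Dirichlet Laplacian, wherever their eigenfunctions come from, are
eigenvalues of the given basis. -/
theorem exists_eq_of_eigenvalue {D : Set (E n)} {ι : Type} {e : ι → L2 D} {lam : ι → ℝ}
    (htot : ∀ f, (∀ k, inner ℂ (e k) f = 0) → f = 0)
    (he : ∀ k, (e k, (lam k : ℂ) • e k) ∈ dirichletLaplacian D) {ν : ℝ} {u : L2 D} (hu : u ≠ 0)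
    (h : (u, (ν : ℂ) • u) ∈ dirichletLaplacian D) : ∃ k, lam k = ν := by
  by_contra hcon
  refine hu (htot u fun k => ?_)
  have h1 := formOperator_symm h (he k)
  rw [inner_smul_left, inner_smul_right, Complex.conj_ofReal] at h1
  by_contra h3
  exact hcon ⟨k, by exact_mod_cast (mul_right_cancel₀ h3 h1).symm⟩

/-! ### Weak gradients and mollification -/

/-- `G` is the weak gradient of `v` on `ℝⁿ`. -/
def IsWeakGrad (v : E n → ℂ) (G : Fin n → E n → ℂ) : Prop :=
  ∀ η : E n → ℝ, ContDiff ℝ ((⊤ : ℕ∞) : WithTop ℕ∞) η → HasCompactSupport η → ∀ i,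
    ∫ x, fderiv ℝ η x (basisVec i) • v x = -∫ x, η x • G i x

/-- A smooth probability density concentrated in the ball of radius `δ`. -/
structure IsMollifier (η : E n → ℝ) (δ : ℝ) : Prop where
  contDiff : ContDiff ℝ ((⊤ : ℕ∞) : WithTop ℕ∞) η
  compact : HasCompactSupport η
  nonneg : ∀ x, 0 ≤ η x
  integral_eq : ∫ x, η x = 1
  support_subset : Function.support η ⊆ Metric.closedBall 0 δ

/-- The convolution of `v` with a mollifier. -/
def mollify (η : E n → ℝ) (v : E n → ℂ) : E n → ℂ :=
  convolution η v (ContinuousLinearMap.lsmul ℝ ℝ) volume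

theorem mollify_apply (η : E n → ℝ) (v : E n → ℂ) (x : E n) :
    mollify η v x = ∫ t, η t • v (x - t) := rfl

theorem tendsto_lintegral_translate {v : E n → ℂ} (hv : MemLp v 2 volume) :
    Tendsto (fun t : E n => ∫⁻ x, ‖v (x - t) - v x‖ₑ ^ 2) (𝓝 0) (𝓝 0) := by
  have : Fact ((2 : ENNReal) ≠ ⊤) := ⟨by norm_num⟩
  let f : Lp ℂ 2 (volume : Measure (E n)) := hv.toLp v
  have h1 : Continuous fun t : E n => (DomAddAct.mk (-t) +ᵥ f) - f := by
    have h2 : Continuous fun t : E n => DomAddAct.mk (-t) :=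
      DomAddAct.continuous_mk.comp continuous_neg
    exact (h2.vadd continuous_const).sub continuous_const
  have h3 : ∀ t : E n, ∫⁻ x, ‖v (x - t) - v x‖ₑ ^ 2 = ‖(DomAddAct.mk (-t) +ᵥ f) - f‖ₑ ^ 2 := by
    intro t
    rw [enorm_sq_Lp]
    apply lintegral_congr_ae
    have h4 : DomAddAct.mk (-t) +ᵥ f
        = (hv.comp_measurePreserving (measurePreserving_vadd (-t) volume)).toLp _ :=
      DomAddAct.mk_vadd_toLp (-t) hv
    filter_upwards [Lp.coeFn_sub (DomAddAct.mk (-t) +ᵥ f) f, hv.coeFn_toLp,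
      (hv.comp_measurePreserving (measurePreserving_vadd (-t) volume)).coeFn_toLp] with x h5 h6 h7
    rw [h5, Pi.sub_apply, h4, h7, h6]
    simp only [Function.comp_apply, vadd_eq_add, sub_eq_neg_add]
  simp only [h3]
  have h8 := (h1.tendsto 0).enorm
  have h9 : (DomAddAct.mk (-(0 : E n)) +ᵥ f) - f = 0 := by
    rw [neg_zero]
    have : DomAddAct.mk (0 : E n) = 0 := rfl
    rw [this, zero_vadd, sub_self]
  rw [h9, enorm_zero] at h8
  simpa [Function.comp_def] using ((ENNReal.continuous_pow 2).tendsto 0).comp h8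

theorem lintegral_mollify_sub_le {η : E n → ℝ} {δ : ℝ} (hη : IsMollifier η δ) {v : E n → ℂ}
    (hv : MemLp v 2 volume) (hvm : Measurable v) {ε : ENNReal}
    (h : ∀ t ∈ Metric.closedBall (0 : E n) δ, ∫⁻ x, ‖v (x - t) - v x‖ₑ ^ 2 ≤ ε) :
    ∫⁻ x, ‖mollify η v x - v x‖ₑ ^ 2 ≤ ε := by
  have hloc : LocallyIntegrable v volume := hv.locallyIntegrable (by norm_num)
  have hηc := hη.contDiff.continuous
  have hηm : Measurable fun t => ENNReal.ofReal (η t) := hηc.measurable.ennreal_ofReal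
  have hηint : Integrable η volume := hηc.integrable_of_hasCompactSupport hη.compact
  have hη1 : ∫⁻ t, ENNReal.ofReal (η t) = 1 := by
    rw [← ofReal_integral_eq_lintegral_ofReal hηint (Eventually.of_forall hη.nonneg),
      hη.integral_eq, ENNReal.ofReal_one]
  let π : Measure (E n) := volume.withDensity fun t => ENNReal.ofReal (η t)
  have hπ : IsProbabilityMeasure π := ⟨by
    rw [withDensity_apply _ MeasurableSet.univ, Measure.restrict_univ, hη1]⟩
  have hmeas : Measurable fun q : E n × E n => ‖v (q.1 - q.2) - v q.1‖ₑ ^ 2 :=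
    (((hvm.comp (measurable_fst.sub measurable_snd)).sub
      (hvm.comp measurable_fst)).enorm).pow_const 2
  have h1 : ∀ x, ‖mollify η v x - v x‖ₑ ^ 2 ≤ ∫⁻ t, ‖v (x - t) - v x‖ₑ ^ 2 ∂π := by
    intro x
    have h2 : mollify η v x - v x = ∫ t, (v (x - t) - v x) ∂π := by
      have h3 : Integrable (fun t => η t • v (x - t)) volume :=
        hη.compact.convolutionExists_left (ContinuousLinearMap.lsmul ℝ ℝ) hηc hloc x
      rw [integral_withDensity_eq_integral_toReal_smul hηm
        (Eventually.of_forall fun _ => ENNReal.ofReal_lt_top)]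
      have h4 : ∀ t, (ENNReal.ofReal (η t)).toReal • (v (x - t) - v x)
          = η t • v (x - t) - η t • v x := by
        intro t
        rw [ENNReal.toReal_ofReal (hη.nonneg t), smul_sub]
      simp only [h4]
      rw [integral_sub h3 (hηint.smul_const _), integral_smul_const, hη.integral_eq, one_smul,
        mollify_apply]
    rw [h2]
    calc ‖∫ t, (v (x - t) - v x) ∂π‖ₑ ^ 2 ≤ (∫⁻ t, ‖v (x - t) - v x‖ₑ ∂π) ^ 2 := by
          gcongr
          exact enorm_integral_le_lintegral_enorm _
      _ ≤ _ := by
          have := ENNReal.lintegral_mul_le_Lp_mul_Lq π Real.HolderConjugate.two_two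
            (f := fun t => ‖v (x - t) - v x‖ₑ) (g := fun _ => 1)
            ((hvm.comp (measurable_const.sub measurable_id)).sub
              measurable_const).enorm.aemeasurable
            aemeasurable_const
          simp only [Pi.mul_apply, mul_one, ENNReal.one_rpow, lintegral_one, measure_univ] at this
          calc _ ≤ _ := pow_le_pow_left' this 2
            _ = _ := by
              rw [← ENNReal.rpow_natCast, ← ENNReal.rpow_mul]
              norm_num
  calc ∫⁻ x, ‖mollify η v x - v x‖ₑ ^ 2
      ≤ ∫⁻ x, ∫⁻ t, ‖v (x - t) - v x‖ₑ ^ 2 ∂π := lintegral_mono h1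
    _ = ∫⁻ t, ∫⁻ x, ‖v (x - t) - v x‖ₑ ^ 2 ∂volume ∂π := lintegral_lintegral_swap hmeas.aemeasurable
    _ ≤ ∫⁻ t, ε ∂π := by
        apply lintegral_mono_ae
        rw [ae_withDensity_iff hηm]
        refine Eventually.of_forall fun t ht => h t (hη.support_subset ?_)
        intro h0
        exact ht (by rw [h0, ENNReal.ofReal_zero])
    _ = ε := by simp

theorem tendsto_eLpNorm_of_lintegral {α : Type*} [MeasurableSpace α] {μ : Measure α}
    {f : ℕ → α → ℂ} (h : Tendsto (fun k => ∫⁻ x, ‖f k x‖ₑ ^ 2 ∂μ) atTop (𝓝 0)) :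
    Tendsto (fun k => eLpNorm (f k) 2 μ) atTop (𝓝 0) := by
  have h1 : ∀ k, eLpNorm (f k) 2 μ = (∫⁻ x, ‖f k x‖ₑ ^ 2 ∂μ) ^ (1 / 2 : ℝ) := by
    intro k
    rw [eLpNorm_eq_lintegral_rpow_enorm_toReal (by norm_num) (by norm_num)]
    simp
  simp only [h1]
  have := (ENNReal.continuous_rpow_const (y := (1 / 2 : ℝ))).tendsto 0 |>.comp h
  simpa [Function.comp_def] using this

/-- Mollification commutes with weak derivatives. -/
theorem pderiv_mollify {η : E n → ℝ} {δ : ℝ} (hη : IsMollifier η δ) {v : E n → ℂ}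
    {G : Fin n → E n → ℂ} (hv : LocallyIntegrable v volume) (hG : IsWeakGrad v G) (i : Fin n)
    (x : E n) : pderiv i (mollify η v) x = mollify η (G i) x := by
  have h1 := hη.compact.hasFDerivAt_convolution_left (ContinuousLinearMap.lsmul ℝ ℝ (E := ℂ))
    (hη.contDiff.of_le (by simp)) hv x
  have h2 : pderiv i (mollify η v) x = ∫ t, fderiv ℝ η t (basisVec i) • v (x - t) := by
    unfold pderiv mollify
    rw [h1.fderiv, convolution_def, ContinuousLinearMap.integral_apply]
    · rfl
    · exact (hη.compact.fderiv ℝ).convolutionExists_left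
        (ContinuousLinearMap.precompL (E n) (ContinuousLinearMap.lsmul ℝ ℝ (E := ℂ)))
        (hη.contDiff.continuous_fderiv (by simp)) hv x
  let ζ : E n → ℝ := fun y => η (x - y)
  have hζ : ContDiff ℝ ((⊤ : ℕ∞) : WithTop ℕ∞) ζ :=
    hη.contDiff.comp (contDiff_const.sub contDiff_id)
  have hζc : HasCompactSupport ζ := hη.compact.comp_homeomorph (Homeomorph.subLeft x)
  have hζd : ∀ y, fderiv ℝ ζ y (basisVec i) = -fderiv ℝ η (x - y) (basisVec i) := by
    intro y
    have h3 : HasFDerivAt ζ ((fderiv ℝ η (x - y)).comp (-ContinuousLinearMap.id ℝ (E n))) y :=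
      (hη.contDiff.differentiable (by simp) (x - y)).hasFDerivAt.comp y
        ((hasFDerivAt_id y).const_sub x)
    rw [h3.fderiv]
    simp
  have h4 := hG ζ hζ hζc i
  simp only [hζd, neg_smul] at h4
  rw [integral_neg, neg_inj] at h4
  rw [h2, mollify_apply, ← integral_sub_left_eq_self
    (fun t => fderiv ℝ η t (basisVec i) • v (x - t))
    volume x, ← integral_sub_left_eq_self (fun t => η t • G i (x - t)) volume x]
  simpa only [sub_sub_cancel] using h4

open scoped Pointwise in
/-- A function that mollifiers do not push out of `D` belongs to `W₀^{1,2}(D)`. -/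
theorem mem_dirichletGradient_of_mollify {D K : Set (E n)} (hK : IsCompact K)
    {v : E n → ℂ} {G : Fin n → E n → ℂ} (hv : MemLp v 2 volume) (hvm : Measurable v)
    (hG : ∀ i, MemLp (G i) 2 volume) (hGm : ∀ i, Measurable (G i)) (hvG : IsWeakGrad v G)
    (hvK : ∀ x ∉ K, v x = 0)
    (hη : ∀ δ > 0, ∃ η : E n → ℝ, IsMollifier η δ ∧ ∀ x ∈ K, ∀ t ∈ tsupport η, x + t ∈ D) :
    ((hv.restrict D).toLp v, fun i => ((hG i).restrict D).toLp (G i)) ∈ dirichletGradient D := by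
  choose η hη hηD using fun k : ℕ => hη (1 / ((k : ℝ) + 1)) (by positivity)
  have hlim : ∀ w : E n → ℂ, MemLp w 2 volume → Measurable w →
      Tendsto (fun k => eLpNorm (fun x => mollify (η k) w x - w x) 2 volume) atTop (𝓝 0) := by
    intro w hw hwm
    apply tendsto_eLpNorm_of_lintegral
    rw [ENNReal.tendsto_nhds_zero]
    intro ε hε
    have h1 := (ENNReal.tendsto_nhds_zero.1 (tendsto_lintegral_translate hw)) ε hε
    obtain ⟨δ, hδ, h2⟩ := Metric.eventually_nhds_iff_ball.1 h1
    have h3 := (tendsto_order.1 (tendsto_one_div_add_atTop_nhds_zero_nat (𝕜 := ℝ))).2 δ hδ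
    filter_upwards [h3] with k hk
    exact lintegral_mollify_sub_le (hη k) hw hwm fun t ht =>
      h2 t (Metric.closedBall_subset_ball hk ht)
  have hlim' : ∀ (w : E n → ℂ) (hw : MemLp w 2 volume), Measurable w →
      Tendsto (fun k => eLpNorm (fun x => mollify (η k) w x - (hw.restrict D).toLp w x) 2
        (volume.restrict D)) atTop (𝓝 0) := by
    intro w hw hwm
    refine tendsto_of_tendsto_of_tendsto_of_le_of_le tendsto_const_nhds (hlim w hw hwm)
      (fun _ => zero_le) fun k => ?_
    refine le_trans (le_of_eq (eLpNorm_congr_ae ?_))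
      (eLpNorm_mono_measure _ (Measure.restrict_le_self (s := D)))
    filter_upwards [(hw.restrict D).coeFn_toLp] with x hx
    rw [hx]
  have hloc : LocallyIntegrable v volume := hv.locallyIntegrable (by norm_num)
  refine ⟨fun k => mollify (η k) v, fun k => ⟨?_, ?_⟩, hlim' v hv hvm, fun i => ?_⟩
  · exact (hη k).compact.contDiff_convolution_left _ (hη k).contDiff hloc
  · have hc : IsCompact (K + tsupport (η k)) := hK.add (hη k).compact
    have hsub : tsupport (mollify (η k) v) ⊆ K + tsupport (η k) := by
      refine closure_minimal ?_ hc.isClosed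
      refine (support_convolution_subset_swap _).trans (Set.add_subset_add ?_ subset_closure)
      intro x hx
      by_contra hxK
      exact hx (hvK x hxK)
    refine ⟨hc.of_isClosed_subset isClosed_closure hsub, hsub.trans ?_⟩
    rintro _ ⟨x, hx, t, ht, rfl⟩
    exact hηD k x hx t ht
  · have h5 : ∀ k x, fderiv ℝ (mollify (η k) v) x (basisVec i) = mollify (η k) (G i) x :=
      fun k x => pderiv_mollify (hη k) hloc hvG i x
    simp only [h5]
    exact hlim' (G i) (hG i) (hGm i)

/-! ### Functions vanishing outside a Lipschitz domain -/

/-- The normalized bump function of radius `s` centred at `c`. -/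
theorem exists_mollifier (c : E n) {s δ : ℝ} (hs : 0 < s) (h : ‖c‖ + s ≤ δ) :
    ∃ η : E n → ℝ, IsMollifier η δ ∧ tsupport η = Metric.closedBall c s := by
  let f : ContDiffBump c := ⟨s / 2, s, by positivity, by linarith⟩
  refine ⟨f.normed volume, ⟨f.contDiff_normed, f.hasCompactSupport_normed, f.nonneg_normed,
    f.integral_normed, ?_⟩, f.tsupport_normed_eq⟩
  rw [f.support_normed_eq]
  intro x hx
  rw [mem_closedBall_zero_iff]
  have h1 : ‖x - c‖ < s := mem_ball_iff_norm.1 hx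
  have h2 := norm_add_le (x - c) c
  rw [sub_add_cancel] at h2
  linarith

/-- Near each point of its closure, a Lipschitz domain can be pushed into itself by arbitrarily
small translations, with room for a mollification. -/
theorem exists_local_mollifier {D : Set (E n)} (hopen : IsOpen D) (hlip : HasLipschitzBoundary D)
    (p : E n) : p ∈ closure D → ∃ U : Set (E n), IsOpen U ∧ p ∈ U ∧ ∀ δ > 0, ∃ η : E n → ℝ,
      IsMollifier η δ ∧ ∀ x ∈ U ∩ closure D, ∀ t ∈ tsupport η, x + t ∈ D := by
  intro hp
  by_cases hpD : p ∈ D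
  · obtain ⟨ρ, hρ, hball⟩ := Metric.isOpen_iff.1 hopen p hpD
    refine ⟨Metric.ball p (ρ / 2), Metric.isOpen_ball, Metric.mem_ball_self (by positivity), ?_⟩
    intro δ hδ
    have hs : 0 < min δ (ρ / 4) := by positivity
    obtain ⟨η, hη, hsupp⟩ := exists_mollifier (0 : E n) hs (δ := δ) (by simp)
    refine ⟨η, hη, fun x hx t ht => hball ?_⟩
    rw [hsupp, mem_closedBall_zero_iff] at ht
    have h1 := mem_ball_iff_norm.1 hx.1
    rw [mem_ball_iff_norm, add_sub_right_comm]
    have := norm_add_le (x - p) t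
    linarith [min_le_right δ (ρ / 4)]
  · have hpf : p ∈ frontier D := ⟨hp, by rwa [hopen.interior_eq]⟩
    obtain ⟨e, he, L, γ, ρ, hγ, hρ, hchart⟩ := hlip p hpf
    set P := (Submodule.span ℝ {e})ᗮ.orthogonalProjectionOnto
    -- the graph condition passes to the closure
    have hcl : ∀ x ∈ Metric.ball p ρ, x ∈ closure D → γ (P x) ≤ inner ℝ e x := by
      intro x hx hxD
      have h1 : x ∈ closure (Metric.ball p ρ ∩ D) :=
        Metric.isOpen_ball.inter_closure ⟨hx, hxD⟩
      have h2 : IsClosed {x : E n | γ (P x) ≤ inner ℝ e x} :=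
        isClosed_le (hγ.continuous.comp P.continuous) (by fun_prop)
      refine closure_minimal ?_ h2 h1
      intro y hy
      exact ((hchart y hy.1).1 hy.2).le
    refine ⟨Metric.ball p (ρ / 2), Metric.isOpen_ball, Metric.mem_ball_self (by positivity), ?_⟩
    intro δ hδ
    set t := min (δ / 2) (ρ / 8) with ht
    have ht0 : 0 < t := by positivity
    set c : ℝ := 1 / (2 * (1 + L)) with hc
    have hL : (0 : ℝ) ≤ L := L.2
    have hc0 : 0 < c := by positivity
    have hcL : c * (1 + L) < 1 := by
      rw [hc]
      field_simp
      norm_num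
    have hc1 : c < 1 := by nlinarith
    have htδ : t ≤ δ / 2 := min_le_left _ _
    have htρ : t ≤ ρ / 8 := min_le_right _ _
    have hte : ‖t • e‖ = t := by rw [norm_smul, he, mul_one, Real.norm_of_nonneg ht0.le]
    obtain ⟨η, hη, hsupp⟩ := exists_mollifier (t • e) (s := c * t) (δ := δ) (by positivity)
      (by rw [hte]; nlinarith)
    refine ⟨η, hη, fun x hx y hy => ?_⟩
    rw [hsupp, mem_closedBall_iff_norm] at hy
    obtain ⟨z, rfl⟩ : ∃ z, y = t • e + z := ⟨y - t • e, by abel⟩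
    rw [add_sub_cancel_left] at hy
    have h1 := mem_ball_iff_norm.1 hx.1
    have hxρ : x ∈ Metric.ball p ρ := Metric.ball_subset_ball (by linarith) hx.1
    have hmem : x + (t • e + z) ∈ Metric.ball p ρ := by
      rw [mem_ball_iff_norm, add_sub_right_comm]
      have h2 := norm_add_le (x - p) (t • e + z)
      have h3 := norm_add_le (t • e) z
      nlinarith
    rw [hchart _ hmem]
    have hPe : P (t • e) = 0 := by
      rw [map_smul]
      have : P e = 0 := by
        apply Submodule.orthogonalProjectionOnto_eq_zero_iff.2
        exact Submodule.le_orthogonal_orthogonal _ (Submodule.mem_span_singleton_self e)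
      rw [this, smul_zero]
    have h4 : P (x + (t • e + z)) = P x + P z := by
      rw [map_add, map_add, hPe, zero_add]
    have h5 : γ (P x + P z) ≤ γ (P x) + L * ‖z‖ := by
      have h6 := hγ.dist_le_mul (P x + P z) (P x)
      rw [Real.dist_eq, dist_eq_norm, add_sub_cancel_left] at h6
      have h7 : ‖P z‖ ≤ ‖z‖ := Submodule.norm_orthogonalProjectionOnto_apply_le _ z
      have h8 := le_abs_self (γ (P x + P z) - γ (P x))
      nlinarith
    have h9 : inner ℝ e (x + (t • e + z)) = inner ℝ e x + (t + inner ℝ e z) := by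
      rw [inner_add_right, inner_add_right, inner_smul_right, real_inner_self_eq_norm_sq, he]
      ring
    have h10 : -‖z‖ ≤ inner ℝ e z := by
      have := abs_real_inner_le_norm e z
      rw [he, one_mul] at this
      exact (abs_le.1 this).1
    have h11 := hcl x hxρ hx.2
    rw [h4, h9]
    nlinarith

/-- The product rule for weak gradients. -/
theorem IsWeakGrad.smul {v : E n → ℂ} {G : Fin n → E n → ℂ} (h : IsWeakGrad v G)
    (hv : LocallyIntegrable v volume) (hG : ∀ i, LocallyIntegrable (G i) volume)
    {χ : E n → ℝ} (hχ : ContDiff ℝ ((⊤ : ℕ∞) : WithTop ℕ∞) χ) :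
    IsWeakGrad (fun x => χ x • v x)
      (fun i x => χ x • G i x + fderiv ℝ χ x (basisVec i) • v x) := by
  intro η hη hηc i
  have h1 := h (fun x => η x * χ x) (hη.mul hχ) (hηc.mul_right) i
  have hd : ∀ x, fderiv ℝ (fun x => η x * χ x) x (basisVec i)
      = η x * fderiv ℝ χ x (basisVec i) + χ x * fderiv ℝ η x (basisVec i) := by
    intro x
    rw [fderiv_fun_mul (hη.differentiable (by simp) x) (hχ.differentiable (by simp) x)]
    simp
  have hdχ : Continuous fun x => fderiv ℝ χ x (basisVec i) :=
    (hχ.continuous_fderiv (by simp)).clm_apply continuous_const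
  have hdη : Continuous fun x => fderiv ℝ η x (basisVec i) :=
    (hη.continuous_fderiv (by simp)).clm_apply continuous_const
  have i1 : Integrable (fun x => (χ x * fderiv ℝ η x (basisVec i)) • v x) volume :=
    hv.integrable_smul_left_of_hasCompactSupport (hχ.continuous.mul hdη)
      ((hηc.fderiv_apply ℝ _).mul_left)
  have i2 : Integrable (fun x => (η x * fderiv ℝ χ x (basisVec i)) • v x) volume :=
    hv.integrable_smul_left_of_hasCompactSupport (hη.continuous.mul hdχ) hηc.mul_right
  have i3 : Integrable (fun x => (η x * χ x) • G i x) volume :=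
    (hG i).integrable_smul_left_of_hasCompactSupport (hη.continuous.mul hχ.continuous) hηc.mul_right
  simp only [hd, add_smul] at h1
  rw [integral_add i2 i1] at h1
  have e1 : ∫ x, fderiv ℝ η x (basisVec i) • χ x • v x
      = ∫ x, (χ x * fderiv ℝ η x (basisVec i)) • v x := by
    refine integral_congr_ae (Eventually.of_forall fun x => ?_)
    simp only [smul_smul, mul_comm]
  have e2 : ∫ x, η x • (χ x • G i x + fderiv ℝ χ x (basisVec i) • v x)
      = (∫ x, (η x * χ x) • G i x) + ∫ x, (η x * fderiv ℝ χ x (basisVec i)) • v x := by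
    rw [← integral_add i3 i2]
    refine integral_congr_ae (Eventually.of_forall fun x => ?_)
    simp only [smul_add, smul_smul]
  rw [e1, e2]
  linear_combination h1

open scoped Manifold in
/-- A function on `ℝⁿ` with weak gradient in `L²` that vanishes outside a bounded Lipschitz domain
`D` belongs to `W₀^{1,2}(D)`. -/
theorem mem_dirichletGradient_of_isWeakGrad {D : Set (E n)} (hopen : IsOpen D)
    (hbdd : Bornology.IsBounded D) (hlip : HasLipschitzBoundary D) {v : E n → ℂ}
    {G : Fin n → E n → ℂ} (hv : MemLp v 2 volume) (hvm : Measurable v)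
    (hG : ∀ i, MemLp (G i) 2 volume) (hGm : ∀ i, Measurable (G i)) (hvG : IsWeakGrad v G)
    (hvD : ∀ x ∉ D, v x = 0) :
    ((hv.restrict D).toLp v, fun i => ((hG i).restrict D).toLp (G i)) ∈ dirichletGradient D := by
  have hcomp : IsCompact (closure D) := hbdd.isCompact_closure
  choose! U hUo hpU hU using exists_local_mollifier hopen hlip
  obtain ⟨f, hf⟩ := SmoothPartitionOfUnity.exists_isSubordinate 𝓘(ℝ, E n) (s := closure D)
    isClosed_closure (fun p : closure D => U p) (fun p => hUo p p.2)
    (fun p hp => Set.mem_iUnion.2 ⟨⟨p, hp⟩, hpU p hp⟩)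
  have hsm : ∀ j, ContDiff ℝ ((⊤ : ℕ∞) : WithTop ℕ∞) (f j) := fun j => (f j).contMDiff.contDiff
  have hfin := f.locallyFinite.finite_nonempty_inter_compact hcomp
  set J := hfin.toFinset
  have hsum : ∀ x ∈ D, ∑ j ∈ J, f j x = 1 := by
    intro x hx
    refine f.sum_finsupport' x (subset_closure hx) fun j hj => ?_
    rw [Set.Finite.mem_toFinset]
    exact ⟨x, (f.mem_finsupport x).1 hj, subset_closure hx⟩
  have hdsum : ∀ x ∈ D, ∀ i, ∑ j ∈ J, fderiv ℝ (f j) x (basisVec i) = 0 := by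
    intro x hx i
    have h1 : (fun y => ∑ j ∈ J, f j y) =ᶠ[𝓝 x] fun _ => 1 := by
      filter_upwards [hopen.mem_nhds hx] with y hy using hsum y hy
    have h2 := h1.fderiv_eq (𝕜 := ℝ)
    rw [fderiv_fun_sum fun j _ => (hsm j).differentiable (by simp) x, fderiv_const_apply] at h2
    rw [← sum_apply, h2]
    rfl
  have hvloc : LocallyIntegrable v volume := hv.locallyIntegrable (by norm_num)
  have hGloc : ∀ i, LocallyIntegrable (G i) volume := fun i =>
    (hG i).locallyIntegrable (by norm_num)
  have hle : ∀ j x, ‖f j x‖ ≤ 1 := fun j x => by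
    rw [Real.norm_of_nonneg (f.nonneg j x)]
    exact f.le_one j x
  have hdc : ∀ j i, Continuous fun x => fderiv ℝ (f j) x (basisVec i) := fun j i =>
    ((hsm j).continuous_fderiv (by simp)).clm_apply continuous_const
  -- the pieces of `v`
  have m1 : ∀ j, MemLp (fun x => f j x • v x) 2 volume := fun j =>
    hv.of_le_mul (c := 1) ((hsm j).continuous.aestronglyMeasurable.smul hv.1)
      (Eventually.of_forall fun x => by
        rw [norm_smul]
        gcongr
        exact hle j x)
  have m2 : ∀ j i, MemLp (fun x => f j x • G i x) 2 volume := fun j i =>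
    (hG i).of_le_mul (c := 1) ((hsm j).continuous.aestronglyMeasurable.smul (hG i).1)
      (Eventually.of_forall fun x => by
        rw [norm_smul]
        gcongr
        exact hle j x)
  have m3 : ∀ j i, MemLp (fun x => fderiv ℝ (f j) x (basisVec i) • v x) 2 volume := by
    intro j i
    obtain ⟨C, hC⟩ := hcomp.exists_bound_of_continuousOn (hdc j i).continuousOn
    refine hv.of_le_mul (c := C) ((hdc j i).aestronglyMeasurable.smul hv.1)
      (Eventually.of_forall fun x => ?_)
    by_cases hx : x ∈ D
    · rw [norm_smul]
      gcongr
      exact hC x (subset_closure hx)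
    · simp [hvD x hx]
  have m4 : ∀ j i, MemLp (fun x => f j x • G i x + fderiv ℝ (f j) x (basisVec i) • v x) 2 volume :=
    fun j i => (m2 j i).add (m3 j i)
  have key : ∀ j : closure D, (((m1 j).restrict D).toLp _, fun i => ((m4 j i).restrict D).toLp _)
      ∈ dirichletGradient D := by
    intro j
    have hK : IsCompact (tsupport (f j) ∩ closure D) :=
      hcomp.inter_left (isClosed_tsupport _)
    refine mem_dirichletGradient_of_mollify hK (m1 j) ?_ (m4 j) ?_
      (hvG.smul hvloc hGloc (hsm j)) ?_ ?_
    · exact (hsm j).continuous.measurable.smul hvm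
    · exact fun i => ((hsm j).continuous.measurable.smul (hGm i)).add
        ((hdc j i).measurable.smul hvm)
    · intro x hx
      by_cases hxD : x ∈ D
      · have : x ∉ tsupport (f j) := fun h => hx ⟨h, subset_closure hxD⟩
        simp [image_eq_zero_of_notMem_tsupport this]
      · simp [hvD x hxD]
    · intro δ hδ
      obtain ⟨η, hη, hη'⟩ := hU j j.2 δ hδ
      exact ⟨η, hη, fun x hx => hη' x ⟨hf j hx.1, hx.2⟩⟩
  rw [dirichletGradient_eq] at key ⊢
  have hs := Submodule.sum_mem (testPairs D).topologicalClosure (t := J) fun j _ => key j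
  refine (congrArg (· ∈ (testPairs D).topologicalClosure) (Prod.ext ?_ ?_)).mpr hs
  · rw [Prod.fst_sum]
    apply Lp.ext
    have hall : ∀ᵐ x ∂volume.restrict D, ∀ j ∈ J,
        ((m1 j).restrict D).toLp _ x = f j x • v x := by
      rw [Finset.eventually_all]
      exact fun j _ => ((m1 j).restrict D).coeFn_toLp
    filter_upwards [hall, (hv.restrict D).coeFn_toLp, ae_restrict_mem hopen.measurableSet,
      Lp.coeFn_finsetSum J fun j => ((m1 j).restrict D).toLp _] with x h1 h2 h3 h4
    rw [h4, h2, Finset.sum_apply, Finset.sum_congr rfl h1, ← Finset.sum_smul, hsum x h3, one_smul]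
  · funext i
    rw [Prod.snd_sum, Finset.sum_apply]
    apply Lp.ext
    have hall : ∀ᵐ x ∂volume.restrict D, ∀ j ∈ J, ((m4 j i).restrict D).toLp _ x
        = f j x • G i x + fderiv ℝ (f j) x (basisVec i) • v x := by
      rw [Finset.eventually_all]
      exact fun j _ => ((m4 j i).restrict D).coeFn_toLp
    filter_upwards [hall, ((hG i).restrict D).coeFn_toLp, ae_restrict_mem hopen.measurableSet,
      Lp.coeFn_finsetSum J fun j => ((m4 j i).restrict D).toLp _] with x h1 h2 h3 h4
    rw [h4, h2, Finset.sum_apply, Finset.sum_congr rfl h1, Finset.sum_add_distrib,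
      ← Finset.sum_smul, ← Finset.sum_smul, hsum x h3, hdsum x h3, one_smul, zero_smul, add_zero]

/-! ### Dilations about the centre of the cell -/

/-- The dilation of `ℝⁿ` by the factor `a` about the centre of the cell. -/
def dil (a : ℝ) (x : E n) : E n := a • (x - cellCentre n) + cellCentre n

theorem dil_dil_inv {a : ℝ} (ha : a ≠ 0) (x : E n) : dil a (dil a⁻¹ x) = x := by
  simp [dil, smul_smul, ha]

theorem dil_inv_dil {a : ℝ} (ha : a ≠ 0) (x : E n) : dil a⁻¹ (dil a x) = x := by
  simp [dil, smul_smul, ha]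

theorem contDiff_dil (a : ℝ) : ContDiff ℝ ((⊤ : ℕ∞) : WithTop ℕ∞) (dil a : E n → E n) := by
  unfold dil
  fun_prop

theorem continuous_dil (a : ℝ) : Continuous (dil a : E n → E n) := (contDiff_dil a).continuous

theorem measurable_dil (a : ℝ) : Measurable (dil a : E n → E n) := (continuous_dil a).measurable

/-- The dilation as a homeomorphism. -/
def dilHomeomorph {a : ℝ} (ha : a ≠ 0) : E n ≃ₜ E n where
  toFun := dil a
  invFun := dil a⁻¹
  left_inv := dil_inv_dil ha
  right_inv := dil_dil_inv ha
  continuous_toFun := continuous_dil a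
  continuous_invFun := continuous_dil a⁻¹

theorem scaled_eq_preimage {r : ℝ} (hr : r ≠ 0) (D : Set (E n)) :
    scaled D r = dil r⁻¹ ⁻¹' D :=
  (dilHomeomorph (n := n) hr).image_eq_preimage_symm D

theorem map_dil_volume {a : ℝ} (ha : 0 < a) :
    Measure.map (dil a) (volume : Measure (E n)) = ENNReal.ofReal ((a ^ n)⁻¹) • volume := by
  have h : (dil a : E n → E n) = (fun x => x + cellCentre n) ∘ (fun x => a • x) ∘
      (fun x => x - cellCentre n) := rfl
  rw [h, ← Measure.map_map (by fun_prop) (by fun_prop),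
    ← Measure.map_map (by fun_prop) (by fun_prop),
    (measurePreserving_sub_right volume (cellCentre n)).map_eq,
    Measure.map_addHaar_smul volume ha.ne', finrank_euclideanSpace_fin, abs_of_pos (by positivity),
    Measure.map_smul, (measurePreserving_add_right volume (cellCentre n)).map_eq]

theorem map_dil_restrict {a : ℝ} (ha : 0 < a) {D D' : Set (E n)} (hD : D' = dil a ⁻¹' D) :
    Measure.map (dil a) (volume.restrict D') =
      ENNReal.ofReal ((a ^ n)⁻¹) • volume.restrict D := by
  have h : MeasurableEmbedding (dil a : E n → E n) := (dilHomeomorph ha.ne').measurableEmbedding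
  rw [hD, ← h.restrict_map volume D, map_dil_volume ha, Measure.restrict_smul]

section Dilate

variable {a : ℝ} {D D' : Set (E n)}

theorem eLpNorm_comp_dil (ha : 0 < a) (hD : D' = dil a ⁻¹' D)
    {F : E n → ℂ} (hF : AEStronglyMeasurable F (volume.restrict D)) :
    eLpNorm (fun x => F (dil a x)) 2 (volume.restrict D') =
      ENNReal.ofReal ((a ^ n)⁻¹) ^ (2⁻¹ : ℝ) * eLpNorm F 2 (volume.restrict D) := by
  have h := eLpNorm_map_measure (p := 2) (μ := volume.restrict D') (f := dil a) (g := F)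
    (by rw [map_dil_restrict ha hD]; exact hF.smul_measure _) (measurable_dil a).aemeasurable
  rw [map_dil_restrict ha hD, eLpNorm_smul_measure_of_ne_top (by simp)] at h
  simpa [Function.comp_def] using h.symm

theorem quasiMeasurePreserving_dil (ha : 0 < a) (hD : D' = dil a ⁻¹' D) :
   
    Measure.QuasiMeasurePreserving (dil a) (volume.restrict D') (volume.restrict D) :=
  ⟨measurable_dil a, by
    rw [map_dil_restrict ha hD]
    exact Measure.smul_absolutelyContinuous⟩

theorem memLp_comp_dil (ha : 0 < a) (hD : D' = dil a ⁻¹' D)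
    (u : L2 D) : MemLp (fun x => u (dil a x)) 2 (volume.restrict D') := by
  refine ⟨(Lp.aestronglyMeasurable u).comp_quasiMeasurePreserving
    (quasiMeasurePreserving_dil ha hD), ?_⟩
  rw [eLpNorm_comp_dil ha hD (Lp.aestronglyMeasurable u)]
  exact ENNReal.mul_lt_top (by finiteness) (Lp.memLp u).2

/-- The function `u ∘ dil a` for `u ∈ L²(D)`. -/
def dilate (ha : 0 < a) (hD : D' = dil a ⁻¹' D)
    (u : L2 D) : L2 D' := (memLp_comp_dil ha hD u).toLp _

theorem coeFn_dilate (ha : 0 < a) (hD : D' = dil a ⁻¹' D)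
    (u : L2 D) :
    dilate ha hD u =ᵐ[volume.restrict D'] fun x => u (dil a x) :=
  (memLp_comp_dil ha hD u).coeFn_toLp

theorem integral_comp_dil (ha : 0 < a) (hD : D' = dil a ⁻¹' D)
    {F : E n → ℂ} (hF : AEStronglyMeasurable F (volume.restrict D)) :
    ∫ x in D', F (dil a x) = ((a ^ n)⁻¹ : ℝ) • ∫ x in D, F x := by
  rw [← integral_map (measurable_dil a).aemeasurable
    (by rw [map_dil_restrict ha hD]; exact hF.smul_measure _), map_dil_restrict ha hD,
    integral_smul_measure, ENNReal.toReal_ofReal (by positivity)]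

theorem integral_dilate (ha : 0 < a) (hD : D' = dil a ⁻¹' D)
    (u : L2 D) :
    ∫ x in D', dilate ha hD u x = ((a ^ n)⁻¹ : ℝ) • ∫ x in D, u x := by
  rw [integral_congr_ae (coeFn_dilate ha hD u), integral_comp_dil ha hD (Lp.aestronglyMeasurable u)]

theorem inner_dilate (ha : 0 < a) (hD : D' = dil a ⁻¹' D)
    (u v : L2 D) :
    inner ℂ (dilate ha hD u) (dilate ha hD v) = ((a ^ n)⁻¹ : ℝ) • inner ℂ u v := by
  rw [L2.inner_def, L2.inner_def, ← integral_comp_dil ha hD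
    (L2.integrable_inner u v).aestronglyMeasurable]
  refine integral_congr_ae ?_
  filter_upwards [coeFn_dilate ha hD u, coeFn_dilate ha hD v] with x h1 h2
  rw [h1, h2]

theorem dilate_smul (ha : 0 < a) (hD : D' = dil a ⁻¹' D)
    (c : ℂ) (u : L2 D) : dilate ha hD (c • u) = c • dilate ha hD u := by
  apply Lp.ext
  filter_upwards [coeFn_dilate ha hD u, coeFn_dilate ha hD (c • u),
    Lp.coeFn_smul c (dilate ha hD u),
    (quasiMeasurePreserving_dil ha hD).ae (Lp.coeFn_smul c u)] with x h1 h2 h3 h4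
  rw [h2, h3, h4, Pi.smul_apply, Pi.smul_apply, h1]

theorem dilate_dilate_inv (ha : 0 < a) (hD : D' = dil a ⁻¹' D)
    (hD' : D = dil a⁻¹ ⁻¹' D') (u : L2 D') :
    dilate ha hD (dilate (inv_pos.2 ha) hD' u) = u := by
  apply Lp.ext
  filter_upwards [coeFn_dilate ha hD (dilate (inv_pos.2 ha) hD' u),
    (quasiMeasurePreserving_dil ha hD).ae (coeFn_dilate (inv_pos.2 ha) hD' u)] with x h1 h2
  rw [h1, h2, dil_inv_dil ha.ne']

theorem preimage_dil_inv (ha : 0 < a) (hD : D' = dil a ⁻¹' D) :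
    D = dil a⁻¹ ⁻¹' D' := by
  rw [hD]
  ext x
  simp [dil_dil_inv ha.ne']

theorem IsTest.comp_dil (ha : 0 < a) {φ : E n → ℂ} (h : IsTest D φ) :
    IsTest (dil a ⁻¹' D) fun x => φ (dil a x) := by
  refine ⟨h.1.comp (contDiff_dil a), h.2.1.comp_homeomorph (dilHomeomorph ha.ne'), ?_⟩
  exact (tsupport_comp_subset_preimage φ (continuous_dil a)).trans (Set.preimage_mono h.2.2)

theorem fderiv_comp_dil {φ : E n → ℂ} (h : Differentiable ℝ φ) (a : ℝ) (x v : E n) :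
    fderiv ℝ (fun x => φ (dil a x)) x v = (a : ℂ) * fderiv ℝ φ (dil a x) v := by
  have h1 : HasFDerivAt (dil a : E n → E n) (a • ContinuousLinearMap.id ℝ (E n)) x := by
    unfold dil
    exact (((hasFDerivAt_id x).sub_const _).const_smul a).add_const _
  have h2 := (h (dil a x)).hasFDerivAt.comp x h1
  rw [show (fun x => φ (dil a x)) = φ ∘ dil a from rfl, h2.fderiv]
  simp

/-- Dilations act on the form domains of Dirichlet Laplacians. -/
theorem dilate_mem_dirichletGradient (ha : 0 < a) (hD : D' = dil a ⁻¹' D)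
    {u : L2 D} {g : Fin n → L2 D}
    (h : (u, g) ∈ dirichletGradient D) :
    (dilate ha hD u, fun i => (a : ℂ) • dilate ha hD (g i)) ∈ dirichletGradient D' := by
  obtain ⟨φ, h1, h2, h3⟩ := h
  have ht : ∀ k, IsTest D (φ k) := h1
  have hlim : ∀ {F : ℕ → E n → ℂ} (_ : ∀ k, Continuous (F k)) {w : L2 D} (_ : Tendsto (fun k =>
      eLpNorm (fun x => F k x - w x) 2 (volume.restrict D)) atTop (𝓝 0)),
      Tendsto (fun k => eLpNorm (fun x => F k (dil a x) - dilate ha hD w x) 2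
        (volume.restrict D')) atTop (𝓝 0) := by
    intro F hF w hw
    have h4 : ∀ k, eLpNorm (fun x => F k (dil a x) - dilate ha hD w x) 2 (volume.restrict D')
        = ENNReal.ofReal ((a ^ n)⁻¹) ^ (2⁻¹ : ℝ) *
          eLpNorm (fun x => F k x - w x) 2 (volume.restrict D) := by
      intro k
      rw [← eLpNorm_comp_dil ha hD (F := fun x => F k x - w x)
        ((hF k).aestronglyMeasurable.sub (Lp.aestronglyMeasurable w))]
      refine eLpNorm_congr_ae ?_
      filter_upwards [coeFn_dilate ha hD w] with x hx
      rw [hx]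
    simp_rw [h4]
    simpa using ENNReal.Tendsto.const_mul hw (Or.inr (by finiteness))
  refine ⟨fun k x => φ k (dil a x), fun k => ?_, hlim (fun k => (ht k).continuous) h2, fun i => ?_⟩
  · rw [hD]
    exact (ht k).comp_dil ha
  · have h5 := hlim (fun k => ((ht k).pderiv i).continuous) (h3 i)
    have h6 : ∀ k, eLpNorm (fun x => fderiv ℝ (fun x => φ k (dil a x)) x (basisVec i)
        - ((a : ℂ) • dilate ha hD (g i) : L2 D') x) 2 (volume.restrict D')
        = ‖(a : ℂ)‖ₑ * eLpNorm (fun x => pderiv i (φ k) (dil a x) - dilate ha hD (g i) x) 2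
          (volume.restrict D') := by
      intro k
      rw [← eLpNorm_const_smul]
      refine eLpNorm_congr_ae ?_
      filter_upwards [Lp.coeFn_smul (a : ℂ) (dilate ha hD (g i))] with x hx
      rw [hx, fderiv_comp_dil (ht k).differentiable]
      simp [pderiv, mul_sub]
    simp only
    simp_rw [h6]
    simpa using ENNReal.Tendsto.const_mul h5 (Or.inr (by finiteness))

/-- Dilations intertwine the Dirichlet Laplacians up to the square of the factor. -/
theorem dilate_mem_dirichletLaplacian (ha : 0 < a) (hD : D' = dil a ⁻¹' D)
    {u f : L2 D} (h : (u, f) ∈ dirichletLaplacian D) :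
    (dilate ha hD u, ((a ^ 2 : ℝ) : ℂ) • dilate ha hD f) ∈ dirichletLaplacian D' := by
  obtain ⟨g, hg, hgf⟩ := h
  refine ⟨_, dilate_mem_dirichletGradient ha hD hg, fun v w hvw => ?_⟩
  have hD' := preimage_dil_inv ha hD
  have h1 := hgf _ _ (dilate_mem_dirichletGradient (inv_pos.2 ha) hD' hvw)
  have h2 : ∀ (p : L2 D') (q : L2 D), inner ℂ p (dilate ha hD q)
      = (((a ^ n)⁻¹ : ℝ) : ℂ) * inner ℂ (dilate (inv_pos.2 ha) hD' p) q := by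
    intro p q
    conv_lhs => rw [← dilate_dilate_inv ha hD hD' p]
    rw [inner_dilate, Complex.real_smul]
  simp_rw [inner_smul_right, h2, ← h1, inner_smul_left, Finset.mul_sum]
  refine Finset.sum_congr rfl fun i _ => ?_
  have : (a : ℂ) ≠ 0 := by exact_mod_cast ha.ne'
  simp only [map_inv₀, Complex.conj_ofReal, Complex.ofReal_inv, Complex.ofReal_pow]
  field_simp

theorem dilate_ne_zero (ha : 0 < a) (hD : D' = dil a ⁻¹' D)
    {u : L2 D} (hu : u ≠ 0) : dilate ha hD u ≠ 0 := by
  intro h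
  have h1 := inner_dilate ha hD u u
  rw [h, inner_zero_left, eq_comm, smul_eq_zero] at h1
  rcases h1 with h1 | h1
  · exact absurd h1 (by positivity)
  · exact hu (inner_self_eq_zero.1 h1)

/-- Eigenfunctions with a prescribed property of the integral are preserved by dilations. -/
theorem exists_eigenfunction_dilate (ha : 0 < a) (hD : D' = dil a ⁻¹' D)
    {ν : ℝ} {Q : ℂ → Prop}
    (hQ : ∀ (c : ℝ) (z : ℂ), 0 < c → Q z → Q (c • z))
    (h : ∃ u : L2 D, u ≠ 0 ∧ (u, (ν : ℂ) • u) ∈ dirichletLaplacian D ∧ Q (∫ x in D, u x)) :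
    ∃ u : L2 D', u ≠ 0 ∧ (u, ((a ^ 2 * ν : ℝ) : ℂ) • u) ∈ dirichletLaplacian D' ∧
      Q (∫ x in D', u x) := by
  obtain ⟨u, h0, h1, h2⟩ := h
  refine ⟨dilate ha hD u, dilate_ne_zero ha hD h0, ?_, ?_⟩
  · have := dilate_mem_dirichletLaplacian ha hD h1
    rwa [dilate_smul, smul_smul, ← Complex.ofReal_mul] at this
  · rw [integral_dilate]
    exact hQ _ _ (by positivity) h2

end Dilate

theorem exists_eigenfunction_scaled_iff {D : Set (E n)} {r : ℝ} (hr : 0 < r) {Q : ℂ → Prop}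
    (hQ : ∀ (c : ℝ) (z : ℂ), 0 < c → Q z → Q (c • z)) :
    {ν : ℝ | ∃ u : L2 (scaled D r), u ≠ 0 ∧ (u, (ν : ℂ) • u) ∈ dirichletLaplacian (scaled D r) ∧
      Q (∫ x in scaled D r, u x)} = (fun ν => ν / r ^ 2) ''
    {ν : ℝ | ∃ u : L2 D, u ≠ 0 ∧ (u, (ν : ℂ) • u) ∈ dirichletLaplacian D ∧ Q (∫ x in D, u x)} := by
  have hD := scaled_eq_preimage hr.ne' D
  have hD' := preimage_dil_inv (inv_pos.2 hr) hD
  ext ν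
  constructor
  · intro h
    have := exists_eigenfunction_dilate (inv_pos.2 (inv_pos.2 hr)) hD' hQ h
    refine ⟨_, this, ?_⟩
    simp only [inv_inv]
    field_simp
  · rintro ⟨ν', h, rfl⟩
    have := exists_eigenfunction_dilate (inv_pos.2 hr) hD hQ h
    rwa [inv_pow, ← div_eq_inv_mul] at this

/-- The two sets of Dirichlet eigenvalues scale with the inverse square of the factor. -/
theorem nuSet_scaled {D : Set (E n)} {r : ℝ} (hr : 0 < r) :
    nuSet (scaled D r) = (fun ν => ν / r ^ 2) '' nuSet D :=
  exists_eigenfunction_scaled_iff hr (Q := fun z => z ≠ 0)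
    fun _ _ hc hz => smul_ne_zero hc.ne' hz

theorem nuPrimeSet_scaled {D : Set (E n)} {r : ℝ} (hr : 0 < r) :
    nuPrimeSet (scaled D r) = (fun ν => ν / r ^ 2) '' nuPrimeSet D :=
  exists_eigenfunction_scaled_iff hr (Q := fun z => z = 0)
    fun c _ _ hz => by rw [hz, smul_zero]

/-! ### The dynamical system preserves the measure -/

theorem measurePreserving_fract_add (x : ℝ) :
    MeasurePreserving (fun t : ℝ => Int.fract (x + t)) (volume.restrict (Set.Ico 0 1))
      (volume.restrict (Set.Ico 0 1)) := by
  have hm : Measurable fun t : ℝ => Int.fract (x + t) := by fun_prop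
  refine ⟨hm, ?_⟩
  ext s hs
  set f : ℝ → ENNReal := s.indicator 1 with hf
  have hfm : Measurable f := measurable_one.indicator hs
  have hper : ∀ (g : AddSubgroup.zmultiples (1 : ℝ)) (t : ℝ),
      f (Int.fract (g +ᵥ t)) = f (Int.fract t) := by
    rintro ⟨_, k, rfl⟩ t
    simp [AddSubgroup.vadd_def]
  rw [Measure.map_apply hm hs, ← lintegral_indicator_one hs, ← lintegral_indicator_one (hm hs)]
  calc ∫⁻ t in Set.Ico (0 : ℝ) 1, ((fun t : ℝ => Int.fract (x + t)) ⁻¹' s).indicator 1 t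
      = ∫⁻ t in Set.Ico (0 : ℝ) 1, f (Int.fract (x + t)) := rfl
    _ = ∫⁻ t in Set.Ioc (0 : ℝ) 1, f (Int.fract (x + t)) := setLIntegral_congr Ico_ae_eq_Ioc
    _ = ∫⁻ t in Set.Ioc x (x + 1), f (Int.fract t) := by
        have h := (measurePreserving_add_left volume x).setLIntegral_comp_preimage
          (measurableSet_Ioc (a := x) (b := x + 1)) (f := fun t => f (Int.fract t)) (by fun_prop)
        rw [Set.preimage_const_add_Ioc] at h
        simpa using h
    _ = ∫⁻ t in Set.Ioc (0 : ℝ) (0 + 1), f (Int.fract t) :=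
        (isAddFundamentalDomain_Ioc one_pos x).setLIntegral_eq
          (isAddFundamentalDomain_Ioc one_pos 0) _ hper
    _ = ∫⁻ t in Set.Ico (0 : ℝ) 1, f (Int.fract t) := by
        rw [zero_add]
        exact (setLIntegral_congr Ico_ae_eq_Ioc).symm
    _ = ∫⁻ t in Set.Ico (0 : ℝ) 1, f t :=
        setLIntegral_congr_fun measurableSet_Ico fun t ht => by
          simp only [Int.fract_eq_self.2 ht]

/-- Lebesgue measure on the cell. -/
abbrev cellMeasure (n : ℕ) : Measure (cell n) := Measure.comap (Subtype.val : cell n → E n) volume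

theorem measurePreserving_val :
    MeasurePreserving (Subtype.val : cell n → E n) (cellMeasure n) (volume.restrict (cell n)) :=
  measurePreserving_subtype_coe measurableSet_cell

instance : IsProbabilityMeasure (cellMeasure n) :=
  ⟨by rw [← Set.preimage_univ (f := (Subtype.val : cell n → E n)),
    measurePreserving_val.measure_preimage MeasurableSet.univ.nullMeasurableSet]
      simp [volume_cell]⟩

instance (μ : Measure ℝ) [IsProbabilityMeasure μ] : IsProbabilityMeasure (prob n μ) := by
  unfold prob
  infer_instance

theorem measurePreserving_ofLp_cell :
    MeasurePreserving (fun y : cell n => (WithLp.ofLp (y : E n) : Fin n → ℝ)) (cellMeasure n)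
      (Measure.pi fun _ => volume.restrict (Set.Ico 0 1)) := by
  have h := (PiLp.volume_preserving_ofLp (Fin n)).restrict_preimage
    (s := Set.univ.pi fun _ => Set.Ico (0 : ℝ) 1) (MeasurableSet.univ_pi fun _ => measurableSet_Ico)
  rw [show (volume : Measure (Fin n → ℝ)) = Measure.pi fun _ => volume from rfl,
    Measure.restrict_pi_pi] at h
  have hc : (WithLp.ofLp : E n → Fin n → ℝ) ⁻¹'
      (Set.univ.pi fun _ => Set.Ico (0 : ℝ) 1) = cell n := by
    ext y
    simp [cell]
  rw [hc] at h
  exact h.comp measurePreserving_val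

/-- The action of `x ∈ ℝⁿ` on the cell. -/
def cellShift (x : E n) (y : cell n) : cell n :=
  ⟨WithLp.toLp 2 fun i => Int.fract (x i + (y : E n) i),
    fun i => ⟨Int.fract_nonneg (x i + (y : E n) i), Int.fract_lt_one (x i + (y : E n) i)⟩⟩

theorem measurable_cellShift (x : E n) : Measurable (cellShift x) := by
  refine Measurable.subtype_mk ?_
  refine (PiLp.volume_preserving_toLp (Fin n)).measurable.comp (measurable_pi_iff.2 fun i => ?_)
  exact (measurable_const.add ((by fun_prop : Measurable fun z : E n => z i).comp
    measurable_subtype_coe)).fract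

theorem measurePreserving_cellShift (x : E n) :
    MeasurePreserving (cellShift x) (cellMeasure n) (cellMeasure n) := by
  refine ⟨measurable_cellShift x, ?_⟩
  have he : MeasurableEmbedding (fun y : cell n => (WithLp.ofLp (y : E n) : Fin n → ℝ)) :=
    (MeasurableEquiv.toLp 2 (Fin n → ℝ)).symm.measurableEmbedding.comp
      (MeasurableEmbedding.subtype_coe measurableSet_cell)
  refine he.map_injective ?_
  have h1 : MeasurePreserving (fun (a : Fin n → ℝ) i => Int.fract (x i + a i))
      (Measure.pi fun _ => volume.restrict (Set.Ico 0 1))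
      (Measure.pi fun _ => volume.restrict (Set.Ico 0 1)) :=
    measurePreserving_pi _ _ fun i => measurePreserving_fract_add (x i)
  rw [Measure.map_map he.measurable (measurable_cellShift x), measurePreserving_ofLp_cell.map_eq]
  exact (h1.comp measurePreserving_ofLp_cell).map_eq

theorem map_shift_infinitePi (μ : Measure ℝ) [IsProbabilityMeasure μ] (z : Fin n → ℤ) :
    Measure.map (fun (w : (Fin n → ℤ) → ℝ) j => w (j + z)) (Measure.infinitePi fun _ => μ) =
      Measure.infinitePi fun _ => μ := by
  have h := Measure.infinitePi_map_piCongrLeft (fun _ : Fin n → ℤ => μ) (Equiv.subRight z)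
  convert h using 2
  funext w j
  simp [MeasurableEquiv.coe_piCongrLeft, Equiv.piCongrLeft_apply]

theorem measurable_eval_index :
    Measurable fun p : ((Fin n → ℤ) → ℝ) × (Fin n → ℤ) => p.1 p.2 :=
  measurable_from_prod_countable_left fun j => measurable_pi_apply j

/-- The dynamical system is measure preserving: it is a skew product over the action on the cell. -/
theorem measurePreserving_T (μ : Measure ℝ) [IsProbabilityMeasure μ] (x : E n) :
    MeasurePreserving (T x) (prob n μ) (prob n μ) := by
  have hfl : Measurable fun y : cell n => fun i => ⌊x i + (y : E n) i⌋ :=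
    measurable_pi_iff.2 fun i => (measurable_const.add
      ((by fun_prop : Measurable fun z : E n => z i).comp measurable_subtype_coe)).floor
  have h1 : MeasurePreserving (fun p : cell n × ((Fin n → ℤ) → ℝ) =>
      (cellShift x p.1, fun j => p.2 (j + fun i => ⌊x i + (p.1 : E n) i⌋)))
      ((cellMeasure n).prod (Measure.infinitePi fun _ => μ))
      ((cellMeasure n).prod (Measure.infinitePi fun _ => μ)) := by
    refine (measurePreserving_cellShift x).skew_product
      (g := fun (y : cell n) (w : (Fin n → ℤ) → ℝ) j => w (j + fun i => ⌊x i + (y : E n) i⌋)) ?_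
      (Eventually.of_forall fun y => map_shift_infinitePi μ _)
    refine measurable_pi_iff.2 fun j => ?_
    exact measurable_eval_index.comp
      (measurable_snd.prodMk (measurable_const.add (hfl.comp measurable_fst)))
  exact (Measure.measurePreserving_swap.comp h1).comp Measure.measurePreserving_swap

theorem T_add (x x' : E n) (ω : Om n) : T (x + x') ω = T x (T x' ω) := by
  have h : ∀ i, x i + x' i + (ω.2 : E n) i
      = (x i + Int.fract (x' i + (ω.2 : E n) i)) + (⌊x' i + (ω.2 : E n) i⌋ : ℤ) := by
    intro i
    have := Int.floor_add_fract (x' i + (ω.2 : E n) i)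
    linarith
  refine Prod.ext ?_ (Subtype.ext ?_)
  · funext j
    simp only [T, PiLp.add_apply, h, Int.floor_add_intCast]
    rw [add_assoc]
    rfl
  · simp only [T, PiLp.add_apply, h, Int.fract_add_intCast]

theorem T_zero (ω : Om n) : T 0 ω = ω := by
  have h : ∀ i, ⌊(ω.2 : E n) i⌋ = 0 := fun i => Int.floor_eq_zero_iff.2 (ω.2.2 i)
  refine Prod.ext ?_ (Subtype.ext ?_)
  · funext j
    simp only [T, PiLp.zero_apply, zero_add, h]
    exact congrArg ω.1 (add_zero j)
  · ext i
    simp [T, Int.fract_eq_self.2 (ω.2.2 i)]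

/-! ### The unitary groups of the coordinate directions -/

section Group

variable (μ : Measure ℝ) [IsProbabilityMeasure μ]

/-- The unitary group `f ↦ f ∘ T_{t eᵢ}` on `L²(Ω)`. -/
def grp (i : Fin n) (t : ℝ) : Lp ℂ 2 (prob n μ) →ₗᵢ[ℂ] Lp ℂ 2 (prob n μ) :=
  Lp.compMeasurePreservingₗᵢ ℂ (T (t • basisVec i)) (measurePreserving_T μ _)

theorem coeFn_grp (i : Fin n) (t : ℝ) (f : Lp ℂ 2 (prob n μ)) :
    grp μ i t f =ᵐ[prob n μ] fun ω => f (T (t • basisVec i) ω) :=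
  Lp.coeFn_compMeasurePreserving f (measurePreserving_T μ _)

theorem coeFn_grp_toLp (i : Fin n) (t : ℝ) {f : Om n → ℂ} (hf : MemLp f 2 (prob n μ)) :
    grp μ i t (hf.toLp f) =ᵐ[prob n μ] fun ω => f (T (t • basisVec i) ω) :=
  (coeFn_grp μ i t _).trans
    ((measurePreserving_T μ (t • basisVec i)).quasiMeasurePreserving.ae_eq_comp hf.coeFn_toLp)

theorem grp_zero (i : Fin n) (f : Lp ℂ 2 (prob n μ)) : grp μ i 0 f = f := by
  apply Lp.ext
  filter_upwards [coeFn_grp μ i 0 f] with ω h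
  rw [h, zero_smul, T_zero]

theorem grp_add (i : Fin n) (s t : ℝ) (f : Lp ℂ 2 (prob n μ)) :
    grp μ i (s + t) f = grp μ i s (grp μ i t f) := by
  apply Lp.ext
  filter_upwards [coeFn_grp μ i (s + t) f, coeFn_grp μ i s (grp μ i t f),
    (measurePreserving_T μ (s • basisVec i)).quasiMeasurePreserving.ae (coeFn_grp μ i t f)]
    with ω h1 h2 h3
  rw [h1, h2, h3, add_smul, add_comm, T_add]

theorem isStochDeriv_iff {i : Fin n} {f d : Om n → ℂ} (hf : MemLp f 2 (prob n μ))
    (hd : MemLp d 2 (prob n μ)) :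
    IsStochDeriv μ i f d ↔ HasDerivAt (fun t => grp μ i t (hf.toLp f)) (hd.toLp d) 0 := by
  rw [hasDerivAt_iff_tendsto_slope, Lp.tendsto_Lp_iff_tendsto_eLpNorm', IsStochDeriv,
    and_iff_right hf, and_iff_right hd]
  refine Eq.to_iff (congrArg (fun F => Tendsto F _ _) (funext fun t => eLpNorm_congr_ae ?_))
  rw [slope_def_module, grp_zero]
  filter_upwards [hd.coeFn_toLp, hf.coeFn_toLp, coeFn_grp_toLp μ i t hf,
    Lp.coeFn_smul (t - 0)⁻¹ (grp μ i t (hf.toLp f) - hf.toLp f),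
    Lp.coeFn_sub (grp μ i t (hf.toLp f)) (hf.toLp f)] with ω h1 h2 h3 h4 h5
  rw [Pi.sub_apply, h1, h4, Pi.smul_apply, h5, Pi.sub_apply, h2, h3, Complex.real_smul, sub_zero]
  push_cast
  ring

/-- The form domain on `𝒪` in terms of the generators of the unitary groups. -/
theorem mem_stochGradient_iff {O : Set (Om n)} (hO : MeasurableSet O) {v : L2O μ O}
    {g : Fin n → L2O μ O} :
    (v, g) ∈ stochGradient μ O ↔ ∀ i, ∃ d : Lp ℂ 2 (prob n μ),
      HasDerivAt (fun t => grp μ i t (extL2 (prob n μ) hO v)) d 0 ∧ g i = resL2 (prob n μ) O d := by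
  have hv : MemLp (O.indicator v) 2 (prob n μ) :=
    (memLp_indicator_iff_restrict hO).2 (Lp.memLp v)
  have hve : hv.toLp _ = extL2 (prob n μ) hO v :=
    Lp.ext (hv.coeFn_toLp.trans (coeFn_extL2 hO v).symm)
  have hres : ∀ (g : L2O μ O) {d : Om n → ℂ} (hd : MemLp d 2 (prob n μ)),
      g =ᵐ[(prob n μ).restrict O] d ↔ g = resL2 (prob n μ) O (hd.toLp d) := by
    intro g d hd
    have h1 : resL2 (prob n μ) O (hd.toLp d) =ᵐ[(prob n μ).restrict O] d :=
      (coeFn_resL2 _).trans (ae_restrict_of_ae hd.coeFn_toLp)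
    exact ⟨fun h => Lp.ext (h.trans h1.symm), fun h => h ▸ h1⟩
  constructor
  · rintro ⟨d, hd⟩ i
    have hm := (hd i).1.2.1
    refine ⟨hm.toLp _, ?_, (hres _ hm).1 (hd i).2⟩
    rw [← hve]
    exact (isStochDeriv_iff μ hv hm).1 (hd i).1
  · intro h
    choose d hd hg using h
    refine ⟨fun i => d i, fun i => ⟨?_, ?_⟩⟩
    · rw [isStochDeriv_iff μ hv (Lp.memLp (d i)), hve, Lp.toLp_coeFn]
      exact hd i
    · rw [hres _ (Lp.memLp (d i)), Lp.toLp_coeFn]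
      exact hg i

end Group

/-! ### Rescaling the random inclusion to the reference inclusion -/

/-- The standing conditions on the range of sizes. -/
structure IsRange (r₁ r₂ : ℝ) : Prop where
  pos : 0 < r₁
  lt : r₁ < r₂
  lt_one : r₂ < 1

theorem measurable_dil_uncurry : Measurable fun p : ℝ × E n => dil p.1 p.2 := by
  unfold dil
  fun_prop

section Rescale

variable (μ : Measure ℝ) [IsProbabilityMeasure μ] (r₁ r₂ : ℝ)

/-- The families of sizes with `ω̃₀ ∈ [r₁, r₂]`. -/
def sizeSet (n : ℕ) (r₁ r₂ : ℝ) : Set ((Fin n → ℤ) → ℝ) := {w | w 0 ∈ Set.Icc r₁ r₂}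

theorem measurableSet_sizeSet : MeasurableSet (sizeSet n r₁ r₂) :=
  measurable_pi_apply 0 measurableSet_Icc

/-- The points of `Ω` whose size at the origin lies in `[r₁, r₂]`. -/
def sizeSetOm (n : ℕ) (r₁ r₂ : ℝ) : Set (Om n) := Prod.fst ⁻¹' sizeSet n r₁ r₂

theorem measurableSet_sizeSetOm : MeasurableSet (sizeSetOm n r₁ r₂) :=
  measurable_fst (measurableSet_sizeSet r₁ r₂)

/-- The measure `ω̃₀ⁿ P̃` on `{ω̃₀ ∈ [r₁, r₂]}`; the density is the Jacobian of the rescaling. -/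
def sizeMeasure (n : ℕ) (μ : Measure ℝ) [IsProbabilityMeasure μ] (r₁ r₂ : ℝ) :
    Measure ((Fin n → ℤ) → ℝ) :=
  ((Measure.infinitePi fun _ => μ).restrict (sizeSet n r₁ r₂)).withDensity
    fun w => ENNReal.ofReal (w 0 ^ n)

instance : SFinite (sizeMeasure n μ r₁ r₂) := by
  unfold sizeMeasure
  infer_instance

theorem ae_mem_sizeSet : ∀ᵐ w ∂sizeMeasure n μ r₁ r₂, w 0 ∈ Set.Icc r₁ r₂ :=
  (withDensity_absolutelyContinuous _ _).ae_le
    (ae_restrict_mem (measurableSet_sizeSet (n := n) r₁ r₂))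

theorem isFiniteMeasure_sizeMeasure (hI : IsRange r₁ r₂) :
    IsFiniteMeasure (sizeMeasure n μ r₁ r₂) := by
  refine isFiniteMeasure_withDensity (ne_of_lt ?_)
  calc ∫⁻ w in sizeSet n r₁ r₂, ENNReal.ofReal (w 0 ^ n) ∂(Measure.infinitePi fun _ => μ)
      ≤ ∫⁻ w in sizeSet n r₁ r₂, 1 ∂(Measure.infinitePi fun _ => μ) := by
        refine setLIntegral_mono measurable_const fun w hw => ?_
        rw [ENNReal.ofReal_le_one]
        exact pow_le_one₀ (hI.pos.le.trans hw.1) (hw.2.trans hI.lt_one.le)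
    _ < ⊤ := by
        rw [setLIntegral_one]
        exact measure_lt_top _ _

/-- The rescaling `(ω̃, y) ↦ (ω̃, y^c + ω̃₀⁻¹ (y - y^c))`. -/
def blowUp (ω : Om n) : ((Fin n → ℤ) → ℝ) × E n := (ω.1, dil (ω.1 0)⁻¹ ω.2)

theorem measurable_blowUp : Measurable (blowUp : Om n → _) := by
  refine measurable_fst.prodMk (measurable_dil_uncurry.comp (Measurable.prodMk ?_ ?_))
  · exact ((measurable_pi_apply 0).comp measurable_fst).inv
  · exact measurable_subtype_coe.comp measurable_snd

/-- The range of the rescaling. -/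
def blownCell (n : ℕ) : Set (((Fin n → ℤ) → ℝ) × E n) := {p | dil (p.1 0) p.2 ∈ cell n}

theorem measurable_dil_fst :
    Measurable fun p : ((Fin n → ℤ) → ℝ) × E n => dil (p.1 0) p.2 :=
  measurable_dil_uncurry.comp (f := fun p : ((Fin n → ℤ) → ℝ) × E n => (p.1 0, p.2))
    (((measurable_pi_apply 0).comp measurable_fst).prodMk measurable_snd)

theorem measurableSet_blownCell : MeasurableSet (blownCell n) :=
  measurable_dil_fst measurableSet_cell

variable {r₁ r₂}

theorem measurePreserving_blowUp (hI : IsRange r₁ r₂) :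
    MeasurePreserving blowUp ((prob n μ).restrict (sizeSetOm n r₁ r₂))
      (((sizeMeasure n μ r₁ r₂).prod volume).restrict (blownCell n)) := by
  refine ⟨measurable_blowUp, ?_⟩
  ext Z hZ
  have hZA := hZ.inter (measurableSet_blownCell (n := n))
  rw [Measure.map_apply measurable_blowUp hZ, Measure.restrict_apply (measurable_blowUp hZ),
    Measure.restrict_apply hZ, prob, Measure.prod_apply ((measurable_blowUp hZ).inter
      (measurableSet_sizeSetOm r₁ r₂)), Measure.prod_apply hZA, sizeMeasure,
    lintegral_withDensity_eq_lintegral_mul _ (by fun_prop) (measurable_measure_prodMk_left hZA),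
    ← lintegral_indicator (measurableSet_sizeSet r₁ r₂)]
  refine lintegral_congr fun w => ?_
  by_cases hw : w ∈ sizeSet n r₁ r₂
  · have hpos : 0 < w 0 := hI.pos.trans_le hw.1
    have hZw : MeasurableSet (Prod.mk w ⁻¹' Z) := measurable_prodMk_left hZ
    have hcell : cell n = dil (w 0)⁻¹ ⁻¹' (dil (w 0) ⁻¹' cell n) := by
      ext x
      simp [dil_dil_inv hpos.ne']
    have h1 : Prod.mk w ⁻¹' (blowUp ⁻¹' Z ∩ sizeSetOm n r₁ r₂)
        = Subtype.val ⁻¹' (dil (w 0)⁻¹ ⁻¹' (Prod.mk w ⁻¹' Z)) := by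
      ext y
      simp only [Set.mem_preimage, Set.mem_inter_iff]
      exact and_iff_left hw
    rw [Set.indicator_of_mem hw, h1, measurePreserving_val.measure_preimage
      (measurable_dil _ hZw).nullMeasurableSet, ← Measure.map_apply (measurable_dil _) hZw,
      map_dil_restrict (inv_pos.2 hpos) hcell, Measure.smul_apply, Measure.restrict_apply hZw,
      inv_pow, inv_inv]
    rfl
  · rw [Set.indicator_of_notMem hw]
    have : Prod.mk w ⁻¹' (blowUp ⁻¹' Z ∩ sizeSetOm n r₁ r₂) = (∅ : Set (cell n)) := by
      ext y
      simp only [Set.mem_preimage, Set.mem_inter_iff, Set.mem_empty_iff_false, iff_false, not_and]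
      exact fun _ => hw
    rw [this, measure_empty]

/-- Pull-back along the rescaling, extended by zero to all of `Ω`. -/
def pull (hI : IsRange r₁ r₂) :
    Lp ℂ 2 ((sizeMeasure n μ r₁ r₂).prod (volume : Measure (E n))) →L[ℂ] Lp ℂ 2 (prob n μ) :=
  (extL2 (prob n μ) (measurableSet_sizeSetOm r₁ r₂)).toContinuousLinearMap ∘L
    (Lp.compMeasurePreservingₗᵢ ℂ blowUp (measurePreserving_blowUp μ hI)).toContinuousLinearMap ∘L
    resL2 _ (blownCell n)

theorem quasiMeasurePreserving_blowUp (hI : IsRange r₁ r₂) :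
    Measure.QuasiMeasurePreserving blowUp ((prob n μ).restrict (sizeSetOm n r₁ r₂))
      ((sizeMeasure n μ r₁ r₂).prod volume) :=
  ⟨measurable_blowUp, by
    rw [(measurePreserving_blowUp μ hI).map_eq]
    exact Measure.absolutelyContinuous_of_le Measure.restrict_le_self⟩

theorem coeFn_pull (hI : IsRange r₁ r₂)
    (F : Lp ℂ 2 ((sizeMeasure n μ r₁ r₂).prod (volume : Measure (E n)))) :
    pull μ hI F =ᵐ[prob n μ] (sizeSetOm n r₁ r₂).indicator fun ω => F (blowUp ω) := by
  have h1 := (ae_restrict_iff' (measurableSet_sizeSetOm r₁ r₂)).1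
    (Lp.coeFn_compMeasurePreserving (resL2 _ (blownCell n) F) (measurePreserving_blowUp μ hI))
  have h2 := (ae_restrict_iff' (measurableSet_sizeSetOm r₁ r₂)).1
    ((measurePreserving_blowUp μ hI).quasiMeasurePreserving.ae (coeFn_resL2 (s := blownCell n) F))
  filter_upwards [coeFn_extL2 (measurableSet_sizeSetOm r₁ r₂) (Lp.compMeasurePreservingₗᵢ ℂ blowUp
    (measurePreserving_blowUp μ hI) (resL2 _ (blownCell n) F)), h1, h2] with ω h3 h4 h5
  refine Eq.trans h3 ?_
  by_cases hω : ω ∈ sizeSetOm n r₁ r₂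
  · rw [Set.indicator_of_mem hω, Set.indicator_of_mem hω, ← h5 hω]
    exact h4 hω
  · rw [Set.indicator_of_notMem hω, Set.indicator_of_notMem hω]

theorem inner_pull (hI : IsRange r₁ r₂)
    {F : Lp ℂ 2 ((sizeMeasure n μ r₁ r₂).prod (volume : Measure (E n)))}
    (hF : ∀ᵐ p ∂(sizeMeasure n μ r₁ r₂).prod volume, p ∉ blownCell n → F p = 0)
    (G : Lp ℂ 2 ((sizeMeasure n μ r₁ r₂).prod (volume : Measure (E n)))) :
    inner ℂ (pull μ hI F) (pull μ hI G) = inner ℂ F G := by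
  change inner ℂ (extL2 (prob n μ) (measurableSet_sizeSetOm r₁ r₂) (Lp.compMeasurePreservingₗᵢ ℂ
    blowUp (measurePreserving_blowUp μ hI) (resL2 _ (blownCell n) F))) (extL2 (prob n μ)
    (measurableSet_sizeSetOm r₁ r₂) (Lp.compMeasurePreservingₗᵢ ℂ
    blowUp (measurePreserving_blowUp μ hI) (resL2 _ (blownCell n) G))) = _
  rw [LinearIsometry.inner_map_map, LinearIsometry.inner_map_map,
    ← inner_extL2 (measurableSet_blownCell (n := n))]
  congr 1
  apply Lp.ext
  filter_upwards [coeFn_extL2_resL2 (measurableSet_blownCell (n := n)) F, hF] with p h1 h2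
  rw [h1]
  by_cases hp : p ∈ blownCell n
  · rw [Set.indicator_of_mem hp]
  · rw [Set.indicator_of_notMem hp, h2 hp]

/-- The function `1_{ω̃₀ ∈ [r₁, r₂]} h(ω̃) ψ(y^c + ω̃₀⁻¹ (y - y^c))` on `Ω`. -/
def blow (hI : IsRange r₁ r₂) :
    Lp ℂ 2 (sizeMeasure n μ r₁ r₂) →L[ℂ] Lp ℂ 2 (volume : Measure (E n)) →L[ℂ]
      Lp ℂ 2 (prob n μ) :=
  (ContinuousLinearMap.compL ℂ _ _ _ (pull μ hI)) ∘L tensorL2 (sizeMeasure n μ r₁ r₂) volume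

theorem blow_apply (hI : IsRange r₁ r₂) (h : Lp ℂ 2 (sizeMeasure n μ r₁ r₂))
    (ψ : Lp ℂ 2 (volume : Measure (E n))) :
    blow μ hI h ψ = pull μ hI (tensorL2 _ _ h ψ) := rfl

theorem coeFn_blow (hI : IsRange r₁ r₂) (h : Lp ℂ 2 (sizeMeasure n μ r₁ r₂))
    (ψ : Lp ℂ 2 (volume : Measure (E n))) :
    blow μ hI h ψ =ᵐ[prob n μ] (sizeSetOm n r₁ r₂).indicator
      fun ω => h ω.1 * ψ (dil (ω.1 0)⁻¹ ω.2) := by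
  have h1 := (ae_restrict_iff' (measurableSet_sizeSetOm r₁ r₂)).1
    ((quasiMeasurePreserving_blowUp μ hI).ae (coeFn_tensorL2 h ψ))
  filter_upwards [coeFn_pull μ hI (tensorL2 _ _ h ψ), h1] with ω h2 h3
  rw [blow_apply, h2]
  by_cases hω : ω ∈ sizeSetOm n r₁ r₂
  · rw [Set.indicator_of_mem hω, Set.indicator_of_mem hω, h3 hω]
    rfl
  · rw [Set.indicator_of_notMem hω, Set.indicator_of_notMem hω]

/-- `coeFn_blow` with explicit representatives of both factors. -/
theorem coeFn_blow_of_ae (hI : IsRange r₁ r₂) {h : Lp ℂ 2 (sizeMeasure n μ r₁ r₂)}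
    {ψ : Lp ℂ 2 (volume : Measure (E n))} {h' : ((Fin n → ℤ) → ℝ) → ℂ} {ψ' : E n → ℂ}
    (hh : h =ᵐ[sizeMeasure n μ r₁ r₂] h') (hψ : ψ =ᵐ[volume] ψ') :
    blow μ hI h ψ =ᵐ[prob n μ] (sizeSetOm n r₁ r₂).indicator
      fun ω => h' ω.1 * ψ' (dil (ω.1 0)⁻¹ ω.2) := by
  have h1 := (ae_restrict_iff' (measurableSet_sizeSetOm r₁ r₂)).1
    ((quasiMeasurePreserving_blowUp μ hI).ae
      ((coeFn_tensorL2 h ψ).trans (tensor_congr hh hψ)))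
  filter_upwards [coeFn_pull μ hI (tensorL2 _ _ h ψ), h1] with ω h2 h3
  rw [blow_apply, h2]
  by_cases hω : ω ∈ sizeSetOm n r₁ r₂
  · rw [Set.indicator_of_mem hω, Set.indicator_of_mem hω, h3 hω]
    rfl
  · rw [Set.indicator_of_notMem hω, Set.indicator_of_notMem hω]

theorem dil_mem_cell {s : ℝ} (h0 : 0 < s) (h1 : s < 1) {x : E n} (hx : x ∈ cell n) :
    dil s x ∈ cell n := by
  intro i
  have := hx i
  simp only [dil, cellCentre, PiLp.add_apply, PiLp.smul_apply, PiLp.sub_apply, smul_eq_mul]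
  constructor <;> nlinarith [this.1, this.2]

theorem inner_blow (hI : IsRange r₁ r₂) (h h' : Lp ℂ 2 (sizeMeasure n μ r₁ r₂))
    {ψ : Lp ℂ 2 (volume : Measure (E n))} (hψ : ∀ᵐ x, x ∉ cell n → ψ x = 0)
    (ψ' : Lp ℂ 2 (volume : Measure (E n))) :
    inner ℂ (blow μ hI h ψ) (blow μ hI h' ψ') = inner ℂ h h' * inner ℂ ψ ψ' := by
  rw [blow_apply, blow_apply, inner_pull, inner_tensorL2]
  have h1 : ∀ᵐ p ∂(sizeMeasure n μ r₁ r₂).prod (volume : Measure (E n)),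
      p.1 0 ∈ Set.Icc r₁ r₂ := Measure.quasiMeasurePreserving_fst.ae (ae_mem_sizeSet μ r₁ r₂)
  have h2 : ∀ᵐ p ∂(sizeMeasure n μ r₁ r₂).prod (volume : Measure (E n)),
      p.2 ∉ cell n → ψ p.2 = 0 := Measure.quasiMeasurePreserving_snd.ae hψ
  filter_upwards [h1, h2, coeFn_tensorL2 h ψ] with p h3 h4 h5 hp
  rw [h5, h4 fun hc => hp (dil_mem_cell (hI.pos.trans_le h3.1) (h3.2.trans_lt hI.lt_one) hc),
    mul_zero]

end Rescale

/-! ### Stochastic derivatives of rescaled test functions -/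

theorem exists_taylor_bound {D : Set (E n)} {φ : E n → ℂ} (h : IsTest D φ) (i : Fin n) :
    ∃ K : ℝ, 0 ≤ K ∧ ∀ (x : E n) (τ : ℝ),
      ‖φ (x + τ • basisVec i) - φ x - τ * pderiv i φ x‖ ≤ K * τ ^ 2 := by
  obtain ⟨L, hL⟩ := (h.pderiv i).1.lipschitzWith_of_hasCompactSupport (h.pderiv i).2.1 (by simp)
  refine ⟨L, L.2, fun x τ => ?_⟩
  have hb : ‖(basisVec i : E n)‖ = 1 := by simp [basisVec]
  have hline : ∀ σ : ℝ, HasDerivAt (fun σ : ℝ => x + σ • (basisVec i : E n)) (basisVec i) σ := by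
    intro σ
    simpa using ((hasDerivAt_id σ).smul_const (basisVec i : E n)).const_add x
  have hd : ∀ σ : ℝ, HasDerivAt (fun σ : ℝ => φ (x + σ • basisVec i) - σ * pderiv i φ x)
      (pderiv i φ (x + σ • basisVec i) - pderiv i φ x) σ := by
    intro σ
    have h1 : HasDerivAt (fun σ : ℝ => φ (x + σ • basisVec i)) _ σ :=
      (h.differentiable (x + σ • basisVec i)).hasFDerivAt.comp_hasDerivAt σ (hline σ)
    have h2 : HasDerivAt (fun σ : ℝ => (σ : ℂ) * pderiv i φ x) (pderiv i φ x) σ := by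
      simpa using (Complex.ofRealCLM.hasDerivAt (x := σ)).mul_const (pderiv i φ x)
    exact h1.sub h2
  have := (convex_uIcc 0 τ).norm_image_sub_le_of_norm_hasDerivWithin_le
    (f := fun σ : ℝ => φ (x + σ • basisVec i) - σ * pderiv i φ x) (C := L * |τ|)
    (fun σ _ => (hd σ).hasDerivWithinAt) (fun σ hσ => ?_) Set.left_mem_uIcc Set.right_mem_uIcc
  · have h0 : ‖φ (x + τ • basisVec i) - φ x - τ * pderiv i φ x‖
        = ‖(φ (x + τ • basisVec i) - τ * pderiv i φ x)
          - (φ (x + (0 : ℝ) • basisVec i) - ((0 : ℝ) : ℂ) * pderiv i φ x)‖ := by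
      congr 1
      simp
      ring
    rw [h0]
    refine this.trans (le_of_eq ?_)
    rw [sub_zero, Real.norm_eq_abs, mul_assoc, abs_mul_abs_self, sq]
  · rw [← dist_eq_norm]
    refine (hL.dist_le_mul _ _).trans ?_
    have h3 : |σ| ≤ |τ| := by simpa using Set.abs_sub_left_of_mem_uIcc hσ
    rw [dist_self_add_left, norm_smul, hb, mul_one, Real.norm_eq_abs]
    gcongr

theorem T_of_mem {x : E n} {ω : Om n} (h : x + (ω.2 : E n) ∈ cell n) :
    T x ω = (ω.1, ⟨x + ω.2, h⟩) := by
  have h1 : ∀ i, ⌊x i + (ω.2 : E n) i⌋ = 0 := fun i => Int.floor_eq_zero_iff.2 (h i)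
  refine Prod.ext ?_ (Subtype.ext ?_)
  · funext j
    simp only [T, h1]
    exact congrArg ω.1 (add_zero j)
  · ext i
    exact Int.fract_eq_self.2 (h i)

/-- The points that stay at distance `ε` from the boundary of the cell under all the dilations by
sizes in `[r₁, r₂]`. -/
def innerRegion (n : ℕ) (r₁ r₂ ε : ℝ) : Set (E n) :=
  {x | ∀ s ∈ Set.Icc r₁ r₂, ∀ j, dil s x j ∈ Set.Icc ε (1 - ε)}

theorem mem_cell_of_Icc {ε : ℝ} (hε : 0 < ε) {y : E n} (h : ∀ j, y j ∈ Set.Icc ε (1 - ε)) :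
    y ∈ cell n :=
  fun j => ⟨hε.le.trans (h j).1, (h j).2.trans_lt (by linarith)⟩

section Deriv

variable (μ : Measure ℝ) [IsProbabilityMeasure μ] {r₁ r₂ : ℝ}

/-- A rescaled function supported away from the boundary of the cell is translated along with the
dynamical system, as long as the translation is small: no lattice point is passed. -/
theorem indicator_blow_T (hI : IsRange r₁ r₂) {ε t : ℝ} (hε : 0 < ε) (ht : |t| < ε)
    (h : ((Fin n → ℤ) → ℝ) → ℂ) {φ : E n → ℂ} (hφ : ∀ x ∉ innerRegion n r₁ r₂ ε, φ x = 0)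
    (i : Fin n) (ω : Om n) :
    (sizeSetOm n r₁ r₂).indicator (fun ω => h ω.1 * φ (dil (ω.1 0)⁻¹ ω.2)) (T (t • basisVec i) ω) =
      (sizeSetOm n r₁ r₂).indicator
        (fun ω => h ω.1 * φ (dil (ω.1 0)⁻¹ ω.2 + (t * (ω.1 0)⁻¹) • basisVec i)) ω := by
  have hdil : ∀ s : ℝ, dil s⁻¹ (t • basisVec i + (ω.2 : E n))
      = dil s⁻¹ ω.2 + (t * s⁻¹) • basisVec i := by
    intro s
    simp only [dil]
    module
  by_cases hc : t • basisVec i + (ω.2 : E n) ∈ cell n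
  · rw [T_of_mem hc]
    by_cases hω : ω ∈ sizeSetOm n r₁ r₂
    · rw [Set.indicator_of_mem hω, Set.indicator_of_mem (by exact hω), hdil]
    · rw [Set.indicator_of_notMem hω, Set.indicator_of_notMem (by exact hω)]
  · have h1 : (sizeSetOm n r₁ r₂).indicator
        (fun ω => h ω.1 * φ (dil (ω.1 0)⁻¹ ω.2 + (t * (ω.1 0)⁻¹) • basisVec i)) ω = 0 := by
      refine Set.indicator_apply_eq_zero.2 fun hω => ?_
      rw [← hdil, hφ, mul_zero]
      intro hx
      have h2 := hx (ω.1 0) hω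
      rw [dil_dil_inv (hI.pos.trans_le hω.1).ne'] at h2
      exact hc (mem_cell_of_Icc hε h2)
    rw [h1]
    refine Set.indicator_apply_eq_zero.2 fun hω => ?_
    rw [hφ, mul_zero]
    intro hx
    have h2 := hx _ hω
    rw [dil_dil_inv (hI.pos.trans_le hω.1).ne'] at h2
    refine hc fun j => ?_
    have h3 : Int.fract ((t • basisVec i : E n) j + (ω.2 : E n) j) ∈ Set.Icc ε (1 - ε) := h2 j
    have h4 : |(t • basisVec i : E n) j| < ε := by
      simp only [basisVec, PiLp.smul_apply, PiLp.single_apply, smul_eq_mul]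
      split_ifs
      · simpa using ht
      · simpa using hε
    have h5 := ω.2.2 j
    have h6 := Int.floor_add_fract ((t • basisVec i : E n) j + (ω.2 : E n) j)
    rw [abs_lt] at h4
    have h7 : ⌊(t • basisVec i : E n) j + (ω.2 : E n) j⌋ = 0 := by
      have a1 : ((⌊(t • basisVec i : E n) j + (ω.2 : E n) j⌋ : ℤ) : ℝ) < (1 : ℤ) := by
        push_cast
        linarith [h3.1, h5.2]
      have a2 : ((-1 : ℤ) : ℝ) < (⌊(t • basisVec i : E n) j + (ω.2 : E n) j⌋ : ℤ) := by
        push_cast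
        linarith [h3.2, h5.1]
      have := Int.cast_lt.1 a1
      have := Int.cast_lt.1 a2
      omega
    exact Int.floor_eq_zero_iff.1 h7

/-- The class in `L²(ℝⁿ)` of a test function. -/
def IsTest.lp {D : Set (E n)} {φ : E n → ℂ} (h : IsTest D φ) : Lp ℂ 2 (volume : Measure (E n)) :=
  (h.memLp volume).toLp φ

theorem IsTest.coeFn_lp {D : Set (E n)} {φ : E n → ℂ} (h : IsTest D φ) : h.lp =ᵐ[volume] φ :=
  (h.memLp volume).coeFn_toLp

/-- A function in `L²(ℝⁿ)` whose rescalings equal one on the cell. -/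
theorem exists_blow_bound (hI : IsRange r₁ r₂) : ∃ χ : Lp ℂ 2 (volume : Measure (E n)),
    ∀ h : Lp ℂ 2 (sizeMeasure n μ r₁ r₂),
      blow μ hI h χ =ᵐ[prob n μ] (sizeSetOm n r₁ r₂).indicator fun ω => h ω.1 := by
  have hm := measurableSet_cube (n := n) (-r₁⁻¹) (1 + r₁⁻¹)
  have hfin : volume {y : E n | ∀ i, y i ∈ Set.Ico (-r₁⁻¹) (1 + r₁⁻¹)} ≠ ⊤ := by
    rw [volume_cube]
    finiteness
  refine ⟨indicatorConstLp 2 hm hfin 1, fun h => ?_⟩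
  refine (coeFn_blow_of_ae μ hI (EventuallyEq.refl _ _) indicatorConstLp_coeFn).trans
    (Eventually.of_forall fun ω => ?_)
  by_cases hω : ω ∈ sizeSetOm n r₁ r₂
  swap
  · rw [Set.indicator_of_notMem hω, Set.indicator_of_notMem hω]
  rw [Set.indicator_of_mem hω, Set.indicator_of_mem hω]
  have hmem : dil (ω.1 0)⁻¹ (ω.2 : E n) ∈ {y : E n | ∀ i, y i ∈ Set.Ico (-r₁⁻¹) (1 + r₁⁻¹)} := by
    intro i
    have h1 : (ω.1 0)⁻¹ ≤ r₁⁻¹ := inv_anti₀ hI.pos hω.1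
    have h2 : 0 < (ω.1 0)⁻¹ := inv_pos.2 (hI.pos.trans_le hω.1)
    have h3 := ω.2.2 i
    simp only [dil, cellCentre, PiLp.add_apply, PiLp.smul_apply, PiLp.sub_apply, smul_eq_mul]
    constructor <;> nlinarith [h3.1, h3.2]
  rw [Set.indicator_of_mem hmem, mul_one]

/-- Rescaled test functions are stochastically differentiable. -/
theorem hasDerivAt_blow_test (hI : IsRange r₁ r₂) {ε : ℝ} (hε : 0 < ε)
    {h h₁ : Lp ℂ 2 (sizeMeasure n μ r₁ r₂)}
    (hh : h₁ =ᵐ[sizeMeasure n μ r₁ r₂] fun w => ((w 0)⁻¹ : ℝ) * h w) {φ : E n → ℂ}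
    (hφ : IsTest (innerRegion n r₁ r₂ ε) φ) (i : Fin n) :
    HasDerivAt (fun t => grp μ i t (blow μ hI h hφ.lp)) (blow μ hI h₁ (hφ.pderiv i).lp) 0 := by
  obtain ⟨K, hK, hKφ⟩ := exists_taylor_bound hφ i
  obtain ⟨χ, hχ⟩ := exists_blow_bound (n := n) μ hI
  have hmain : ∀ t : ℝ, |t| < ε → ‖grp μ i t (blow μ hI h hφ.lp) - blow μ hI h hφ.lp
      - t • blow μ hI h₁ (hφ.pderiv i).lp‖ ≤ (K * (t * r₁⁻¹) ^ 2) * ‖blow μ hI h χ‖ := by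
    intro t ht
    apply Lp.norm_le_mul_norm_of_ae_le_mul
    have hb := coeFn_blow_of_ae μ hI (EventuallyEq.refl _ h) hφ.coeFn_lp
    filter_upwards [hχ h, hb, (measurePreserving_T μ (t • basisVec i)).quasiMeasurePreserving.ae hb,
      coeFn_grp μ i t (blow μ hI h hφ.lp), coeFn_blow_of_ae μ hI hh (hφ.pderiv i).coeFn_lp,
      Lp.coeFn_sub (grp μ i t (blow μ hI h hφ.lp) - blow μ hI h hφ.lp)
        (t • blow μ hI h₁ (hφ.pderiv i).lp),
      Lp.coeFn_sub (grp μ i t (blow μ hI h hφ.lp)) (blow μ hI h hφ.lp),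
      Lp.coeFn_smul t (blow μ hI h₁ (hφ.pderiv i).lp)] with ω e1 e2 e3 e4 e5 e6 e7 e8
    rw [e6, Pi.sub_apply, e7, Pi.sub_apply, e8, Pi.smul_apply, e1, e4, e3, e2, e5,
      indicator_blow_T hI hε ht _ fun x hx => hφ.eq_zero_of_notMem hx]
    by_cases hω : ω ∈ sizeSetOm n r₁ r₂
    · simp only [Set.indicator_of_mem hω]
      have h1 : h ω.1 * φ (dil (ω.1 0)⁻¹ ω.2 + (t * (ω.1 0)⁻¹) • basisVec i)
          - h ω.1 * φ (dil (ω.1 0)⁻¹ ω.2)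
          - t • (((ω.1 0)⁻¹ : ℝ) * h ω.1 * pderiv i φ (dil (ω.1 0)⁻¹ ω.2))
          = (φ (dil (ω.1 0)⁻¹ ω.2 + (t * (ω.1 0)⁻¹) • basisVec i) - φ (dil (ω.1 0)⁻¹ ω.2)
            - ((t * (ω.1 0)⁻¹ : ℝ) : ℂ) * pderiv i φ (dil (ω.1 0)⁻¹ ω.2)) * h ω.1 := by
        rw [Complex.real_smul]
        push_cast
        ring
      rw [h1, norm_mul]
      refine mul_le_mul_of_nonneg_right ((hKφ _ _).trans ?_) (norm_nonneg _)
      have h2 : (ω.1 0)⁻¹ ≤ r₁⁻¹ := inv_anti₀ hI.pos hω.1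
      have h3 : 0 < (ω.1 0)⁻¹ := inv_pos.2 (hI.pos.trans_le hω.1)
      rw [mul_pow, mul_pow]
      gcongr
    · simp [Set.indicator_of_notMem hω]
  rw [hasDerivAt_iff_isLittleO_nhds_zero]
  refine Asymptotics.IsBigO.trans_isLittleO (g := fun t : ℝ => t ^ 2) ?_ ?_
  · refine Asymptotics.IsBigO.of_bound (K * r₁⁻¹ ^ 2 * ‖blow μ hI h χ‖) ?_
    filter_upwards [Metric.ball_mem_nhds (0 : ℝ) hε] with t ht
    rw [zero_add, grp_zero]
    refine (hmain t (by simpa using ht)).trans (le_of_eq ?_)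
    rw [Real.norm_of_nonneg (sq_nonneg t)]
    ring
  · exact Asymptotics.isLittleO_pow_id one_lt_two

end Deriv

/-! ### Separation of variables on the random inclusion -/

theorem extL2_resL2_of_ae {α : Type*} [MeasurableSpace α] {μ : Measure α} {s : Set α}
    (hs : MeasurableSet s) {f : Lp ℂ 2 μ} (hf : ∀ᵐ x ∂μ, x ∉ s → f x = 0) :
    extL2 μ hs (resL2 μ s f) = f := by
  apply Lp.ext
  filter_upwards [coeFn_extL2_resL2 hs f, hf] with x h1 h2
  rw [h1]
  by_cases hx : x ∈ s
  · rw [Set.indicator_of_mem hx]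
  · rw [Set.indicator_of_notMem hx, h2 hx]

theorem extL2_ae_zero {α : Type*} [MeasurableSpace α] {μ : Measure α} {s : Set α}
    (hs : MeasurableSet s) (f : Lp ℂ 2 (μ.restrict s)) : ∀ᵐ x ∂μ, x ∉ s → extL2 μ hs f x = 0 := by
  filter_upwards [coeFn_extL2 hs f] with x h hx
  rw [h, Set.indicator_of_notMem hx]

/-- Rectangles suffice to test the vanishing of integrals over preimages of sets in a product. -/
theorem setIntegral_preimage_eq_zero {α β γ : Type*} [MeasurableSpace α] [MeasurableSpace β]
    [MeasurableSpace γ] {P : Measure α} {f : α → β × γ} (hf : Measurable f) {F : α → ℂ}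
    (hFi : Integrable F P) (hrect : ∀ (A : Set β) (B : Set γ), MeasurableSet A → MeasurableSet B →
      ∫ ω in f ⁻¹' (A ×ˢ B), F ω ∂P = 0) {Z : Set (β × γ)} (hZ : MeasurableSet Z) :
    ∫ ω in f ⁻¹' Z, F ω ∂P = 0 := by
  have huniv : ∫ ω, F ω ∂P = 0 := by
    simpa using hrect Set.univ Set.univ MeasurableSet.univ MeasurableSet.univ
  induction Z, hZ using MeasurableSpace.induction_on_inter generateFrom_prod.symm
    isPiSystem_prod with
  | empty => simp
  | basic t ht =>
    obtain ⟨A, hA, B, hB, rfl⟩ := ht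
    exact hrect A B hA hB
  | compl t ht h =>
    have := integral_add_compl (hf ht) hFi
    rw [h, huniv, zero_add] at this
    exact this
  | iUnion g hd hm h =>
    rw [Set.preimage_iUnion, integral_iUnion (fun i => hf (hm i))
      (fun i j hij => (hd hij).preimage _) hFi.integrableOn]
    simp [h]

section Separation

variable (μ : Measure ℝ) [IsProbabilityMeasure μ] {r₁ r₂ : ℝ} {D : Set (E n)}

theorem mem_inclusionSet_iff (hI : IsRange r₁ r₂) {ω : Om n} :
    ω ∈ inclusionSet D r₁ r₂ ↔ ω ∈ sizeSetOm n r₁ r₂ ∧ dil (ω.1 0)⁻¹ ω.2 ∈ D := by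
  refine and_congr_right fun h => ?_
  rw [scaled_eq_preimage (hI.pos.trans_le h.1).ne']
  rfl

theorem measurableSet_inclusionSet (hI : IsRange r₁ r₂) (hD : MeasurableSet D) :
    MeasurableSet (inclusionSet D r₁ r₂) := by
  have : inclusionSet D r₁ r₂ = sizeSetOm n r₁ r₂ ∩ (fun ω => (blowUp ω).2) ⁻¹' D := by
    ext ω
    exact mem_inclusionSet_iff hI
  rw [this]
  exact (measurableSet_sizeSetOm r₁ r₂).inter (measurable_blowUp.snd hD)

theorem blow_ae_zero (hI : IsRange r₁ r₂) (h : Lp ℂ 2 (sizeMeasure n μ r₁ r₂))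
    {ψ : Lp ℂ 2 (volume : Measure (E n))} (hψ : ∀ᵐ x, x ∉ D → ψ x = 0) :
    ∀ᵐ ω ∂prob n μ, ω ∉ inclusionSet D r₁ r₂ → blow μ hI h ψ ω = 0 := by
  have h1 := (ae_restrict_iff' (measurableSet_sizeSetOm r₁ r₂)).1
    ((quasiMeasurePreserving_blowUp μ hI).ae (Measure.quasiMeasurePreserving_snd.ae hψ))
  filter_upwards [coeFn_blow μ hI h ψ, h1] with ω h2 h3 hω
  rw [h2]
  refine Set.indicator_apply_eq_zero.2 fun hs => ?_
  have h4 := h3 hs fun hx => hω ((mem_inclusionSet_iff hI).2 ⟨hs, hx⟩)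
  change h ω.1 * ψ (blowUp ω).2 = 0
  rw [h4, mul_zero]

/-- The function `h(ω̃) ψ(y^c + ω̃₀⁻¹ (y - y^c))` on the random inclusion. -/
def blowO (hI : IsRange r₁ r₂) (hD : MeasurableSet D) (h : Lp ℂ 2 (sizeMeasure n μ r₁ r₂))
    (ψ : L2 D) : L2O μ (inclusionSet D r₁ r₂) :=
  resL2 _ _ (blow μ hI h (extL2 volume hD ψ))

theorem extL2_blowO (hI : IsRange r₁ r₂) (hD : MeasurableSet D)
    (h : Lp ℂ 2 (sizeMeasure n μ r₁ r₂)) (ψ : L2 D) :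
    extL2 (prob n μ) (measurableSet_inclusionSet hI hD) (blowO μ hI hD h ψ)
      = blow μ hI h (extL2 volume hD ψ) :=
  extL2_resL2_of_ae _ (blow_ae_zero μ hI h (extL2_ae_zero hD ψ))

theorem inner_blowO (hI : IsRange r₁ r₂) (hD : MeasurableSet D) (hsub : D ⊆ cell n)
    (h h' : Lp ℂ 2 (sizeMeasure n μ r₁ r₂)) (ψ ψ' : L2 D) :
    inner ℂ (blowO μ hI hD h ψ) (blowO μ hI hD h' ψ') = inner ℂ h h' * inner ℂ ψ ψ' := by
  rw [← (extL2 (prob n μ) (measurableSet_inclusionSet hI hD)).inner_map_map, extL2_blowO,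
    extL2_blowO, inner_blow, LinearIsometry.inner_map_map]
  filter_upwards [extL2_ae_zero hD ψ] with x hx hc using hx fun h => hc (hsub h)

/-- On `{ω̃₀ ∈ [r₁, r₂]}` the rescaling is injective with measurable inverse, so that every
measurable set is a preimage there. -/
theorem exists_preimage_blowUp (hI : IsRange r₁ r₂) {Q : Set (Om n)} (hQ : MeasurableSet Q) :
    ∃ Z, MeasurableSet Z ∧ ∀ ω ∈ sizeSetOm n r₁ r₂, ω ∈ blowUp ⁻¹' Z ↔ ω ∈ Q := by
  have hemb : MeasurableEmbedding fun ω : Om n => (ω.1, (ω.2 : E n)) :=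
    MeasurableEmbedding.id.prodMap (MeasurableEmbedding.subtype_coe measurableSet_cell)
  have hm : Measurable fun p : ((Fin n → ℤ) → ℝ) × E n => (p.1, dil (p.1 0) p.2) :=
    measurable_fst.prodMk measurable_dil_fst
  refine ⟨_, hm (hemb.measurableSet_image.2 hQ), fun ω hs => ?_⟩
  have h1 : ((blowUp ω).1, dil ((blowUp ω).1 0) (blowUp ω).2) = (ω.1, (ω.2 : E n)) := by
    simp only [blowUp, dil_dil_inv (hI.pos.trans_le hs.1).ne']
  rw [Set.mem_preimage, Set.mem_preimage, h1]
  exact hemb.injective.mem_set_image (a := ω)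

/-- The products `h(ω̃) ψ(y^c + ω̃₀⁻¹ (y - y^c))` span a dense subspace. -/
theorem eq_zero_of_inner_blowO (hI : IsRange r₁ r₂) (hD : MeasurableSet D) (hsub : D ⊆ cell n)
    {F : L2O μ (inclusionSet D r₁ r₂)} (hF : ∀ h ψ, inner ℂ (blowO μ hI hD h ψ) F = 0) :
    F = 0 := by
  have hfin : IsFiniteMeasure (volume.restrict D) :=
    ⟨by rw [Measure.restrict_apply_univ]; exact volume_lt_top_of_subset_cell hsub⟩
  have hfin' := isFiniteMeasure_sizeMeasure (n := n) μ r₁ r₂ hI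
  set P := (prob n μ).restrict (inclusionSet D r₁ r₂) with hP
  have hFi : Integrable F P := (Lp.memLp F).integrable (by norm_num)
  have hmemO : ∀ᵐ ω ∂P, ω ∈ inclusionSet D r₁ r₂ :=
    ae_restrict_mem (measurableSet_inclusionSet hI hD)
  have hrect : ∀ (A : Set ((Fin n → ℤ) → ℝ)) (B : Set (E n)), MeasurableSet A → MeasurableSet B →
      ∫ ω in blowUp ⁻¹' (A ×ˢ B), F ω ∂P = 0 := by
    intro A B hA hB
    obtain ⟨h, hh⟩ : ∃ h : Lp ℂ 2 (sizeMeasure n μ r₁ r₂),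
        h =ᵐ[sizeMeasure n μ r₁ r₂] A.indicator fun _ => 1 :=
      ⟨indicatorConstLp 2 hA (measure_ne_top _ _) 1, indicatorConstLp_coeFn⟩
    obtain ⟨ψ, hψ⟩ : ∃ ψ : L2 D, ψ =ᵐ[volume.restrict D] B.indicator fun _ => 1 :=
      ⟨indicatorConstLp 2 hB (measure_ne_top _ _) 1, indicatorConstLp_coeFn⟩
    rw [← hF h ψ, L2.inner_def, ← integral_indicator (measurable_blowUp (hA.prod hB))]
    refine integral_congr_ae ?_
    have h1 := coeFn_blow_of_ae μ hI hh
      ((coeFn_extL2 hD ψ).trans ((ae_eq_restrict_iff_indicator_ae_eq hD).1 hψ))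
    filter_upwards [hmemO, ae_restrict_of_ae h1, coeFn_resL2 (s := inclusionSet D r₁ r₂)
      (blow μ hI h (extL2 volume hD ψ))] with ω h2 h3 h4
    obtain ⟨h5, h6⟩ := (mem_inclusionSet_iff hI).1 h2
    have h7 : blowO μ hI hD h ψ ω = _ := h4.trans h3
    rw [h7, Set.indicator_of_mem h5, Set.indicator_of_mem h6]
    by_cases ha : ω.1 ∈ A
    · by_cases hb : dil (ω.1 0)⁻¹ (ω.2 : E n) ∈ B
      · have : ω ∈ blowUp ⁻¹' (A ×ˢ B) := ⟨ha, hb⟩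
        simp [Set.indicator_of_mem this, ha, hb]
      · have : ω ∉ blowUp ⁻¹' (A ×ˢ B) := fun h => hb h.2
        simp [Set.indicator_of_notMem this, hb]
    · have : ω ∉ blowUp ⁻¹' (A ×ˢ B) := fun h => ha h.1
      simp [Set.indicator_of_notMem this, ha]
  have hall : ∀ Z : Set (((Fin n → ℤ) → ℝ) × E n), MeasurableSet Z →
      ∫ ω in blowUp ⁻¹' Z, F ω ∂P = 0 := by
    exact fun Z hZ => setIntegral_preimage_eq_zero measurable_blowUp hFi hrect hZ
  apply Lp.ext
  refine EventuallyEq.trans ?_ (Lp.coeFn_zero _ _ _).symm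
  refine hFi.ae_eq_zero_of_forall_setIntegral_eq_zero fun Q hQ _ => ?_
  obtain ⟨Z, hZ, hQZ⟩ := exists_preimage_blowUp hI hQ
  rw [← hall Z hZ]
  refine setIntegral_congr_set ?_
  filter_upwards [hmemO] with ω hω
  exact propext (hQZ ω ((mem_inclusionSet_iff hI).1 hω).1).symm

end Separation

/-! ### The form domain on the random inclusion -/

/-- The vectors with continuous orbits form a closed set. -/
theorem isClosed_continuousAt_group {H : Type*} [NormedAddCommGroup H] [InnerProductSpace ℂ H]
    (U : ℝ → H →ₗᵢ[ℂ] H) : IsClosed {f | ContinuousAt (fun t => U t f) 0} := by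
  refine isClosed_of_closure_subset fun f hf => ?_
  change ContinuousAt (fun t => U t f) 0
  refine Metric.continuousAt_iff.2 fun ε hε => ?_
  obtain ⟨g, hg, hfg⟩ := Metric.mem_closure_iff.1 hf (ε / 3) (by positivity)
  obtain ⟨δ, hδ, h⟩ := Metric.continuousAt_iff.1
    (show ContinuousAt (fun t => U t g) 0 from hg) (ε / 3) (by positivity)
  refine ⟨δ, hδ, fun t ht => ?_⟩
  have h1 := dist_triangle4 (U t f) (U t g) (U 0 g) (U 0 f)
  rw [(U t).isometry.dist_eq, (U 0).isometry.dist_eq, dist_comm g f] at h1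
  linarith [h ht]

theorem mem_innerRegion {r₁ r₂ ρ : ℝ} (hI : IsRange r₁ r₂) {x : E n}
    (hx : ∀ j, |x j - 1 / 2| ≤ ρ) : x ∈ innerRegion n r₁ r₂ (1 / 2 - r₂ * ρ) := by
  intro s hs j
  have h0 : 0 < s := hI.pos.trans_le hs.1
  have h1 := abs_le.1 (hx j)
  have hρ : 0 ≤ ρ := (abs_nonneg _).trans (hx j)
  have h2 : s * ρ ≤ r₂ * ρ := by
    gcongr
    exact hs.2
  simp only [dil, cellCentre, PiLp.add_apply, PiLp.smul_apply, PiLp.sub_apply, smul_eq_mul]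
  constructor <;> nlinarith [h1.1, h1.2]

theorem cell_subset_innerRegion {r₁ r₂ : ℝ} (hI : IsRange r₁ r₂) :
    cell n ⊆ innerRegion n r₁ r₂ (1 / 2 - r₂ * (1 / 2)) := fun x hx =>
  mem_innerRegion hI fun j => abs_le.2 ⟨by linarith [(hx j).1], by linarith [(hx j).2]⟩

section FormDomain

variable (μ : Measure ℝ) [IsProbabilityMeasure μ] {r₁ r₂ : ℝ} {D : Set (E n)}

/-- Multiplication of a function of the sizes by a bounded function of the size `ω̃₀`. -/
def sizeMul (a : ℝ → ℂ) (C : ℝ) (ha : Measurable a) (hC : ∀ s ∈ Set.Icc r₁ r₂, ‖a s‖ ≤ C) :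
    Lp ℂ 2 (sizeMeasure n μ r₁ r₂) →L[ℂ] Lp ℂ 2 (sizeMeasure n μ r₁ r₂) :=
  mulL2 (sizeMeasure n μ r₁ r₂) (fun w => a (w 0)) C
    (ha.comp (measurable_pi_apply 0)).aestronglyMeasurable
    ((ae_mem_sizeSet μ r₁ r₂).mono fun _ hw => hC _ hw)

theorem coeFn_sizeMul {a : ℝ → ℂ} {C : ℝ} (ha : Measurable a)
    (hC : ∀ s ∈ Set.Icc r₁ r₂, ‖a s‖ ≤ C) (h : Lp ℂ 2 (sizeMeasure n μ r₁ r₂)) :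
    sizeMul μ a C ha hC h =ᵐ[sizeMeasure n μ r₁ r₂] fun w => a (w 0) * h w :=
  coeFn_mulL2 _ _ h

theorem exists_inv_size_mul (hI : IsRange r₁ r₂) (h : Lp ℂ 2 (sizeMeasure n μ r₁ r₂)) :
    ∃ h₁ : Lp ℂ 2 (sizeMeasure n μ r₁ r₂),
      h₁ =ᵐ[sizeMeasure n μ r₁ r₂] fun w => ((w 0)⁻¹ : ℝ) * h w := by
  have hm : Measurable fun s : ℝ => ((s⁻¹ : ℝ) : ℂ) := by fun_prop
  refine ⟨sizeMul μ (fun s => ((s⁻¹ : ℝ) : ℂ)) r₁⁻¹ hm (fun s hs => ?_) h, coeFn_sizeMul μ hm _ h⟩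
  have h0 : 0 < s := hI.pos.trans_le hs.1
  rw [Complex.norm_real, Real.norm_of_nonneg (inv_nonneg.2 h0.le)]
  exact inv_anti₀ hI.pos hs.1

theorem extL2_testPair {φ : E n → ℂ} (hD : MeasurableSet D) (hφ : IsTest D φ) :
    extL2 volume hD (testPair hφ).1 = hφ.lp := by
  apply Lp.ext
  refine ((coeFn_extL2 hD _).trans ((ae_eq_restrict_iff_indicator_ae_eq hD).1
    (hφ.memLp _).coeFn_toLp)).trans (EventuallyEq.trans ?_ hφ.coeFn_lp.symm)
  refine Eventually.of_forall fun x => ?_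
  by_cases hx : x ∈ D
  · rw [Set.indicator_of_mem hx]
  · rw [Set.indicator_of_notMem hx, hφ.eq_zero_of_notMem hx]

theorem extL2_testPair_snd {φ : E n → ℂ} (hD : MeasurableSet D) (hφ : IsTest D φ) (i : Fin n) :
    extL2 volume hD ((testPair hφ).2 i) = (hφ.pderiv i).lp :=
  extL2_testPair hD (hφ.pderiv i)

/-- Rescaled functions from `W₀^{1,2}(D)` are stochastically differentiable. -/
theorem hasDerivAt_blow (hI : IsRange r₁ r₂) (hD : MeasurableSet D) (hsub : D ⊆ cell n)
    {h h₁ : Lp ℂ 2 (sizeMeasure n μ r₁ r₂)}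
    (hh : h₁ =ᵐ[sizeMeasure n μ r₁ r₂] fun w => ((w 0)⁻¹ : ℝ) * h w)
    {p : L2 D × (Fin n → L2 D)} (hp : p ∈ dirichletGradient D) (i : Fin n) :
    HasDerivAt (fun t => grp μ i t (blow μ hI h (extL2 volume hD p.1)))
      (blow μ hI h₁ (extL2 volume hD (p.2 i))) 0 := by
  refine dirichletGradient_induction (P := fun p => HasDerivAt
    (fun t => grp μ i t (blow μ hI h (extL2 volume hD p.1)))
      (blow μ hI h₁ (extL2 volume hD (p.2 i))) 0) (IsSeqClosed.isClosed ?_) (fun φ hφ => ?_) hp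
  · intro q q₀ hq hlim
    have c1 : Continuous fun q : L2 D × (Fin n → L2 D) => blow μ hI h (extL2 volume hD q.1) := by
      fun_prop
    have c2 : Continuous fun q : L2 D × (Fin n → L2 D) =>
        blow μ hI h₁ (extL2 volume hD (q.2 i)) := by
      fun_prop
    exact hasDerivAt_group_of_tendsto (grp_add μ i) hq ((c1.tendsto q₀).comp hlim)
      ((c2.tendsto q₀).comp hlim) (grp_zero μ i)
  · simp only [extL2_testPair, extL2_testPair_snd]
    exact hasDerivAt_blow_test μ hI (by nlinarith [hI.lt_one]) hh
      (hφ.mono (hsub.trans (cell_subset_innerRegion hI))) i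

/-- The dynamical system acts continuously on rescaled functions. -/
theorem continuousAt_grp_blow (hI : IsRange r₁ r₂) (hopen : IsOpen D) (hsub : D ⊆ cell n)
    (h : Lp ℂ 2 (sizeMeasure n μ r₁ r₂)) (ψ : L2 D) (i : Fin n) :
    ContinuousAt (fun t => grp μ i t (blow μ hI h (extL2 volume hopen.measurableSet ψ))) 0 := by
  let F : L2 D → Prop := fun ψ => ContinuousAt
    (fun t => grp μ i t (blow μ hI h (extL2 volume hopen.measurableSet ψ))) 0
  let M : Submodule ℂ (L2 D) :=
    { carrier := {ψ | F ψ}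
      zero_mem' := by simp only [Set.mem_ofPred_eq, F, map_zero, continuousAt_const]
      add_mem' := fun {a b} ha hb => by
        simp only [Set.mem_ofPred_eq, F, map_add] at *
        exact ha.add hb
      smul_mem' := fun c a ha => by
        simp only [Set.mem_ofPred_eq, F, map_smul] at *
        exact ha.const_smul c }
  have hc : IsClosed (M : Set (L2 D)) :=
    (isClosed_continuousAt_group (grp μ i)).preimage
      (f := fun ψ : L2 D => blow μ hI h (extL2 volume hopen.measurableSet ψ)) (by fun_prop)
  have htop : M = ⊤ := by
    rw [← hc.submodule_topologicalClosure_eq, Submodule.topologicalClosure_eq_top_iff,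
      Submodule.eq_bot_iff]
    intro f hf
    refine eq_zero_of_inner_test hopen f fun φ hφ => hf _ ?_
    obtain ⟨h₁, hh⟩ := exists_inv_size_mul (n := n) μ hI h
    have := hasDerivAt_blow μ hI hopen.measurableSet hsub hh
      (p := testPair hφ) (by rw [dirichletGradient_eq]; exact subset_closure (testPair_mem hφ)) i
    exact this.continuousAt
  have : ψ ∈ M := htop ▸ Submodule.mem_top
  exact this

/-- Stochastic derivatives of functions vanishing outside the random inclusion vanish there. -/
theorem ae_zero_of_hasDerivAt (hI : IsRange r₁ r₂) (hopen : IsOpen D) (hsub : D ⊆ cell n)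
    {i : Fin n} {V d : Lp ℂ 2 (prob n μ)}
    (hV : ∀ᵐ ω ∂prob n μ, ω ∉ inclusionSet D r₁ r₂ → V ω = 0)
    (h : HasDerivAt (fun t => grp μ i t V) d 0) :
    ∀ᵐ ω ∂prob n μ, ω ∉ inclusionSet D r₁ r₂ → d ω = 0 := by
  have hO := measurableSet_inclusionSet (D := D) hI hopen.measurableSet
  set O := inclusionSet D r₁ r₂ with hOdef
  -- the indicator of `O` has a continuous orbit
  obtain ⟨a, ha, hac⟩ : ∃ a : Lp ℂ 2 (prob n μ), a =ᵐ[prob n μ] O.indicator (fun _ => 1) ∧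
      ContinuousAt (fun t => grp μ i t a) 0 := by
    have hfin : IsFiniteMeasure (volume.restrict D) :=
      ⟨by rw [Measure.restrict_apply_univ]; exact volume_lt_top_of_subset_cell hsub⟩
    have hfin' := isFiniteMeasure_sizeMeasure (n := n) μ r₁ r₂ hI
    refine ⟨_, ?_, continuousAt_grp_blow μ hI hopen hsub
      (indicatorConstLp 2 MeasurableSet.univ (measure_ne_top _ _) 1)
      (indicatorConstLp 2 MeasurableSet.univ (measure_ne_top _ _) 1) i⟩
    refine (coeFn_blow_of_ae μ hI indicatorConstLp_coeFn ((coeFn_extL2 hopen.measurableSet _).trans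
      ((ae_eq_restrict_iff_indicator_ae_eq hopen.measurableSet).1 indicatorConstLp_coeFn))).trans
      (Eventually.of_forall fun ω => ?_)
    by_cases hω : ω ∈ sizeSetOm n r₁ r₂
    · by_cases hd : dil (ω.1 0)⁻¹ (ω.2 : E n) ∈ D
      · rw [Set.indicator_of_mem hω, Set.indicator_of_mem ((mem_inclusionSet_iff hI).2 ⟨hω, hd⟩)]
        simp [hd]
      · rw [Set.indicator_of_mem hω,
          Set.indicator_of_notMem fun h => hd ((mem_inclusionSet_iff hI).1 h).2]
        simp [hd]
    · rw [Set.indicator_of_notMem hω,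
        Set.indicator_of_notMem fun h => hω ((mem_inclusionSet_iff hI).1 h).1]
  have key : ∀ Z, MeasurableSet Z → Z ⊆ Oᶜ → ∫ ω in Z, d ω ∂prob n μ = 0 := by
    intro Z hZ hZO
    set w : Lp ℂ 2 (prob n μ) := indicatorConstLp 2 hZ (measure_ne_top _ _) 1 with hw
    have hb : ∀ᵐ ω ∂prob n μ, ‖Z.indicator (fun _ => (1 : ℂ)) ω‖ ≤ 1 :=
      Eventually.of_forall fun ω => by
        by_cases hω : ω ∈ Z <;> simp [hω]
    have hbm : AEStronglyMeasurable (Z.indicator fun _ => (1 : ℂ)) (prob n μ) :=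
      (measurable_const.indicator hZ).aestronglyMeasurable
    set m := mulL2 (prob n μ) (Z.indicator fun _ => (1 : ℂ)) 1 hbm hb with hm
    rw [← L2.inner_indicatorConstLp_one (𝕜 := ℂ) hZ (measure_ne_top _ _) d]
    have hs := hasDerivAt_iff_tendsto_slope.1 h
    -- on `Z` the difference quotient lives where the indicator of `O` has changed
    have heq : ∀ t : ℝ, inner ℂ w (slope (fun t => grp μ i t V) 0 t)
        = inner ℂ (m (grp μ i t a - grp μ i 0 a)) (slope (fun t => grp μ i t V) 0 t) := by
      intro t
      rw [L2.inner_def, L2.inner_def]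
      refine integral_congr_ae ?_
      have hq := (measurePreserving_T μ (t • basisVec i)).quasiMeasurePreserving
      rw [slope_def_module, grp_zero, grp_zero]
      filter_upwards [Lp.coeFn_smul (t - 0)⁻¹ (grp μ i t V - V), Lp.coeFn_sub (grp μ i t V) V,
        coeFn_grp μ i t V, hV, hq.ae hV, coeFn_mulL2 hbm hb (grp μ i t a - a),
        Lp.coeFn_sub (grp μ i t a) a, coeFn_grp μ i t a, ha, hq.ae ha,
        indicatorConstLp_coeFn (p := 2) (hs := hZ) (hμs := measure_ne_top (prob n μ) Z)
          (c := (1 : ℂ))] with ω e1 e2 e3 e4 e5 e6 e7 e8 e9 e10 e11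
      rw [hm, e6, e7, Pi.sub_apply, e8, e9, e10, hw, e11]
      by_cases hωZ : ω ∈ Z
      · have hωO : ω ∉ O := hZO hωZ
        rw [Set.indicator_of_mem hωZ, Set.indicator_of_notMem hωO, one_mul]
        by_cases hT : T (t • basisVec i) ω ∈ O
        · rw [Set.indicator_of_mem hT, sub_zero (1 : ℂ)]
        · rw [e1, Pi.smul_apply, e2, Pi.sub_apply, e3, e4 hωO, e5 hT]
          simp
      · rw [Set.indicator_of_notMem hωZ, zero_mul]
    have hm1 : ‖m‖ ≤ 1 := norm_mulL2_le zero_le_one hbm hb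
    have hlim0 : Tendsto (fun t => m (grp μ i t a - grp μ i 0 a)) (𝓝[≠] 0) (𝓝 0) := by
      have h1 : Tendsto (fun t => grp μ i t a - grp μ i 0 a) (𝓝[≠] 0) (𝓝 0) := by
        have := (hac.tendsto.mono_left (nhdsWithin_le_nhds (s := {0}ᶜ))).sub_const
          (grp μ i 0 a)
        rwa [sub_self] at this
      have h2 := (m.continuous.tendsto 0).comp h1
      rwa [map_zero] at h2
    have h2 := hlim0.inner (𝕜 := ℂ) hs
    rw [inner_zero_left] at h2
    refine tendsto_nhds_unique ((tendsto_const_nhds.inner (𝕜 := ℂ) hs).congr heq) h2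
  have hint : Integrable d (prob n μ) := (Lp.memLp d).integrable (by norm_num)
  have := hint.restrict (s := Oᶜ)
  have h0 := this.ae_eq_zero_of_forall_setIntegral_eq_zero fun s hs _ => by
    rw [Measure.restrict_restrict hs]
    exact key _ (hs.inter hO.compl) Set.inter_subset_right
  exact (ae_restrict_iff' hO.compl).1 h0

theorem mem_stochGradient_iff_hasDerivAt (hI : IsRange r₁ r₂) (hopen : IsOpen D)
    (hsub : D ⊆ cell n) {v : L2O μ (inclusionSet D r₁ r₂)}
    {g : Fin n → L2O μ (inclusionSet D r₁ r₂)} :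
    (v, g) ∈ stochGradient μ (inclusionSet D r₁ r₂) ↔ ∀ i, HasDerivAt
      (fun t => grp μ i t (extL2 (prob n μ) (measurableSet_inclusionSet hI hopen.measurableSet) v))
      (extL2 (prob n μ) (measurableSet_inclusionSet hI hopen.measurableSet) (g i)) 0 := by
  have hO := measurableSet_inclusionSet (D := D) hI hopen.measurableSet
  rw [mem_stochGradient_iff μ hO]
  refine forall_congr' fun i => ⟨?_, fun h => ⟨_, h, (resL2_extL2 hO (g i)).symm⟩⟩
  rintro ⟨d, hd, hg⟩
  rwa [hg, extL2_resL2_of_ae hO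
    (ae_zero_of_hasDerivAt μ hI hopen hsub (extL2_ae_zero hO v) hd)]

/-- The graph of the stochastic gradient on the random inclusion is a closed subspace. -/
theorem exists_submodule_stochGradient (hI : IsRange r₁ r₂) (hopen : IsOpen D)
    (hsub : D ⊆ cell n) : ∃ G : Submodule ℂ (L2O μ (inclusionSet D r₁ r₂) ×
      (Fin n → L2O μ (inclusionSet D r₁ r₂))),
      (G : Set (L2O μ (inclusionSet D r₁ r₂) × (Fin n → L2O μ (inclusionSet D r₁ r₂))))
        = stochGradient μ (inclusionSet D r₁ r₂) ∧
      IsClosed (G : Set (L2O μ (inclusionSet D r₁ r₂) ×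
        (Fin n → L2O μ (inclusionSet D r₁ r₂)))) := by
  have hO := measurableSet_inclusionSet (D := D) hI hopen.measurableSet
  have key : ∀ p : L2O μ (inclusionSet D r₁ r₂) × (Fin n → L2O μ (inclusionSet D r₁ r₂)),
      p ∈ stochGradient μ (inclusionSet D r₁ r₂) ↔ ∀ i, HasDerivAt
      (fun t => grp μ i t (extL2 (prob n μ) hO p.1)) (extL2 (prob n μ) hO (p.2 i)) 0 := fun p =>
    mem_stochGradient_iff_hasDerivAt μ hI hopen hsub
  refine ⟨⟨⟨⟨stochGradient μ (inclusionSet D r₁ r₂), ?_⟩, ?_⟩, ?_⟩, rfl, IsSeqClosed.isClosed ?_⟩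
  · intro p q hp hq
    rw [key] at *
    intro i
    simp only [Prod.fst_add, Prod.snd_add, Pi.add_apply, map_add]
    exact (hp i).add (hq i)
  · rw [key]
    intro i
    simpa using hasDerivAt_const (0 : ℝ) (0 : Lp ℂ 2 (prob n μ))
  · intro c p hp
    rw [key] at *
    intro i
    simp only [Prod.smul_fst, Prod.smul_snd, Pi.smul_apply, map_smul]
    exact (hp i).const_smul c
  · intro q q₀ hq hlim
    refine (key q₀).2 fun i => ?_
    have c1 : Continuous fun q : L2O μ (inclusionSet D r₁ r₂) ×
      (Fin n → L2O μ (inclusionSet D r₁ r₂)) => extL2 (prob n μ) hO q.1 := by fun_prop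
    have c2 : Continuous fun q : L2O μ (inclusionSet D r₁ r₂) ×
      (Fin n → L2O μ (inclusionSet D r₁ r₂)) => extL2 (prob n μ) hO (q.2 i) := by fun_prop
    exact hasDerivAt_group_of_tendsto (grp_add μ i) (fun k => (key _).1 (hq k) i)
      ((c1.tendsto q₀).comp hlim) ((c2.tendsto q₀).comp hlim) (grp_zero μ i)

end FormDomain

/-! ### Averages over the sizes and the Dirichlet Laplacian -/

open scoped Manifold in
/-- A cut-off function that is one near a subset of the cell. -/
theorem exists_cutoff {r₁ r₂ : ℝ} (hI : IsRange r₁ r₂) {D : Set (E n)} (hsub : D ⊆ cell n) :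
    ∃ ε : ℝ, 0 < ε ∧ ∃ ζ : E n → ℝ, ContDiff ℝ ((⊤ : ℕ∞) : WithTop ℕ∞) ζ ∧
      tsupport ζ ⊆ innerRegion n r₁ r₂ ε ∧ ∀ x ∈ D, ∀ᶠ y in 𝓝 x, ζ y = 1 := by
  set ρ : ℝ := 1 / (1 + r₂) with hρ
  have hr₂ : 0 < r₂ := hI.pos.trans hI.lt
  have hρ1 : r₂ * ρ < 1 / 2 := by
    rw [hρ, mul_one_div, div_lt_div_iff₀ (by positivity) (by positivity)]
    linarith [hI.lt_one]
  have hρ2 : 1 / 2 < ρ := by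
    rw [hρ, div_lt_div_iff₀ (by positivity) (by positivity)]
    linarith [hI.lt_one]
  have hcl : ∀ ρ : ℝ, IsClosed {x : E n | ∀ j, |x j - 1 / 2| ≤ ρ} := fun ρ => by
    simp only [Set.ofPred_forall]
    exact isClosed_iInter fun j => isClosed_le (by fun_prop) continuous_const
  have hop : IsOpen {x : E n | ∀ j, |x j - 1 / 2| < ρ} := by
    simp only [Set.ofPred_forall]
    exact isOpen_iInter_of_finite fun j => isOpen_lt (by fun_prop) continuous_const
  obtain ⟨f, h1, h2, -⟩ := exists_contMDiffMap_one_nhds_of_subset_interior (n := (⊤ : ℕ∞))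
    𝓘(ℝ, E n) (hcl (1 / 2)) (t := {x : E n | ∀ j, |x j - 1 / 2| ≤ ρ})
    (fun x hx => interior_mono (fun y hy j => (hy j).le) (hop.interior_eq.symm ▸
      fun j => (hx j).trans_lt hρ2 : x ∈ interior {x : E n | ∀ j, |x j - 1 / 2| < ρ}))
  refine ⟨1 / 2 - r₂ * ρ, by linarith, f, f.contMDiff.contDiff, ?_, fun x hx => ?_⟩
  · refine (closure_minimal (fun x hx => ?_) (hcl ρ)).trans fun x hx => mem_innerRegion hI hx
    by_contra hx'
    exact hx (h2 x hx')
  · refine (eventually_nhdsSet_iff_forall.1 h1) x fun j => ?_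
    have := hsub hx j
    exact abs_le.2 ⟨by linarith [this.1], by linarith [this.2]⟩

section Average

variable (μ : Measure ℝ) [IsProbabilityMeasure μ] {r₁ r₂ : ℝ} {D : Set (E n)}

/-- The average `∫ h̄(ω̃) v(ω̃, y^c + ω̃₀ (x - y^c)) dm(ω̃)` as a function of `x ∈ ℝⁿ`: the adjoint
of rescaling with a weight. -/
def average (hI : IsRange r₁ r₂) (h : Lp ℂ 2 (sizeMeasure n μ r₁ r₂)) :
    Lp ℂ 2 (prob n μ) →L[ℂ] Lp ℂ 2 (volume : Measure (E n)) :=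
  ContinuousLinearMap.adjoint (blow μ hI h)

theorem inner_average (hI : IsRange r₁ r₂) (h : Lp ℂ 2 (sizeMeasure n μ r₁ r₂))
    (V : Lp ℂ 2 (prob n μ)) (ψ : Lp ℂ 2 (volume : Measure (E n))) :
    inner ℂ ψ (average μ hI h V) = inner ℂ (blow μ hI h ψ) V :=
  ContinuousLinearMap.adjoint_inner_right _ _ _

theorem extL2_resL2_average (hI : IsRange r₁ r₂) (hD : MeasurableSet D)
    (h : Lp ℂ 2 (sizeMeasure n μ r₁ r₂)) (v : L2O μ (inclusionSet D r₁ r₂)) :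
    extL2 volume hD (resL2 volume D (average μ hI h
      (extL2 (prob n μ) (measurableSet_inclusionSet hI hD) v)))
      = average μ hI h (extL2 (prob n μ) (measurableSet_inclusionSet hI hD) v) := by
  have hO := measurableSet_inclusionSet (D := D) hI hD
  set b := average μ hI h (extL2 (prob n μ) hO v) with hb
  have hres : resL2 volume D (b - extL2 volume hD (resL2 volume D b)) = 0 := by
    rw [map_sub, resL2_extL2, sub_self]
  set ψ := b - extL2 volume hD (resL2 volume D b) with hψ
  have hψ0 : ∀ᵐ x, x ∉ Dᶜ → ψ x = 0 := by
    have h1 := (ae_restrict_iff' hD).1 (coeFn_resL2 (s := D) ψ)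
    rw [hres] at h1
    have h2 := (ae_restrict_iff' hD).1 (Lp.coeFn_zero ℂ 2 ((volume : Measure (E n)).restrict D))
    filter_upwards [h1, h2] with x h3 h4 hx
    rw [← h3 (not_not.1 hx), h4 (not_not.1 hx)]
    rfl
  have h1 : resL2 (prob n μ) (inclusionSet D r₁ r₂) (blow μ hI h ψ) = 0 := by
    apply Lp.ext
    filter_upwards [coeFn_resL2 (s := inclusionSet D r₁ r₂) (blow μ hI h ψ), ae_restrict_mem hO,
      ae_restrict_of_ae (blow_ae_zero μ hI h hψ0),
      Lp.coeFn_zero ℂ 2 ((prob n μ).restrict (inclusionSet D r₁ r₂))] with ω e1 e2 e3 e4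
    rw [e1, e4, e3]
    · rfl
    · exact fun hω => ((mem_inclusionSet_iff hI).1 hω).2 ((mem_inclusionSet_iff hI).1 e2).2
  have h2 : inner ℂ ψ b = 0 := by
    rw [hb, inner_average, ← inner_conj_symm, inner_extL2, h1, inner_zero_right, map_zero]
  have h3 : inner ℂ ψ (extL2 volume hD (resL2 volume D b)) = 0 := by
    rw [← inner_conj_symm, inner_extL2, hres, inner_zero_right, map_zero]
  have h4 : inner ℂ ψ ψ = 0 := by
    conv_lhs => rw [hψ]
    rw [← hψ, inner_sub_right, h2, h3, sub_zero]
  exact (sub_eq_zero.1 (inner_self_eq_zero.1 h4)).symm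

theorem inner_blowO_right (hI : IsRange r₁ r₂) (hD : MeasurableSet D)
    (w : L2O μ (inclusionSet D r₁ r₂)) (h : Lp ℂ 2 (sizeMeasure n μ r₁ r₂)) (ψ : L2 D) :
    inner ℂ w (blowO μ hI hD h ψ) = inner ℂ (resL2 volume D (average μ hI h
      (extL2 (prob n μ) (measurableSet_inclusionSet hI hD) w))) ψ := by
  rw [blowO, ← inner_extL2 (measurableSet_inclusionSet hI hD), ← inner_conj_symm, ← inner_average,
    inner_extL2, inner_conj_symm]

/-- Averages of functions from `W₀^{1,2}` of the random inclusion belong to `W₀^{1,2}(D)`. -/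
theorem average_mem_dirichletGradient (hI : IsRange r₁ r₂) (hopen : IsOpen D) (hsub : D ⊆ cell n)
    (hbdd : Bornology.IsBounded D) (hlip : HasLipschitzBoundary D)
    {h h₁ : Lp ℂ 2 (sizeMeasure n μ r₁ r₂)}
    (hh : h₁ =ᵐ[sizeMeasure n μ r₁ r₂] fun w => ((w 0)⁻¹ : ℝ) * h w)
    {v : L2O μ (inclusionSet D r₁ r₂)} {g : Fin n → L2O μ (inclusionSet D r₁ r₂)}
    (hvg : (v, g) ∈ stochGradient μ (inclusionSet D r₁ r₂)) :
    (resL2 volume D (average μ hI h₁ (extL2 (prob n μ)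
        (measurableSet_inclusionSet hI hopen.measurableSet) v)),
      fun i => resL2 volume D (average μ hI h (extL2 (prob n μ)
        (measurableSet_inclusionSet hI hopen.measurableSet) (g i)))) ∈ dirichletGradient D := by
  have hD := hopen.measurableSet
  have hO := measurableSet_inclusionSet (D := D) hI hD
  have hder := (mem_stochGradient_iff_hasDerivAt μ hI hopen hsub).1 hvg
  obtain ⟨ε, hε, ζ, hζ, hζs, hζ1⟩ := exists_cutoff hI hsub
  set b := average μ hI h₁ (extL2 (prob n μ) hO v) with hb
  set c : Fin n → Lp ℂ 2 (volume : Measure (E n)) :=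
    fun i => average μ hI h (extL2 (prob n μ) hO (g i)) with hc
  have hb0 : ∀ᵐ x, x ∉ D → b x = 0 := by
    have := extL2_ae_zero hD (resL2 volume D b)
    rwa [hb, extL2_resL2_average μ hI hD] at this
  have hc0 : ∀ i, ∀ᵐ x, x ∉ D → c i x = 0 := fun i => by
    have := extL2_ae_zero hD (resL2 volume D (c i))
    rwa [hc, extL2_resL2_average μ hI hD] at this
  have hbi : b =ᵐ[volume] D.indicator b := by
    filter_upwards [hb0] with x hx
    by_cases hxD : x ∈ D
    · rw [Set.indicator_of_mem hxD]
    · rw [Set.indicator_of_notMem hxD, hx hxD]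
  have hci : ∀ i, c i =ᵐ[volume] D.indicator (c i) := fun i => by
    filter_upwards [hc0 i] with x hx
    by_cases hxD : x ∈ D
    · rw [Set.indicator_of_mem hxD]
    · rw [Set.indicator_of_notMem hxD, hx hxD]
  have hbm : MemLp (D.indicator b) 2 volume := (memLp_congr_ae hbi).1 (Lp.memLp b)
  have hcm : ∀ i, MemLp (D.indicator (c i)) 2 volume := fun i =>
    (memLp_congr_ae (hci i)).1 (Lp.memLp (c i))
  have hweak : IsWeakGrad (D.indicator b) fun i => D.indicator (c i) := by
    intro η hη hηc i
    have hφ : IsTest (innerRegion n r₁ r₂ ε) fun x => ((ζ x * η x : ℝ) : ℂ) := by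
      refine ⟨Complex.ofRealCLM.contDiff.comp (hζ.mul hη),
        (hηc.mul_left (f := ζ)).comp_left (g := Complex.ofReal) (by simp), ?_⟩
      refine (closure_mono ?_).trans hζs
      intro x hx h0
      simp [h0] at hx
    have h1 := inner_group_deriv (grp_zero μ i) (hasDerivAt_blow_test μ hI hε hh hφ i) (hder i)
    rw [← inner_average, ← inner_average, L2.inner_def, L2.inner_def] at h1
    have hφD : ∀ x ∈ D, ((ζ x * η x : ℝ) : ℂ) = η x ∧
        pderiv i (fun x => ((ζ x * η x : ℝ) : ℂ)) x = (fderiv ℝ η x (basisVec i) : ℝ) := by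
      intro x hx
      have he : (fun x => ((ζ x * η x : ℝ) : ℂ)) =ᶠ[𝓝 x] fun x => (η x : ℂ) := by
        filter_upwards [hζ1 x hx] with y hy
        rw [hy, one_mul]
      refine ⟨he.eq_of_nhds, ?_⟩
      have hd : HasFDerivAt (fun x => (η x : ℂ)) (Complex.ofRealCLM ∘L fderiv ℝ η x) x :=
        Complex.ofRealCLM.hasFDerivAt.comp x (hη.differentiable (by simp) x).hasFDerivAt
      rw [pderiv, he.fderiv_eq, hd.fderiv]
      rfl
    have e1 : ∫ x, fderiv ℝ η x (basisVec i) • D.indicator b x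
        = ∫ x, inner ℂ ((hφ.pderiv i).lp x) (b x) := by
      refine integral_congr_ae ?_
      filter_upwards [(hφ.pderiv i).coeFn_lp, hb0] with x h2 h3
      by_cases hxD : x ∈ D
      · rw [Set.indicator_of_mem hxD, h2, (hφD x hxD).2]
        simp [mul_comm]
      · rw [Set.indicator_of_notMem hxD, h3 hxD]
        simp
    have e2 : ∫ x, η x • D.indicator (c i) x = ∫ x, inner ℂ (hφ.lp x) (c i x) := by
      refine integral_congr_ae ?_
      filter_upwards [hφ.coeFn_lp, hc0 i] with x h2 h3
      by_cases hxD : x ∈ D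
      · rw [Set.indicator_of_mem hxD, h2, (hφD x hxD).1]
        simp [mul_comm]
      · rw [Set.indicator_of_notMem hxD, h3 hxD]
        simp
    rw [e1, e2]
    exact h1
  have hmem := mem_dirichletGradient_of_isWeakGrad hopen hbdd hlip hbm
    ((Lp.stronglyMeasurable b).measurable.indicator hD) hcm
    (fun i => (Lp.stronglyMeasurable (c i)).measurable.indicator hD) hweak
    (fun x hx => Set.indicator_of_notMem hx _)
  have hcongr : ∀ {f : Lp ℂ 2 (volume : Measure (E n))} (hf : MemLp (D.indicator f) 2 volume),
      (hf.restrict D).toLp _ = resL2 volume D f := by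
    intro f hf
    apply Lp.ext
    filter_upwards [(hf.restrict D).coeFn_toLp, coeFn_resL2 (s := D) f, ae_restrict_mem hD]
      with x h1 h2 h3
    rw [h1, h2, Set.indicator_of_mem h3]
  have heq : ((hbm.restrict D).toLp _, fun i => ((hcm i).restrict D).toLp _) =
      (resL2 volume D b, fun i => resL2 volume D (c i)) :=
    Prod.ext (hcongr hbm) (funext fun i => hcongr (hcm i))
  rwa [heq] at hmem

/-- Separation of variables: eigenfunctions on the reference inclusion turn the operator on the
random inclusion into multiplication by `λ / ω̃₀²`. -/
theorem blowO_mem_stochLaplacian (hI : IsRange r₁ r₂) (hopen : IsOpen D) (hsub : D ⊆ cell n)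
    (hbdd : Bornology.IsBounded D) (hlip : HasLipschitzBoundary D)
    {h₀ h₁ h₂ : Lp ℂ 2 (sizeMeasure n μ r₁ r₂)}
    (hh₁ : h₁ =ᵐ[sizeMeasure n μ r₁ r₂] fun w => ((w 0)⁻¹ : ℝ) * h₀ w)
    (hh₂ : h₂ =ᵐ[sizeMeasure n μ r₁ r₂] fun w => ((w 0)⁻¹ : ℝ) * h₁ w)
    {e f : L2 D} (he : (e, f) ∈ dirichletLaplacian D) :
    (blowO μ hI hopen.measurableSet h₀ e, blowO μ hI hopen.measurableSet h₂ f)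
      ∈ stochLaplacian μ (inclusionSet D r₁ r₂) := by
  have hD := hopen.measurableSet
  have hO := measurableSet_inclusionSet (D := D) hI hD
  obtain ⟨g, hg, hgf⟩ := he
  refine ⟨fun i => blowO μ hI hD h₁ (g i), ?_, fun v w hvw => ?_⟩
  · rw [mem_stochGradient_iff_hasDerivAt μ hI hopen hsub]
    intro i
    simp only [extL2_blowO]
    exact hasDerivAt_blow μ hI hD hsub hh₁ hg i
  · simp only [inner_blowO_right]
    exact hgf _ _ (average_mem_dirichletGradient μ hI hopen hsub hbdd hlip hh₂ hvw)

end Average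

/-! ### Direct sums of multiplication operators -/

section Diagonal

variable {H W ι : Type*} [NormedAddCommGroup H] [InnerProductSpace ℂ H]
  [MeasurableSpace W] {m : Measure W}

/-- Uniformly bounded operators on the summands of a Hilbert sum define an operator on the sum. -/
theorem exists_diagonal_operator [CompleteSpace H] {M : Type*} [NormedAddCommGroup M]
    [InnerProductSpace ℂ M] [CompleteSpace M] {V : ι → M →ₗᵢ[ℂ] H}
    (hV : OrthogonalFamily ℂ (fun _ : ι => M) V)
    (htot : ∀ F, (∀ k h, inner ℂ (V k h) F = 0) → F = 0) (B : ι → M →L[ℂ] M) {C : ℝ}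
    (hC : 0 ≤ C) (hB : ∀ k, ‖B k‖ ≤ C) :
    ∃ R : H →L[ℂ] H, ∀ f k, (V k).toContinuousLinearMap.adjoint (R f)
      = B k ((V k).toContinuousLinearMap.adjoint f) := by
  classical
  have hsum : IsHilbertSum ℂ (fun _ : ι => M) V := by
    refine IsHilbertSum.mk hV (top_le_iff.2 ?_)
    rw [Submodule.topologicalClosure_eq_top_iff, Submodule.eq_bot_iff]
    intro F hF
    exact htot F fun k h => hF _ (Submodule.mem_iSup_of_mem k ⟨h, rfl⟩)
  have hc : ∀ u k, (V k).toContinuousLinearMap.adjoint u = hsum.linearIsometryEquiv u k := by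
    intro u k
    refine ext_inner_left ℂ fun h => ?_
    have h1 := lp.inner_single_left (𝕜 := ℂ) (G := fun _ : ι => M) k h (hsum.linearIsometryEquiv u)
    have h2 := hsum.linearIsometryEquiv.symm.inner_map_map (lp.single 2 k h)
      (hsum.linearIsometryEquiv u)
    rw [LinearIsometryEquiv.symm_apply_apply, hsum.linearIsometryEquiv_symm_apply_single] at h2
    rw [ContinuousLinearMap.adjoint_inner_right]
    exact h2.trans h1
  refine ⟨hsum.linearIsometryEquiv.symm.toContinuousLinearEquiv.toContinuousLinearMap ∘L
    lp.mapCLM 2 B hC hB ∘L hsum.linearIsometryEquiv.toContinuousLinearEquiv.toContinuousLinearMap,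
    fun f k => ?_⟩
  rw [hc, hc]
  change hsum.linearIsometryEquiv (hsum.linearIsometryEquiv.symm
    (lp.mapCLM 2 B hC hB (hsum.linearIsometryEquiv f))) k = _
  rw [LinearIsometryEquiv.apply_symm_apply]
  rfl

/-- The operator with graph `A` is, in suitable coordinates, the direct sum over `k` of the
operators of multiplication by `lam k * θ` on `L²(m)`. -/
structure IsDiagonal (A : Set (H × H)) (m : Measure W) (θ : W → ℝ) (lam : ι → ℝ) where
  /-- The embedding of the `k`-th summand. -/
  V : ι → Lp ℂ 2 m →ₗᵢ[ℂ] H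
  /-- The coordinate in the `k`-th summand. -/
  c : ι → H →L[ℂ] Lp ℂ 2 m
  /-- The `k`-th multiplication operator. -/
  mul : ι → Lp ℂ 2 m →L[ℂ] Lp ℂ 2 m
  inner_c : ∀ k h u, inner ℂ h (c k u) = inner ℂ (V k h) u
  c_V : ∀ k h, c k (V k h) = h
  c_V_ne : ∀ j k h, j ≠ k → c j (V k h) = 0
  ext : ∀ u u', (∀ k, c k u = c k u') → u = u'
  exists_operator : ∀ (B : ι → Lp ℂ 2 m →L[ℂ] Lp ℂ 2 m) (C : ℝ), 0 ≤ C → (∀ k, ‖B k‖ ≤ C) →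
    ∃ R : H →L[ℂ] H, ∀ f k, c k (R f) = B k (c k f)
  coeFn_mul : ∀ k h, mul k h =ᵐ[m] fun w => ((lam k * θ w : ℝ) : ℂ) * h w
  mem_iff : ∀ u f, (u, f) ∈ A ↔ ∀ k, c k f = mul k (c k u)

namespace IsDiagonal

variable {A : Set (H × H)} {θ : W → ℝ} {lam : ι → ℝ}

theorem single_valued {u f f' : H} (d : IsDiagonal A m θ lam) (h : (u, f) ∈ A) (h' : (u, f') ∈ A) :
    f = f' :=
  d.ext _ _ fun k => ((d.mem_iff u f).1 h k).trans ((d.mem_iff u f').1 h' k).symm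

theorem mem_shift_iff (d : IsDiagonal A m θ lam) {u f : H} {z : ℂ} :
    (u, f + z • u) ∈ A ↔ ∀ k, d.c k f = d.mul k (d.c k u) - z • d.c k u := by
  rw [d.mem_iff]
  refine forall_congr' fun k => ?_
  rw [map_add, map_smul, eq_sub_iff_add_eq]

theorem coeFn_mul_sub (d : IsDiagonal A m θ lam) (k : ι) (z : ℂ) (h : Lp ℂ 2 m) :
    (d.mul k h - z • h : Lp ℂ 2 m) =ᵐ[m] fun w => (((lam k * θ w : ℝ) : ℂ) - z) * h w := by
  filter_upwards [d.coeFn_mul k h, Lp.coeFn_sub (d.mul k h) (z • h), Lp.coeFn_smul z h]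
    with w h1 h2 h3
  rw [h2, Pi.sub_apply, h1, h3, Pi.smul_apply, smul_eq_mul, sub_mul]

/-- A multiplier without level sets of positive measure has no eigenfunctions. -/
theorem eq_zero_of_mul_sub_eq_zero (d : IsDiagonal A m θ lam) {k : ι} {z : ℂ}
    (hz : ∀ᵐ w ∂m, ((lam k * θ w : ℝ) : ℂ) ≠ z) {h : Lp ℂ 2 m} (hh : d.mul k h - z • h = 0) :
    h = 0 := by
  have h1 := d.coeFn_mul_sub k z h
  rw [hh] at h1
  apply Lp.ext
  filter_upwards [h1, hz, Lp.coeFn_zero ℂ 2 m] with w h2 h3 h4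
  rw [h4] at h2 ⊢
  exact (mul_eq_zero.1 h2.symm).resolve_left (sub_ne_zero.2 h3)

theorem eq_zero_of_eigen (d : IsDiagonal A m θ lam) {z : ℂ}
    (hz : ∀ k, ∀ᵐ w ∂m, ((lam k * θ w : ℝ) : ℂ) ≠ z) {u : H} (hu : (u, z • u) ∈ A) : u = 0 := by
  refine d.ext _ _ fun k => ?_
  rw [map_zero]
  refine d.eq_zero_of_mul_sub_eq_zero (hz k) ?_
  rw [← zero_add (z • u), d.mem_shift_iff] at hu
  rw [← hu k, map_zero]

theorem mem_opResolventSet (d : IsDiagonal A m θ lam) (hθ : Measurable θ) {z : ℂ} {C : ℝ}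
    (hC : 0 ≤ C) (hz : ∀ k, ∀ᵐ w ∂m, ((lam k * θ w : ℝ) : ℂ) ≠ z)
    (hzC : ∀ k, ∀ᵐ w ∂m, ‖(((lam k * θ w : ℝ) : ℂ) - z)⁻¹‖ ≤ C) : z ∈ opResolventSet A := by
  have hm : ∀ k, AEStronglyMeasurable (fun w => (((lam k * θ w : ℝ) : ℂ) - z)⁻¹) m := fun k =>
    Measurable.aestronglyMeasurable (by fun_prop)
  obtain ⟨R, hR⟩ := d.exists_operator (fun k => mulL2 m _ C (hm k) (hzC k)) C hC
    fun k => norm_mulL2_le hC _ _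
  refine ⟨R, fun u f => ?_⟩
  rw [d.mem_shift_iff]
  have key : ∀ k, d.c k f = d.mul k (d.c k u) - z • d.c k u ↔
      d.c k u = mulL2 m _ C (hm k) (hzC k) (d.c k f) := by
    intro k
    constructor
    · intro h
      apply Lp.ext
      have h1 := d.coeFn_mul_sub k z (d.c k u)
      rw [← h] at h1
      filter_upwards [coeFn_mulL2 (hm k) (hzC k) (d.c k f), h1, hz k] with w h2 h3 h4
      rw [h2, h3, inv_mul_cancel_left₀ (sub_ne_zero.2 h4)]
    · intro h
      apply Lp.ext
      filter_upwards [coeFn_mulL2 (hm k) (hzC k) (d.c k f), d.coeFn_mul_sub k z (d.c k u), hz k]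
        with w h2 h3 h4
      rw [h3, h, h2, mul_inv_cancel_left₀ (sub_ne_zero.2 h4)]
  simp_rw [key, ← hR]
  exact ⟨fun h => d.ext _ _ h, fun h k => by rw [h]⟩

/-- The image of the `k`-th summand under `A - z`. -/
theorem V_mem (d : IsDiagonal A m θ lam) (k : ι) (z : ℂ) (h : Lp ℂ 2 m) :
    (d.V k h, d.V k (d.mul k h - z • h) + z • d.V k h) ∈ A := by
  rw [d.mem_shift_iff]
  intro j
  by_cases hj : j = k
  · rw [hj, d.c_V, d.c_V]
  · rw [d.c_V_ne j k _ hj, d.c_V_ne j k _ hj, map_zero, smul_zero, sub_zero]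

/-- The essential range of each multiplier belongs to the spectrum. -/
theorem mem_opSpectrum (d : IsDiagonal A m θ lam) [IsFiniteMeasure m] (hθ : Measurable θ) {z : ℂ}
    {k : ι} (hz : ∀ ε : ℝ, 0 < ε → m {w | ‖((lam k * θ w : ℝ) : ℂ) - z‖ < ε} ≠ 0) :
    z ∈ opSpectrum A := by
  rintro ⟨R, hR⟩
  set ε : ℝ := (2 * (‖R‖ + 1))⁻¹ with hε
  have hpos : 0 < ε := by positivity
  have hS : MeasurableSet {w | ‖((lam k * θ w : ℝ) : ℂ) - z‖ < ε} :=
    measurableSet_lt (by fun_prop) measurable_const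
  set h : Lp ℂ 2 m := indicatorConstLp 2 hS (measure_ne_top _ _) 1 with hh
  have hnorm : 0 < ‖h‖ := by
    rw [hh, norm_indicatorConstLp (by norm_num) (by norm_num), norm_one, one_mul]
    refine Real.rpow_pos_of_pos ?_ _
    exact ENNReal.toReal_pos (hz ε hpos) (measure_ne_top _ _)
  have h1 : ‖d.mul k h - z • h‖ ≤ ε * ‖h‖ := by
    apply Lp.norm_le_mul_norm_of_ae_le_mul
    filter_upwards [d.coeFn_mul_sub k z h, indicatorConstLp_coeFn (p := 2) (hs := hS)
      (hμs := measure_ne_top m _) (c := (1 : ℂ))] with w h2 h3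
    rw [h2, norm_mul]
    by_cases hw : w ∈ {w | ‖((lam k * θ w : ℝ) : ℂ) - z‖ < ε}
    · exact mul_le_mul_of_nonneg_right (le_of_lt hw) (norm_nonneg _)
    · rw [hh, h3, Set.indicator_of_notMem hw, norm_zero, mul_zero, mul_zero]
  have h2 := (hR _ _).1 (d.V_mem k z h)
  have h3 : ‖h‖ ≤ ‖R‖ * (ε * ‖h‖) := by
    calc ‖h‖ = ‖R (d.V k (d.mul k h - z • h))‖ := by rw [← h2, (d.V k).norm_map]
      _ ≤ ‖R‖ * ‖d.V k (d.mul k h - z • h)‖ := R.le_opNorm _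
      _ ≤ ‖R‖ * (ε * ‖h‖) := by
        rw [(d.V k).norm_map]
        gcongr
  have h4 : ‖R‖ * ε < 1 := by
    rw [hε, ← div_eq_mul_inv, div_lt_one (by positivity)]
    linarith [norm_nonneg R]
  nlinarith

/-- If the multipliers have no level sets of positive measure, all the shifted operators have
dense range. -/
theorem dense_range (d : IsDiagonal A m θ lam)
    [CompleteSpace H] (hz : ∀ (z : ℂ) k, ∀ᵐ w ∂m, ((lam k * θ w : ℝ) : ℂ) ≠ z) (z : ℂ) :
    Dense {f : H | ∃ u : H, (u, f + z • u) ∈ A} := by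
  let N : Submodule ℂ H :=
    { carrier := {f : H | ∃ u : H, (u, f + z • u) ∈ A}
      zero_mem' := ⟨0, d.mem_shift_iff.2 fun k => by simp⟩
      add_mem' := by
        rintro f f' ⟨u, hu⟩ ⟨u', hu'⟩
        refine ⟨u + u', d.mem_shift_iff.2 fun k => ?_⟩
        rw [map_add, d.mem_shift_iff.1 hu k, d.mem_shift_iff.1 hu' k, map_add, map_add, smul_add]
        abel
      smul_mem' := by
        rintro a f ⟨u, hu⟩
        refine ⟨a • u, d.mem_shift_iff.2 fun k => ?_⟩
        rw [map_smul, d.mem_shift_iff.1 hu k, map_smul, map_smul, smul_sub, smul_comm z a] }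
  change Dense (N : Set H)
  rw [Submodule.dense_iff_topologicalClosure_eq_top, Submodule.topologicalClosure_eq_top_iff,
    Submodule.eq_bot_iff]
  intro F hF
  refine d.ext _ _ fun k => ?_
  rw [map_zero]
  set g := d.c k F with hg
  set conjz := (starRingEnd ℂ) z with hconjz
  -- the shifted multiplication operators are adjoint to each other
  have hadj : ∀ h, inner ℂ (d.mul k h - z • h) g = inner ℂ h (d.mul k g - conjz • g) := by
    intro h
    rw [L2.inner_def, L2.inner_def]
    refine integral_congr_ae ?_
    filter_upwards [d.coeFn_mul_sub k z h, d.coeFn_mul_sub k conjz g] with w h1 h2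
    rw [h1, h2]
    simp only [RCLike.inner_apply, map_mul, map_sub, Complex.conj_ofReal, hconjz]
    ring
  have hzero : d.mul k g - conjz • g = 0 := by
    rw [← inner_self_eq_zero (𝕜 := ℂ), ← hadj, hg, d.inner_c]
    exact hF _ ⟨_, d.V_mem k z _⟩
  exact d.eq_zero_of_mul_sub_eq_zero (hz conjz k) hzero

theorem opEigenvalues_eq_empty (d : IsDiagonal A m θ lam)
    (hz : ∀ (z : ℂ) k, ∀ᵐ w ∂m, ((lam k * θ w : ℝ) : ℂ) ≠ z) : opEigenvalues A = ∅ := by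
  refine Set.eq_empty_iff_forall_notMem.2 ?_
  rintro z ⟨u, hu, h⟩
  exact hu (d.eq_zero_of_eigen (hz z) h)

theorem opContinuousSpectrum_eq (d : IsDiagonal A m θ lam)
    [CompleteSpace H] (hz : ∀ (z : ℂ) k, ∀ᵐ w ∂m, ((lam k * θ w : ℝ) : ℂ) ≠ z) :
    opContinuousSpectrum A = opSpectrum A :=
  Set.Subset.antisymm (fun _ h => h.1) fun z h =>
    ⟨h, fun _ hu => d.eq_zero_of_eigen (hz z) hu, d.dense_range hz z⟩

end IsDiagonal

end Diagonal

/-! ### Diagonalisation of the operator on the random inclusion -/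

theorem isBounded_cell : Bornology.IsBounded (cell n) := by
  have h : IsCompact ((WithLp.toLp 2 : (Fin n → ℝ) → E n) ''
      (Set.univ.pi fun _ => Set.Icc (0 : ℝ) 1)) :=
    (isCompact_univ_pi fun _ => isCompact_Icc).image (PiLp.continuous_toLp 2 fun _ : Fin n => ℝ)
  refine h.isBounded.subset fun x hx => ⟨WithLp.ofLp x, fun i _ => ?_, rfl⟩
  exact ⟨(hx i).1, (hx i).2.le⟩

section Diagonalise

variable (μ : Measure ℝ) [IsProbabilityMeasure μ] {r₁ r₂ : ℝ} {D : Set (E n)}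

/-- The rescaling of a fixed normalised function as an isometry in the weight. -/
def blowIsometry (hI : IsRange r₁ r₂) (hD : MeasurableSet D) (hsub : D ⊆ cell n) (e : L2 D)
    (he : inner ℂ e e = 1) :
    Lp ℂ 2 (sizeMeasure n μ r₁ r₂) →ₗᵢ[ℂ] L2O μ (inclusionSet D r₁ r₂) :=
  LinearMap.isometryOfInner
    (resL2 (prob n μ) (inclusionSet D r₁ r₂) ∘L
      (blow μ hI).flip (extL2 volume hD e)).toLinearMap
    fun h h' => by
      have := inner_blowO μ hI hD hsub h h' e e
      rw [he, mul_one] at this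
      exact this

/-- Multiplication by `l / ω̃₀²`. -/
theorem exists_mul_inv_sq (hI : IsRange r₁ r₂) (l : ℝ) :
    ∃ Λ : Lp ℂ 2 (sizeMeasure n μ r₁ r₂) →L[ℂ] Lp ℂ 2 (sizeMeasure n μ r₁ r₂),
      ∀ h, Λ h =ᵐ[sizeMeasure n μ r₁ r₂] fun w => ((l * (w 0 ^ 2)⁻¹ : ℝ) : ℂ) * h w := by
  have hm : Measurable fun s : ℝ => ((l * (s ^ 2)⁻¹ : ℝ) : ℂ) := by fun_prop
  refine ⟨sizeMul μ _ (|l| * (r₁ ^ 2)⁻¹) hm fun s hs => ?_, fun h => coeFn_sizeMul μ hm _ h⟩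
  have h0 : 0 < s := hI.pos.trans_le hs.1
  rw [Complex.norm_real, norm_mul, Real.norm_eq_abs, Real.norm_of_nonneg (by positivity)]
  have : (s ^ 2)⁻¹ ≤ (r₁ ^ 2)⁻¹ := by
    have := hI.pos
    have := hs.1
    gcongr
  gcongr

theorem mul_inv_sq_symm {l : ℝ}
    {Λ : Lp ℂ 2 (sizeMeasure n μ r₁ r₂) →L[ℂ] Lp ℂ 2 (sizeMeasure n μ r₁ r₂)}
    (hΛ : ∀ h, Λ h =ᵐ[sizeMeasure n μ r₁ r₂] fun w => ((l * (w 0 ^ 2)⁻¹ : ℝ) : ℂ) * h w)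
    (h g : Lp ℂ 2 (sizeMeasure n μ r₁ r₂)) : inner ℂ (Λ h) g = inner ℂ h (Λ g) := by
  rw [L2.inner_def, L2.inner_def]
  refine integral_congr_ae ?_
  filter_upwards [hΛ h, hΛ g] with w h1 h2
  rw [h1, h2]
  simp only [RCLike.inner_apply, map_mul, Complex.conj_ofReal]
  ring

/-- Expanding in the Dirichlet eigenfunctions of the reference inclusion diagonalises the operator
on the random inclusion. -/
theorem exists_isDiagonal (hI : IsRange r₁ r₂) (hopen : IsOpen D) (hsub : D ⊆ cell n)
    (hlip : HasLipschitzBoundary D) {ι : Type} {e : ι → L2 D} {lam : ι → ℝ}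
    (ho : Orthonormal ℂ e) (htot : ∀ f, (∀ k, inner ℂ (e k) f = 0) → f = 0)
    (hpos : ∀ k, 0 < lam k) (he : ∀ k, (e k, (lam k : ℂ) • e k) ∈ dirichletLaplacian D) :
    Nonempty (IsDiagonal (randomSizeLaplacian D r₁ r₂ μ) (sizeMeasure n μ r₁ r₂)
      (fun w => (w 0 ^ 2)⁻¹) lam) := by
  have hD := hopen.measurableSet
  have he1 : ∀ k, inner ℂ (e k) (e k) = 1 := fun k => by
    rw [inner_self_eq_norm_sq_to_K, ho.1 k]
    simp
  obtain ⟨V, hV⟩ : ∃ V : ι → Lp ℂ 2 (sizeMeasure n μ r₁ r₂) →ₗᵢ[ℂ] L2O μ (inclusionSet D r₁ r₂),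
      ∀ k h, V k h = blowO μ hI hD h (e k) :=
    ⟨fun k => blowIsometry μ hI hD hsub (e k) (he1 k), fun k h => rfl⟩
  choose Λ hΛ using fun k => exists_mul_inv_sq (n := n) μ hI (lam k)
  have hVo : ∀ j k, j ≠ k → ∀ h h', inner ℂ (V j h) (V k h') = 0 := by
    intro j k hjk h h'
    rw [hV, hV, inner_blowO μ hI hD hsub, ho.2 hjk, mul_zero]
  have hVtot : ∀ F, (∀ k h, inner ℂ (V k h) F = 0) → F = 0 := by
    intro F hF
    refine eq_zero_of_inner_blowO μ hI hD hsub fun h ψ => ?_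
    have h0 : resL2 volume D (average μ hI h
        (extL2 (prob n μ) (measurableSet_inclusionSet hI hD) F)) = 0 := by
      refine htot _ fun k => ?_
      rw [← inner_conj_symm, ← inner_blowO_right μ hI hD, ← hV, inner_conj_symm, hF]
    rw [← inner_conj_symm, inner_blowO_right, h0, inner_zero_left, map_zero]
  have hVA : ∀ k h, (V k h, V k (Λ k h)) ∈ randomSizeLaplacian D r₁ r₂ μ := by
    intro k h
    obtain ⟨h₁, hh₁⟩ := exists_inv_size_mul (n := n) μ hI h
    obtain ⟨h₂, hh₂⟩ := exists_inv_size_mul (n := n) μ hI h₁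
    have h3 := blowO_mem_stochLaplacian μ hI hopen hsub (isBounded_cell.subset hsub) hlip
      hh₁ hh₂ (he k)
    have h4 : (lam k : ℂ) • h₂ = Λ k h := by
      apply Lp.ext
      filter_upwards [Lp.coeFn_smul (lam k : ℂ) h₂, hh₁, hh₂, hΛ k h] with w e1 e2 e3 e4
      rw [e1, Pi.smul_apply, e3, e2, e4, smul_eq_mul]
      push_cast
      ring
    have h5 : blowO μ hI hD h₂ ((lam k : ℂ) • e k) = V k (Λ k h) := by
      rw [← h4, map_smul, hV, blowO, blowO, map_smul, map_smul, map_smul]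
    rw [h5, ← hV] at h3
    exact h3
  have hc : ∀ k h u, inner ℂ h ((V k).toContinuousLinearMap.adjoint u) = inner ℂ (V k h) u :=
    fun k h u => ContinuousLinearMap.adjoint_inner_right _ _ _
  have hext : ∀ u u', (∀ k, (V k).toContinuousLinearMap.adjoint u
      = (V k).toContinuousLinearMap.adjoint u') → u = u' := by
    intro u u' h
    rw [← sub_eq_zero]
    refine hVtot _ fun k g => ?_
    rw [← hc, map_sub, h k, sub_self, inner_zero_right]
  have hmem : ∀ u f, (u, f) ∈ randomSizeLaplacian D r₁ r₂ μ →
      ∀ k, (V k).toContinuousLinearMap.adjoint f = Λ k ((V k).toContinuousLinearMap.adjoint u) := by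
    intro u f h k
    refine ext_inner_left ℂ fun g => ?_
    rw [hc, ← mul_inv_sq_symm μ (hΛ k), hc]
    exact formOperator_symm h (hVA k g)
  obtain ⟨G, hG, hGc⟩ := exists_submodule_stochGradient μ hI hopen hsub
  obtain ⟨X, _, _, _, ⟨F⟩⟩ := exists_formSpace G hGc
  rw [hG] at F
  exact ⟨{
    V := V
    c := fun k => (V k).toContinuousLinearMap.adjoint
    mul := Λ
    inner_c := hc
    c_V := fun k h => ext_inner_left ℂ fun g => by rw [hc, (V k).inner_map_map]
    c_V_ne := fun j k h hjk => ext_inner_left ℂ fun g => by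
      rw [hc, hVo j k hjk, inner_zero_right]
    ext := hext
    exists_operator := fun B C hC hB =>
      exists_diagonal_operator (fun j k hjk h h' => hVo j k hjk h h') hVtot B hC hB
    coeFn_mul := hΛ
    mem_iff := fun u f => ⟨hmem u f, fun h => by
      -- compare `u` with the solution `u'` of `(A + 1) u' = f + u`
      set u' := F.res (f + u) with hu'
      have h1 : (u', f + u - u') ∈ randomSizeLaplacian D r₁ r₂ μ := by
        refine F.mem_formOperator_iff.2 ?_
        rw [sub_add_cancel]
      have h2 : u = u' := by
        refine hext u u' fun k => ?_
        have h3 := hmem _ _ h1 k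
        rw [map_sub, map_add, h k] at h3
        rw [← sub_eq_zero]
        set δ := (V k).toContinuousLinearMap.adjoint u - (V k).toContinuousLinearMap.adjoint u'
          with hδ
        have h4 : Λ k δ + δ = 0 := by
          rw [hδ, map_sub, ← h3]
          abel
        apply Lp.ext
        have h5 := Lp.coeFn_add (Λ k δ) δ
        rw [h4] at h5
        filter_upwards [h5, hΛ k δ, Lp.coeFn_zero ℂ 2 (sizeMeasure n μ r₁ r₂)] with w e1 e2 e3
        rw [e3, Pi.add_apply, e2] at e1
        rw [e3]
        have e4 : (((lam k * (w 0 ^ 2)⁻¹ + 1 : ℝ) : ℂ)) * δ w = 0 := by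
          rw [Complex.ofReal_add, add_mul, Complex.ofReal_one, one_mul]
          exact e1.symm
        refine (mul_eq_zero.1 e4).resolve_left ?_
        have := hpos k
        exact_mod_cast (by positivity : (0 : ℝ) < lam k * (w 0 ^ 2)⁻¹ + 1).ne'
      refine F.mem_formOperator_iff.2 ?_
      rw [← hu', ← h2]⟩ }⟩

/-! ### The multipliers -/

/-- The multipliers have no level sets of positive measure. -/
theorem ae_mul_inv_sq_ne (hI : IsRange r₁ r₂) (hac : μ.restrict (Set.Icc r₁ r₂) ≪ volume)
    {l : ℝ} (hl : 0 < l) (z : ℂ) :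
    ∀ᵐ w ∂sizeMeasure n μ r₁ r₂, ((l * (w 0 ^ 2)⁻¹ : ℝ) : ℂ) ≠ z := by
  set S : Set ℝ := {s | s ∈ Set.Icc r₁ r₂ ∧ ((l * (s ^ 2)⁻¹ : ℝ) : ℂ) = z} with hS
  have hsub : S.Subsingleton := by
    rintro s ⟨hs, h1⟩ t ⟨ht, h2⟩
    have hs0 : 0 < s := hI.pos.trans_le hs.1
    have ht0 : 0 < t := hI.pos.trans_le ht.1
    have h3 : l * (s ^ 2)⁻¹ = l * (t ^ 2)⁻¹ := by exact_mod_cast h1.trans h2.symm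
    have h4 := inv_injective (mul_left_cancel₀ hl.ne' h3)
    exact (sq_eq_sq₀ hs0.le ht0.le).1 h4
  have hμS : μ S = 0 := by
    have := hac (hsub.measure_zero volume)
    rwa [Measure.restrict_apply hsub.measurableSet,
      Set.inter_eq_left.2 fun s hs => hs.1] at this
  have hP : ∀ᵐ w ∂Measure.infinitePi fun _ : Fin n → ℤ => μ, w 0 ∉ S := by
    have h1 : ∀ᵐ s ∂μ, s ∉ S := by
      rw [ae_iff]
      simpa using hμS
    exact (measurePreserving_eval_infinitePi (fun _ : Fin n → ℤ => μ)
      0).quasiMeasurePreserving.ae h1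
  have hm := (withDensity_absolutelyContinuous ((Measure.infinitePi fun _ : Fin n → ℤ =>
    μ).restrict (sizeSet n r₁ r₂)) fun w => ENNReal.ofReal (w 0 ^ n)).ae_le (ae_restrict_of_ae hP)
  filter_upwards [ae_mem_sizeSet μ r₁ r₂, hm] with w h1 h2 h3
  exact h2 ⟨h1, h3⟩

/-- Every value of a multiplier is an essential value. -/
theorem sizeMeasure_ne_zero (hI : IsRange r₁ r₂)
    (hsupp : ∀ a b : ℝ, r₁ ≤ a → a < b → b ≤ r₂ → 0 < μ (Set.Ioo a b)) (l : ℝ) {r : ℝ}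
    (hr : r ∈ Set.Icc r₁ r₂) {ε : ℝ} (hε : 0 < ε) :
    sizeMeasure n μ r₁ r₂ {w | ‖((l * (w 0 ^ 2)⁻¹ : ℝ) : ℂ) - ((l / r ^ 2 : ℝ) : ℂ)‖ < ε} ≠ 0 := by
  have hr0 : 0 < r := hI.pos.trans_le hr.1
  have hcont : ContinuousAt (fun s : ℝ => ((l * (s ^ 2)⁻¹ : ℝ) : ℂ)) r :=
    Complex.continuous_ofReal.continuousAt.comp
      (continuousAt_const.mul ((continuousAt_id.pow 2).inv₀ (pow_ne_zero 2 hr0.ne')))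
  obtain ⟨δ, hδ, hδε⟩ := Metric.continuousAt_iff.1 hcont ε hε
  have hlt := hI.lt
  have hab : max r₁ (r - δ) < min r₂ (r + δ) := by
    refine max_lt (lt_min hI.lt (by linarith [hr.1])) (lt_min (by linarith [hr.2]) (by linarith))
  have hpos := hsupp _ _ (le_max_left _ _) hab (min_le_left _ _)
  have hmeas : MeasurableSet {w : (Fin n → ℤ) → ℝ |
      ‖((l * (w 0 ^ 2)⁻¹ : ℝ) : ℂ) - ((l / r ^ 2 : ℝ) : ℂ)‖ < ε} :=
    measurableSet_lt (by fun_prop) measurable_const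
  intro h0
  rw [sizeMeasure, withDensity_apply_eq_zero (by fun_prop)] at h0
  refine hpos.ne' (le_antisymm ?_ zero_le)
  rw [← h0, ← (measurePreserving_eval_infinitePi (fun _ : Fin n → ℤ => μ) 0).measure_preimage
    measurableSet_Ioo.nullMeasurableSet, Measure.restrict_apply' (measurableSet_sizeSet r₁ r₂)]
  refine measure_mono fun w hw => ?_
  have h1 : r₁ ≤ w 0 ∧ r - δ < w 0 :=
    ⟨(le_max_left _ _).trans hw.1.le, (le_max_right _ _).trans_lt hw.1⟩
  have h2 : w 0 ≤ r₂ ∧ w 0 < r + δ :=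
    ⟨hw.2.le.trans (min_le_left _ _), hw.2.trans_le (min_le_right _ _)⟩
  have h3 : 0 < w 0 := hI.pos.trans_le h1.1
  refine ⟨⟨?_, ?_⟩, h1.1, h2.1⟩
  · exact (ENNReal.ofReal_pos.2 (by positivity)).ne'
  · have := hδε (x := w 0) (by rw [Real.dist_eq, abs_lt]; constructor <;> linarith [h1.2, h2.2])
    rwa [dist_eq_norm, ← div_eq_mul_inv l (r ^ 2)] at this

/-- Off the values of the multipliers, the multipliers are uniformly bounded away from `z`; this
uses that the eigenvalues accumulate at infinity only. -/
theorem exists_bound_inv (hI : IsRange r₁ r₂) {ι : Type} {lam : ι → ℝ} (hpos : ∀ k, 0 < lam k)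
    (hcomp : IsCompact (insert 0 (Set.range fun k => (1 + lam k)⁻¹))) {z : ℂ}
    (hz : ∀ k, ∀ s ∈ Set.Icc r₁ r₂, ((lam k / s ^ 2 : ℝ) : ℂ) ≠ z) :
    ∃ C : ℝ, 0 ≤ C ∧ ∀ k, ∀ s ∈ Set.Icc r₁ r₂, ‖(((lam k * (s ^ 2)⁻¹ : ℝ) : ℂ) - z)⁻¹‖ ≤ C := by
  set F : ℝ × ℝ → ℂ := fun p => 1 - p.1 - z * p.2 ^ 2 * p.1 with hF
  have hid : ∀ k s, 0 < s → F ((1 + lam k)⁻¹, s)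
      = ((s ^ 2 * (1 + lam k)⁻¹ : ℝ) : ℂ) * (((lam k * (s ^ 2)⁻¹ : ℝ) : ℂ) - z) := by
    intro k s hs
    have h1 : (1 + lam k : ℂ) ≠ 0 := by
      have := hpos k
      exact_mod_cast (by positivity : (0 : ℝ) < 1 + lam k).ne'
    have h2 : (s : ℂ) ≠ 0 := by exact_mod_cast hs.ne'
    simp only [hF]
    push_cast
    field_simp
    ring
  have hne : ∀ p ∈ (insert 0 (Set.range fun k => (1 + lam k)⁻¹)) ×ˢ Set.Icc r₁ r₂, F p ≠ 0 := by
    rintro ⟨κ, s⟩ ⟨hκ, hs⟩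
    have hs0 : 0 < s := hI.pos.trans_le hs.1
    rcases hκ with hκ | ⟨k, hk⟩
    · simp only at hκ
      simp [hF, hκ]
    · simp only at hk
      have := hpos k
      rw [← hk, hid k s hs0]
      refine mul_ne_zero ?_ (sub_ne_zero.2 ?_)
      · exact_mod_cast (by positivity : (0 : ℝ) < s ^ 2 * (1 + lam k)⁻¹).ne'
      · rw [← div_eq_mul_inv]
        exact hz k s hs
  obtain ⟨C, hC⟩ := (hcomp.prod isCompact_Icc).exists_bound_of_continuousOn (f := fun p => (F p)⁻¹)
    (ContinuousOn.inv₀ (by fun_prop) hne)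
  refine ⟨max C 0, le_max_right _ _, fun k s hs => ?_⟩
  have hs0 : 0 < s := hI.pos.trans_le hs.1
  have hl := hpos k
  have h1 := hC ((1 + lam k)⁻¹, s) ⟨Or.inr ⟨k, rfl⟩, hs⟩
  simp only [hid k s hs0] at h1
  set x := ((lam k * (s ^ 2)⁻¹ : ℝ) : ℂ) - z with hx
  have h2 : 0 < s ^ 2 * (1 + lam k)⁻¹ := by positivity
  have h3 : s ^ 2 * (1 + lam k)⁻¹ ≤ 1 := by
    have h4 : s ^ 2 ≤ 1 := pow_le_one₀ hs0.le (hs.2.trans hI.lt_one.le)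
    have h5 : (1 + lam k)⁻¹ ≤ 1 := inv_le_one_of_one_le₀ (by linarith)
    calc s ^ 2 * (1 + lam k)⁻¹ ≤ 1 * 1 := by gcongr
      _ = 1 := one_mul 1
  rw [norm_inv, norm_mul, Complex.norm_real, Real.norm_of_nonneg h2.le, mul_inv] at h1
  refine le_trans ?_ (h1.trans (le_max_left _ _))
  rw [norm_inv]
  refine le_mul_of_one_le_left (by positivity) ?_
  exact (one_le_inv₀ h2).2 h3

end Diagonalise

/-- The Dirichlet eigenvalues in terms of an eigenbasis. -/
theorem nuSet_union_nuPrimeSet {D : Set (E n)} {ι : Type} {e : ι → L2 D} {lam : ι → ℝ}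
    (ho : Orthonormal ℂ e) (htot : ∀ f, (∀ k, inner ℂ (e k) f = 0) → f = 0)
    (he : ∀ k, (e k, (lam k : ℂ) • e k) ∈ dirichletLaplacian D) :
    nuSet D ∪ nuPrimeSet D = Set.range lam := by
  ext ν
  constructor
  · rintro (⟨u, hu, h, -⟩ | ⟨u, hu, h, -⟩) <;> exact exists_eq_of_eigenvalue htot he hu h
  · rintro ⟨k, rfl⟩
    by_cases h : ∫ x in D, e k x = 0
    · exact Or.inr ⟨e k, ho.ne_zero k, he k, h⟩
    · exact Or.inl ⟨e k, ho.ne_zero k, he k, h⟩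

end

end RandomInclusion

theorem lemma7p3 (n : ℕ) (hn : 1 ≤ n)
    (Y₁ : Set (E n)) (hopen : IsOpen Y₁) (hne : Y₁.Nonempty)
    (hsub : Y₁ ⊆ cell n) (hlip : HasLipschitzBoundary Y₁)
    (r₁ r₂ : ℝ) (hr₁ : 0 < r₁) (hr : r₁ < r₂) (hr₂ : r₂ < 1)
    -- the common law of the random sizes, on `{0} ∪ [r₁, r₂]`
    (μ : Measure ℝ) [IsProbabilityMeasure μ]
    (hμ : μ ({0} ∪ Set.Icc r₁ r₂)ᶜ = 0)
    (hac : μ.restrict (Set.Icc r₁ r₂) ≪ volume)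
    -- every size in `[r₁, r₂]` can occur: the support of `μ` contains `[r₁, r₂]`
    (hsupp : ∀ a b : ℝ, r₁ ≤ a → a < b → b ≤ r₂ → 0 < μ (Set.Ioo a b)) :
    -- the form generates a single-valued operator
    (∀ u f f', (u, f) ∈ randomSizeLaplacian Y₁ r₁ r₂ μ →
      (u, f') ∈ randomSizeLaplacian Y₁ r₁ r₂ μ → f = f') ∧
    -- the spectrum
    opSpectrum (randomSizeLaplacian Y₁ r₁ r₂ μ) = (fun t : ℝ => (t : ℂ)) ''
      (⋃ r ∈ Set.Icc r₁ r₂, (nuSet (scaled Y₁ r) ∪ nuPrimeSet (scaled Y₁ r))) ∧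
    -- the scaling of the Dirichlet eigenvalues
    (∀ r ∈ Set.Icc r₁ r₂,
      nuSet (scaled Y₁ r) = (fun ν => ν / r ^ 2) '' nuSet Y₁ ∧
      nuPrimeSet (scaled Y₁ r) = (fun ν => ν / r ^ 2) '' nuPrimeSet Y₁) ∧
    -- there are no eigenvalues, and the spectrum is purely continuous
    opEigenvalues (randomSizeLaplacian Y₁ r₁ r₂ μ) = ∅ ∧
    opContinuousSpectrum (randomSizeLaplacian Y₁ r₁ r₂ μ) =
      opSpectrum (randomSizeLaplacian Y₁ r₁ r₂ μ) := by
  have hI : IsRange r₁ r₂ := ⟨hr₁, hr, hr₂⟩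
  obtain ⟨ι, e, lam, ho, htot, hpos, he, hcomp⟩ :=
    exists_dirichlet_eigenbasis (⟨0, hn⟩ : Fin n) hopen hsub
  obtain ⟨d⟩ := exists_isDiagonal μ hI hopen hsub hlip ho htot hpos he
  have hfin := isFiniteMeasure_sizeMeasure (n := n) μ r₁ r₂ hI
  have hθ : Measurable fun w : (Fin n → ℤ) → ℝ => (w 0 ^ 2)⁻¹ := by fun_prop
  have hz := fun (z : ℂ) k => ae_mul_inv_sq_ne (n := n) μ hI hac (hpos k) z
  have hscal : ∀ r ∈ Set.Icc r₁ r₂,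
      nuSet (scaled Y₁ r) = (fun ν => ν / r ^ 2) '' nuSet Y₁ ∧
      nuPrimeSet (scaled Y₁ r) = (fun ν => ν / r ^ 2) '' nuPrimeSet Y₁ := fun r h =>
    ⟨nuSet_scaled (hr₁.trans_le h.1), nuPrimeSet_scaled (hr₁.trans_le h.1)⟩
  refine ⟨fun u f f' => d.single_valued, ?_, hscal, d.opEigenvalues_eq_empty hz,
    d.opContinuousSpectrum_eq hz⟩
  have hunion : ∀ r ∈ Set.Icc r₁ r₂, nuSet (scaled Y₁ r) ∪ nuPrimeSet (scaled Y₁ r)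
      = Set.range fun k => lam k / r ^ 2 := by
    intro r h
    rw [(hscal r h).1, (hscal r h).2, ← Set.image_union, nuSet_union_nuPrimeSet ho htot he,
      ← Set.range_comp]
    rfl
  refine Set.Subset.antisymm (fun z hspec => ?_) ?_
  · by_contra hcon
    have hne : ∀ k, ∀ s ∈ Set.Icc r₁ r₂, ((lam k / s ^ 2 : ℝ) : ℂ) ≠ z := by
      intro k s hs h
      refine hcon ⟨lam k / s ^ 2, Set.mem_iUnion₂.2 ⟨s, hs, ?_⟩, h⟩
      rw [hunion s hs]
      exact ⟨k, rfl⟩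
    obtain ⟨C, hC, hCz⟩ := exists_bound_inv hI hpos hcomp hne
    exact hspec (d.mem_opResolventSet hθ hC (hz z) fun k =>
      (ae_mem_sizeSet μ r₁ r₂).mono fun w hw => hCz k _ hw)
  · rintro _ ⟨ν, hν, rfl⟩
    obtain ⟨r, h, hνr⟩ := Set.mem_iUnion₂.1 hν
    rw [hunion r h] at hνr
    obtain ⟨k, rfl⟩ := hνr
    exact d.mem_opSpectrum hθ fun ε hε => sizeMeasure_ne_zero μ hI hsupp (lam k) h hε
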